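/- For real $\beta>0$ and an integer $n\ge 0$ let $$F_{\beta,n}(\lambda)=C_\beta(n)\,\exp\Big(-\frac{\beta}{2}\sum_{j=1}^n\lambda_j^2\Big)\prod_{1\le i<j\le n}|\lambda_j-\lambda_i|^{\beta},\qquad \lambda\in\mathbb{R}^n,$$ where $C_\beta(n)>0$ is the normalization constant for which $\int_{\mathbb{R}^n}F_{\beta,n}\,d\lambda=1$ (so $C_\beta(0)=1$). The Gaussian $\beta$-ensemble $G_{\beta,n}$ is given, for arbitrary $\beta>0$, by the joint eigenvalue density $F_{\beta,n}$: the eigenvalues $(\lambda_1,\dots,\lambda_n)$ have this density, and $\det Q=\lambda_1\cdots\lambda_n$. For $\beta=1,2,4$, $G_{\beta,n}$ is also the ensemble of random Hermitian $n\times n$ matrices $Q$ over $\mathbb{R}$, $\mathbb{C}$, $\mathbb{H}$ respectively, with probability density proportional to $e^{-\frac{\beta}{2}\operatorname{tr}(Q^2)}$ (for $\beta=4$, $|\det Q|$ is the square root of the modulus of the determinant of the complex $2n\times 2n$ matrix representing $Q$). Let $$f_{\beta,n}(\varepsilon)=\mathbb{P}\{Q\in G_{\beta,n}\text{ has no eigenvalue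 in }(-\varepsilon,\varepsilon)\}$$ be the gap probability. Let $n\ge 1$. For every $\beta>0$, with $G_{\beta,n}$ and $G_{\beta,n-1}$ given by the joint eigenvalue densities, and also for $\beta=1,2,4$ with $G_{\beta,n}$ and $G_{\beta,n-1}$ the matrix ensembles, the following holds: $|\det Q|^\beta$ is integrable over $G_{\beta,n-1}$, the function $f_{\beta,n}$ is differentiable on $(0,\infty)$ and has a right derivative $f_{\beta,n}'(0)$ at $0$, and $$f_{\beta,n}'(0)=\lim_{\varepsilon\to0^+}f_{\beta,n}'(\varepsilon)=-2n\,\frac{C_\beta(n)}{C_\beta(n-1)}\,\mathbb{E}_{Q\in G_{\beta,n-1}}\big\{|\det Q|^\beta\big\}.$$ -/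

import Mathlib

open MeasureTheory ProbabilityTheory Filter Topology
open scoped NNReal

noncomputable section

namespace GapProbability

/-! ### The Gaussian `β`-ensemble for arbitrary `β > 0`, given by its joint eigenvalue density -/

/-- The unnormalized joint eigenvalue density
`exp (-(β/2) ∑ λ_j²) ∏_{i < j} |λ_j - λ_i| ^ β`. The product over `i < j` of `|λ_j - λ_i| ^ β` is
the product over ordered pairs `i ≠ j` of `|λ_j - λ_i| ^ (β/2)`. -/
def weight (β : ℝ) (n : ℕ) (x : Fin n → ℝ) : ℝ :=
  Real.exp (-(β / 2) * ∑ j, x j ^ 2) * ∏ i, ∏ j ∈ Finset.Ioi i, |x j - x i| ^ β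

/-- The normalization constant `C_β(n)` of the joint eigenvalue density. -/
def normConst (β : ℝ) (n : ℕ) : ℝ := (∫ x : Fin n → ℝ, weight β n x)⁻¹

/-- The joint eigenvalue density `F_{β,n}`. -/
def jointDensity (β : ℝ) (n : ℕ) (x : Fin n → ℝ) : ℝ := normConst β n * weight β n x

/-- The law of the eigenvalues `(λ_1, …, λ_n)` in the Gaussian `β`-ensemble. -/
def betaEnsemble (β : ℝ) (n : ℕ) : Measure (Fin n → ℝ) :=
  volume.withDensity fun x => ENNReal.ofReal (jointDensity β n x)

/-- The gap probability: no eigenvalue lies in `(-ε, ε)`. -/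
def betaGap (β : ℝ) (n : ℕ) (ε : ℝ) : ℝ :=
  (betaEnsemble β n).real {x | ∀ i, x i ∉ Set.Ioo (-ε) ε}

/-! ### The matrix ensembles over `ℝ` (`β = 1`), `ℂ` (`β = 2`) and the quaternions (`β = 4`) -/

/-- The independent real coordinates of a Hermitian `n × n` matrix over a real algebra of
dimension `d`: the diagonal entries, and the `d` components of each entry above the diagonal. -/
abbrev Coord (d n : ℕ) : Type :=
  (Fin n → ℝ) × ({p : Fin n × Fin n // p.1 < p.2} → Fin d → ℝ)

/-- The Hermitian matrix with given coordinates, where `e` is a real basis of `𝕂`. -/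
def hermitian {𝕂 : Type} [Ring 𝕂] [StarRing 𝕂] [Algebra ℝ 𝕂] {d n : ℕ} (e : Fin d → 𝕂)
    (ω : Coord d n) : Matrix (Fin n) (Fin n) 𝕂 :=
  Matrix.of fun i j =>
    if h : i < j then ∑ k, ω.2 ⟨(i, j), h⟩ k • e k
    else if h : j < i then star (∑ k, ω.2 ⟨(j, i), h⟩ k • e k)
    else algebraMap ℝ 𝕂 (ω.1 i)

/-- The Gaussian measure with density proportional to `exp (-(β/2) tr Q²)`, `β = d`, with respect
to the Lebesgue measure in the coordinates. As
`tr Q² = ∑ Q_ii² + 2 ∑_{i < j} |Q_ij|²`, the coordinates are independent centred Gaussians, with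
variance `1/β` on the diagonal and `1/(2β)` for every component off the diagonal. -/
def gaussianEnsemble (d n : ℕ) : Measure (Coord d n) :=
  (Measure.pi fun _ => gaussianReal 0 ((d : ℝ≥0)⁻¹)).prod
    (Measure.pi fun _ => Measure.pi fun _ => gaussianReal 0 ((2 * (d : ℝ≥0))⁻¹))

/-- `t` is a (necessarily real) eigenvalue of the Hermitian matrix `Q`. -/
def IsEigenvalue {𝕂 : Type} [Ring 𝕂] [Algebra ℝ 𝕂] {n : ℕ}
    (Q : Matrix (Fin n) (Fin n) 𝕂) (t : ℝ) : Prop :=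
  ∃ v : Fin n → 𝕂, v ≠ 0 ∧ Q.mulVec v = t • v

/-- The gap probability of the matrix ensemble: no eigenvalue lies in `(-ε, ε)`. -/
def matrixGap {𝕂 : Type} [Ring 𝕂] [StarRing 𝕂] [Algebra ℝ 𝕂] {d : ℕ} (e : Fin d → 𝕂)
    (n : ℕ) (ε : ℝ) : ℝ :=
  (gaussianEnsemble d n).real
    {ω | ∀ t ∈ Set.Ioo (-ε) ε, ¬ IsEigenvalue (hermitian e ω) t}

/-- The standard real basis of `ℝ`. -/
def realBasis : Fin 1 → ℝ := ![1]

/-- The standard real basis of `ℂ`. -/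
def complexBasis : Fin 2 → ℂ := ![1, Complex.I]

/-- The standard real basis `1, i, j, k` of the quaternions. -/
def quaternionBasis : Fin 4 → Quaternion ℝ :=
  ![⟨1, 0, 0, 0⟩, ⟨0, 1, 0, 0⟩, ⟨0, 0, 1, 0⟩, ⟨0, 0, 0, 1⟩]

/-- The complex `2n × 2n` matrix `[[A, B], [-B̄, Ā]]` of the quaternionic matrix `Q = A + B j`. -/
def complexification {n : ℕ} (Q : Matrix (Fin n) (Fin n) (Quaternion ℝ)) :
    Matrix (Fin n ⊕ Fin n) (Fin n ⊕ Fin n) ℂ :=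
  Matrix.fromBlocks
    (Q.map fun q => (⟨q.re, q.imI⟩ : ℂ)) (Q.map fun q => (⟨q.imJ, q.imK⟩ : ℂ))
    (Q.map fun q => -(⟨q.imJ, -q.imK⟩ : ℂ)) (Q.map fun q => (⟨q.re, -q.imI⟩ : ℂ))

/-- The modulus of the quaternionic determinant, whose square is the determinant of the
complexification; for a Hermitian matrix it is the product of the moduli of its `n` eigenvalues. -/
def quaternionAbsDet {n : ℕ} (Q : Matrix (Fin n) (Fin n) (Quaternion ℝ)) : ℝ :=
  Real.sqrt ‖(complexification Q).det‖

/-- `f` is differentiable on `(0, ∞)`, `f'(ε) → v` as `ε → 0⁺`, and `v` is the right derivative of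
`f` at `0`. -/
def HasRightDerivAtZero (f : ℝ → ℝ) (v : ℝ) : Prop :=
  (∀ ε : ℝ, 0 < ε → DifferentiableAt ℝ f ε) ∧
    Tendsto (deriv f) (𝓝[>] 0) (𝓝 v) ∧ HasDerivWithinAt f v (Set.Ici 0) 0

end GapProbability

end

/-!
The joint density of the eigenvalues is symmetric, so the event that some eigenvalue lies in
`(-ε, ε)` may be split according to which eigenvalue has the smallest modulus. Its probability is
`n ∫_{-ε}^{ε} h(s) ds`, where `h(s)` is the integral of `F_{β,n}(s, x)` over the `x ∈ ℝ^{n-1}` all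
of whose coordinates have modulus greater than `|s|` (`betaGap_eq`). By dominated convergence `h` is
continuous, so `f_{β,n}` has the derivative `-n (h(ε) + h(-ε))` at `ε > 0` and the right derivative
`-2n h(0)` at `0`. Setting one eigenvalue equal to `0` in the density leaves the density of the
ensemble of size `n - 1`, times `∏ |x_j|^β`, up to the ratio of the normalization constants
(`innermostDensity_zero`). This proves the claim for the joint densities
(`hasRightDerivAtZero_betaGap`).

It remains to show that the eigenvalues of the matrix ensembles over `ℝ`, `ℂ` and the quaternions
have the joint density with `β = d = 1, 2, 4`. The three algebras are treated at once, as real star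
algebras `K` with an orthonormal basis whose self-adjoint elements are real
(`IsOrthonormalStarBasis`). A Hermitian matrix over `K` acts on `K^n = ℝ^{nd}` as a real symmetric
matrix (`realify`), in whose spectrum each eigenvalue is repeated `d` times. All quantities in
question, the gap event and `|det|^d`, are products `∏ φ(λ)` over that spectrum (`spectralProd`), so
it suffices to know the integrals of such products.

These are computed by an induction on the size that replaces the usual differentiation of the
spectral decomposition. Almost every matrix with corner `a`, border `b` and lower right block `D` is
described by its largest eigenvalue `t` and the eigenvector `(1, y)`: then `b = (t - D) y`,
`a = t - y* (t - D) y`, and all eigenvalues of `D` are less than `t`. For fixed `D` the Jacobian of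
`(t, y) ↦ (a, b)` is `|det (t - D)| (1 + |y|²)` (`lintegral_border`); bijectivity is the
monotonicity of the secular function (`lintegral_secular`). The remaining eigenvalues are those of
`Q' = t + S (D - t) S`, where `S² = 1 + y y*` (`spectralProd_bordered`), and the substitution
`D ↦ Q'` is affine with a Jacobian depending on `y` only. Hence the integral over matrices of size
`m + 1` is a constant times the integral over `t` and over matrices `Q' < t` of size `m`, with the
factor `|det (Q' - t)| = ∏ |x_j - t|^d` (`exists_lintegral_spectralProd_succ`). The integral against
`∏_{i<j} |x_j - x_i|^d` satisfies the same recursion (`vandermondeIntegral_succ`), which gives the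
Weyl integration formula up to a constant (`exists_lintegral_spectralProd`). With the Gaussian
factor inserted, the constant is determined by both sides being probability measures
(`lintegral_gaussianEnsemble_spectralProd`).
-/

noncomputable section

namespace GapProbability

open scoped ENNReal
open Module

/-! ### Splitting a symmetric integral according to the extremal coordinate -/

theorem lintegral_pi_succ {m : ℕ} (g : (Fin (m + 1) → ℝ) → ℝ≥0∞) (hg : Measurable g) :
    ∫⁻ x, g x = ∫⁻ s : ℝ, ∫⁻ x : Fin m → ℝ, g (Fin.cons s x) := by
  have h := (volume_preserving_piFinSuccAbove (fun _ : Fin (m + 1) => ℝ) 0).symm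
  rw [← h.lintegral_comp hg, Measure.volume_eq_prod, lintegral_prod]
  · refine lintegral_congr fun s => lintegral_congr fun x => ?_
    congr 1
    simp [MeasurableEquiv.piFinSuccAbove, Fin.insertNthEquiv]
  · exact (hg.comp (MeasurableEquiv.measurable _)).aemeasurable

theorem volume_tie_eq_zero {m : ℕ} {u : ℝ → ℝ} (hu : Measurable u)
    (hnull : ∀ c, volume {s | u s = c} = 0) {i j : Fin (m + 1)} (hij : i ≠ j) :
    volume {x : Fin (m + 1) → ℝ | u (x i) = u (x j)} = 0 := by
  obtain ⟨k, rfl⟩ := Fin.exists_succAbove_eq hij.symm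
  have h := volume_preserving_piFinSuccAbove (fun _ : Fin (m + 1) => ℝ) i
  have hs : MeasurableSet {p : (Fin m → ℝ) × ℝ | u p.2 = u (p.1 k)} :=
    measurableSet_eq_fun (hu.comp measurable_snd)
      (hu.comp ((measurable_pi_apply k).comp measurable_fst))
  have h2 : volume {p : (Fin m → ℝ) × ℝ | u p.2 = u (p.1 k)} = 0 := by
    rw [Measure.volume_eq_prod, Measure.measure_prod_null hs]
    exact Eventually.of_forall fun y => by simpa [Set.preimage] using hnull (u (y k))
  have h3 : {x : Fin (m + 1) → ℝ | u (x i) = u (x (i.succAbove k))} =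
      MeasurableEquiv.piFinSuccAbove (fun _ : Fin (m + 1) => ℝ) i ⁻¹'
        (Prod.swap ⁻¹' {p : (Fin m → ℝ) × ℝ | u p.2 = u (p.1 k)}) := by
    ext x
    exact Iff.rfl
  rw [h3, h.measure_preimage (hs.preimage measurable_swap).nullMeasurableSet]
  rw [Measure.volume_eq_prod] at h2 ⊢
  rw [(Measure.measurePreserving_swap (μ := (volume : Measure ℝ))).measure_preimage
    hs.nullMeasurableSet]
  exact h2

/-- A symmetric function of `m + 1` real variables is integrated by prescribing which coordinate
minimizes `u`: by symmetry it may be taken to be the first one, and ties form a null set. -/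
theorem lintegral_eq_mul_lintegral_argmin {m : ℕ} {g : (Fin (m + 1) → ℝ) → ℝ≥0∞}
    (hg : Measurable g) (hsymm : ∀ (σ : Equiv.Perm (Fin (m + 1))) x, g (x ∘ σ) = g x)
    {u : ℝ → ℝ} (hu : Measurable u) (hnull : ∀ c, volume {s | u s = c} = 0) :
    ∫⁻ x, g x = (m + 1 : ℕ) * ∫⁻ s : ℝ, ∫⁻ x : Fin m → ℝ,
      {x : Fin m → ℝ | ∀ j, u s < u (x j)}.indicator (fun x => g (Fin.cons s x)) x := by
  set A : Fin (m + 1) → Set (Fin (m + 1) → ℝ) := fun i => {x | ∀ j, j ≠ i → u (x i) < u (x j)}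
    with hA
  have hmeas : ∀ i, MeasurableSet (A i) := by
    intro i
    simp only [hA, Set.ofPred_forall]
    refine MeasurableSet.iInter fun j => MeasurableSet.iInter fun _ => ?_
    exact measurableSet_lt (hu.comp (measurable_pi_apply i)) (hu.comp (measurable_pi_apply j))
  have hdisj : Pairwise (Function.onFun Disjoint A) := by
    intro i j hij
    rw [Function.onFun, Set.disjoint_left]
    intro x hi hj
    exact lt_asymm (hi j hij.symm) (hj i hij)
  have hcover : (⋃ i, A i) =ᵐ[volume] Set.univ := by
    rw [eventuallyEq_univ]
    have : ∀ᵐ x : Fin (m + 1) → ℝ, ∀ i j, i ≠ j → u (x i) ≠ u (x j) := by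
      rw [ae_all_iff]; intro i; rw [ae_all_iff]; intro j
      by_cases hij : i = j
      · simp [hij]
      · have := volume_tie_eq_zero hu hnull hij
        filter_upwards [measure_eq_zero_iff_ae_notMem.1 this] with x hx _
        exact hx
    filter_upwards [this] with x hx
    obtain ⟨i, -, hi⟩ := Finset.exists_min_image Finset.univ (fun i => u (x i))
      Finset.univ_nonempty
    exact Set.mem_iUnion.2 ⟨i, fun j hj =>
      lt_of_le_of_ne (hi j (Finset.mem_univ _)) (hx i j hj.symm)⟩
  have hswap : ∀ i, ∫⁻ x in A i, g x = ∫⁻ x in A 0, g x := by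
    intro i
    have h := volume_measurePreserving_piCongrLeft (fun _ : Fin (m + 1) => ℝ) (Equiv.swap 0 i)
    have he : ∀ x : Fin (m + 1) → ℝ,
        MeasurableEquiv.piCongrLeft (fun _ => ℝ) (Equiv.swap 0 i) x = x ∘ Equiv.swap 0 i := by
      intro x; funext k
      have := Equiv.piCongrLeft_apply_apply (fun _ : Fin (m + 1) => ℝ) (Equiv.swap 0 i) x
        (Equiv.swap 0 i k)
      rw [Equiv.swap_apply_self] at this
      exact this
    rw [← lintegral_indicator (hmeas i), ← lintegral_indicator (hmeas 0),
      ← h.lintegral_comp (hg.indicator (hmeas i))]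
    refine lintegral_congr fun x => ?_
    rw [he]
    have : x ∘ Equiv.swap 0 i ∈ A i ↔ x ∈ A 0 := by
      simp only [hA, Set.mem_ofPred_eq, Function.comp_apply, Equiv.swap_apply_right]
      constructor
      · intro H j hj
        have := H (Equiv.swap 0 i j) (fun h => hj (by
          have := congrArg (Equiv.swap 0 i) h; simpa using this))
        simpa using this
      · intro H j hj
        exact H _ (fun h => hj (by have := congrArg (Equiv.swap 0 i) h; simpa using this))
    by_cases hx : x ∈ A 0
    · rw [Set.indicator_of_mem hx, Set.indicator_of_mem (this.2 hx), hsymm]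
    · rw [Set.indicator_of_notMem hx, Set.indicator_of_notMem (fun h => hx (this.1 h))]
  calc ∫⁻ x, g x = ∫⁻ x in ⋃ i, A i, g x := by
        rw [setLIntegral_congr hcover, setLIntegral_univ]
    _ = ∑ i, ∫⁻ x in A i, g x := by
        rw [lintegral_iUnion hmeas hdisj, tsum_fintype]
    _ = (m + 1 : ℕ) * ∫⁻ x in A 0, g x := by
        simp [hswap, Finset.sum_const]
    _ = _ := by
        rw [← lintegral_indicator (hmeas 0), lintegral_pi_succ _ (hg.indicator (hmeas 0))]
        congr 1
        refine lintegral_congr fun s => lintegral_congr fun x => ?_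
        have : (Fin.cons s x : Fin (m + 1) → ℝ) ∈ A 0 ↔
            x ∈ {x : Fin m → ℝ | ∀ j, u s < u (x j)} := by
          simp only [hA, Set.mem_ofPred_eq]
          constructor
          · intro H j; simpa using H j.succ (Fin.succ_ne_zero j)
          · intro H j hj
            obtain ⟨k, rfl⟩ := Fin.exists_succ_eq_of_ne_zero hj
            simpa using H k
        by_cases hx : (Fin.cons s x : Fin (m + 1) → ℝ) ∈ A 0
        · rw [Set.indicator_of_mem hx, Set.indicator_of_mem (this.1 hx)]
        · rw [Set.indicator_of_notMem hx, Set.indicator_of_notMem (fun h => hx (this.2 h))]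

/-! ### The weight of the `β`-ensemble -/

/-- The product `∏_{i < j} |x_j - x_i| ^ β`. -/
def absVandermonde (β : ℝ) {n : ℕ} (x : Fin n → ℝ) : ℝ :=
  ∏ i, ∏ j ∈ Finset.Ioi i, |x j - x i| ^ β

theorem absVandermonde_nonneg (β : ℝ) {n : ℕ} (x : Fin n → ℝ) : 0 ≤ absVandermonde β x :=
  Finset.prod_nonneg fun _ _ => Finset.prod_nonneg fun _ _ => by positivity

theorem absVandermonde_eq_abs_det (β : ℝ) {n : ℕ} (x : Fin n → ℝ) :
    absVandermonde β x = |(Matrix.vandermonde x).det| ^ β := by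
  rw [Matrix.det_vandermonde, Finset.abs_prod, ← Real.finsetProd_rpow _ _ fun _ _ => abs_nonneg _]
  refine Finset.prod_congr rfl fun i _ => ?_
  rw [Finset.abs_prod, ← Real.finsetProd_rpow _ _ fun _ _ => abs_nonneg _]

theorem absVandermonde_comp_perm (β : ℝ) {n : ℕ} (σ : Equiv.Perm (Fin n)) (x : Fin n → ℝ) :
    absVandermonde β (x ∘ σ) = absVandermonde β x := by
  have : Matrix.vandermonde (x ∘ σ) = (Matrix.vandermonde x).submatrix σ id := by
    ext i j; simp [Matrix.vandermonde]
  rw [absVandermonde_eq_abs_det, absVandermonde_eq_abs_det, this, Matrix.det_permute, abs_mul]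
  rcases Int.units_eq_one_or (Equiv.Perm.sign σ) with h | h <;> simp [h]

theorem absVandermonde_cons (β : ℝ) {m : ℕ} (s : ℝ) (x : Fin m → ℝ) :
    absVandermonde β (Fin.cons s x : Fin (m + 1) → ℝ) =
      (∏ j, |x j - s| ^ β) * absVandermonde β x := by
  simp only [absVandermonde, Fin.prod_univ_succ, Fin.prod_Ioi_zero, Fin.prod_Ioi_succ,
    Fin.cons_zero, Fin.cons_succ]

theorem continuous_absVandermonde {β : ℝ} (hβ : 0 < β) (n : ℕ) :
    Continuous (absVandermonde β : (Fin n → ℝ) → ℝ) := by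
  unfold absVandermonde
  refine continuous_finsetProd _ fun i _ => continuous_finsetProd _ fun j _ => ?_
  exact Continuous.rpow_const (by fun_prop) fun _ => Or.inr hβ.le

theorem weight_eq (β : ℝ) (n : ℕ) (x : Fin n → ℝ) :
    weight β n x = Real.exp (-(β / 2) * ∑ j, x j ^ 2) * absVandermonde β x := rfl

theorem weight_nonneg (β : ℝ) (n : ℕ) (x : Fin n → ℝ) : 0 ≤ weight β n x :=
  mul_nonneg (Real.exp_nonneg _) (absVandermonde_nonneg β x)

theorem continuous_weight {β : ℝ} (hβ : 0 < β) (n : ℕ) : Continuous (weight β n) := by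
  have := continuous_absVandermonde hβ n
  simp only [funext (weight_eq β n)]
  fun_prop

theorem weight_comp_perm (β : ℝ) {n : ℕ} (σ : Equiv.Perm (Fin n)) (x : Fin n → ℝ) :
    weight β n (x ∘ σ) = weight β n x := by
  rw [weight_eq, weight_eq, absVandermonde_comp_perm]
  congr 3
  exact Equiv.sum_comp σ fun j => x j ^ 2

theorem absVandermonde_le {β : ℝ} (hβ : 0 < β) {n : ℕ} (x : Fin n → ℝ) :
    absVandermonde β x ≤ Real.exp (β * n * ∑ i, |x i|) := by
  have key : ∀ i j : Fin n, |x j - x i| ^ β ≤ Real.exp (β * (|x i| + |x j|)) := by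
    intro i j
    have h1 : |x j - x i| ≤ Real.exp (|x i| + |x j|) := by
      calc |x j - x i| ≤ |x j| + |x i| := abs_sub _ _
        _ ≤ (|x i| + |x j|) + 1 := by linarith
        _ ≤ _ := Real.add_one_le_exp _
    calc |x j - x i| ^ β ≤ Real.exp (|x i| + |x j|) ^ β :=
          Real.rpow_le_rpow (abs_nonneg _) h1 hβ.le
      _ = _ := by rw [← Real.exp_mul, mul_comm]
  induction n with
  | zero => simp [absVandermonde]
  | succ m ih =>
    obtain ⟨s, y, rfl⟩ : ∃ s y, x = Fin.cons s y := ⟨x 0, Fin.tail x, by simp⟩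
    rw [absVandermonde_cons, Fin.sum_univ_succ]
    have h1 : ∏ j, |y j - s| ^ β ≤ Real.exp (β * (m * |s| + ∑ j, |y j|)) := by
      calc ∏ j, |y j - s| ^ β ≤ ∏ j, Real.exp (β * (|s| + |y j|)) :=
            Finset.prod_le_prod (fun _ _ => by positivity) fun j _ => by
              simpa using key 0 j.succ
        _ = _ := by
            rw [← Real.exp_sum, ← Finset.mul_sum, Finset.sum_add_distrib]; simp
    have h2 := ih y fun i j => by simpa using key i.succ j.succ
    calc _ ≤ Real.exp (β * (m * |s| + ∑ j, |y j|)) * Real.exp (β * m * ∑ i, |y i|) :=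
          mul_le_mul h1 h2 (absVandermonde_nonneg _ _) (Real.exp_nonneg _)
      _ = Real.exp (β * (m * |s| + ∑ j, |y j|) + β * m * ∑ i, |y i|) := by rw [Real.exp_add]
      _ ≤ _ := by
          apply Real.exp_le_exp.2
          simp only [Fin.cons_zero, Fin.cons_succ]
          push_cast
          nlinarith [mul_nonneg hβ.le (abs_nonneg s)]

/-- The Gaussian factor beats the growth of the interaction: the weight is dominated by a
centred Gaussian of twice the variance. -/
theorem exists_weight_le {β : ℝ} (hβ : 0 < β) (n : ℕ) :
    ∃ K : ℝ, 0 ≤ K ∧ ∀ x, weight β n x ≤ K * ∏ i, Real.exp (-(β / 4) * x i ^ 2) := by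
  refine ⟨∏ _i : Fin n, Real.exp (β * n ^ 2), by positivity, fun x => ?_⟩
  rw [← Finset.prod_mul_distrib, weight_eq]
  calc _ ≤ Real.exp (-(β / 2) * ∑ j, x j ^ 2) * Real.exp (β * n * ∑ i, |x i|) :=
        mul_le_mul_of_nonneg_left (absVandermonde_le hβ x) (Real.exp_nonneg _)
    _ = ∏ i, Real.exp (-(β / 2) * x i ^ 2 + β * n * |x i|) := by
        rw [← Real.exp_add, ← Real.exp_sum, Finset.sum_add_distrib, Finset.mul_sum,
          Finset.mul_sum]
    _ ≤ _ := by
        refine Finset.prod_le_prod (fun _ _ => by positivity) fun i _ => ?_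
        rw [← Real.exp_add]
        apply Real.exp_le_exp.2
        -- `n |x| ≤ x² / 4 + n²`
        have : (n : ℝ) * |x i| ≤ x i ^ 2 / 4 + n ^ 2 := by
          rw [← sq_abs (x i)]
          nlinarith [sq_nonneg (|x i| / 2 - n)]
        nlinarith

theorem integrable_prod_gaussian {β : ℝ} (hβ : 0 < β) (n : ℕ) :
    Integrable fun x : Fin n → ℝ => ∏ i, Real.exp (-(β / 4) * x i ^ 2) :=
  Integrable.fintype_prod (f := fun _ : Fin n => fun s : ℝ => Real.exp (-(β / 4) * s ^ 2))
    fun _ => integrable_exp_neg_mul_sq (by positivity)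

theorem integrable_weight {β : ℝ} (hβ : 0 < β) (n : ℕ) : Integrable (weight β n) := by
  obtain ⟨K, -, hK⟩ := exists_weight_le hβ n
  refine ((integrable_prod_gaussian hβ n).const_mul K).mono'
    (continuous_weight hβ n).aestronglyMeasurable (Eventually.of_forall fun x => ?_)
  rw [Real.norm_of_nonneg (weight_nonneg β n x)]
  exact hK x

theorem integral_weight_pos {β : ℝ} (hβ : 0 < β) (n : ℕ) :
    0 < ∫ x : Fin n → ℝ, weight β n x := by
  -- the weight does not vanish at a point with distinct coordinates, such as `(0, 1, …, n - 1)`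
  refine integral_pos_of_integrable_nonneg_nonzero (x := fun i : Fin n => (i : ℝ))
    (continuous_weight hβ n) (integrable_weight hβ n) (weight_nonneg β n) ?_
  rw [weight_eq]
  refine mul_ne_zero (Real.exp_ne_zero _) (Finset.prod_ne_zero_iff.2 fun i _ =>
    Finset.prod_ne_zero_iff.2 fun j hj => ?_)
  have : (i : ℝ) < j := by exact_mod_cast Finset.mem_Ioi.1 hj
  exact (Real.rpow_pos_of_pos (abs_pos.2 (sub_ne_zero.2 this.ne')) _).ne'

theorem normConst_pos {β : ℝ} (hβ : 0 < β) (n : ℕ) : 0 < normConst β n :=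
  inv_pos.2 (integral_weight_pos hβ n)

theorem jointDensity_nonneg {β : ℝ} (hβ : 0 < β) (n : ℕ) (x : Fin n → ℝ) :
    0 ≤ jointDensity β n x :=
  mul_nonneg (normConst_pos hβ n).le (weight_nonneg β n x)

theorem continuous_jointDensity {β : ℝ} (hβ : 0 < β) (n : ℕ) : Continuous (jointDensity β n) :=
  continuous_const.mul (continuous_weight hβ n)

theorem integrable_jointDensity {β : ℝ} (hβ : 0 < β) (n : ℕ) : Integrable (jointDensity β n) :=
  (integrable_weight hβ n).const_mul _

theorem isProbabilityMeasure_betaEnsemble {β : ℝ} (hβ : 0 < β) (n : ℕ) :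
    IsProbabilityMeasure (betaEnsemble β n) := by
  constructor
  rw [betaEnsemble, withDensity_apply _ MeasurableSet.univ, setLIntegral_univ,
    ← ofReal_integral_eq_lintegral_ofReal (integrable_jointDensity hβ n)
      (Eventually.of_forall (jointDensity_nonneg hβ n))]
  simp only [jointDensity]
  rw [integral_const_mul, normConst, inv_mul_cancel₀ (integral_weight_pos hβ n).ne',
    ENNReal.ofReal_one]

/-! ### The gap probability of the `β`-ensemble -/

/-- The density, up to the factor `m + 1`, of the eigenvalue of smallest modulus at the point `s`:
the joint density is integrated over all positions of the other eigenvalues outside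
`[-|s|, |s|]`. -/
def innermostDensity (β : ℝ) (m : ℕ) (s : ℝ) : ℝ :=
  ∫ x : Fin m → ℝ, {x : Fin m → ℝ | ∀ j, |s| < |x j|}.indicator
    (fun x => jointDensity β (m + 1) (Fin.cons s x)) x

theorem measurableSet_forall_abs_lt (m : ℕ) (s : ℝ) :
    MeasurableSet {x : Fin m → ℝ | ∀ j, |s| < |x j|} := by
  rw [Set.ofPred_forall]
  exact MeasurableSet.iInter fun j =>
    measurableSet_lt measurable_const (measurable_pi_apply j).abs

theorem volume_abs_eq (c : ℝ) : volume {s : ℝ | |s| = c} = 0 := by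
  refine measure_mono_null (t := {c, -c}) (fun s (hs : |s| = c) => ?_)
    (Set.Finite.measure_zero (by simp) _)
  subst hs
  rcases abs_choice s with h | h <;> simp [h]

theorem continuous_cons (m : ℕ) :
    Continuous fun p : ℝ × (Fin m → ℝ) => (Fin.cons p.1 p.2 : Fin (m + 1) → ℝ) := by
  refine continuous_pi fun i => ?_
  refine Fin.cases ?_ (fun j => ?_) i
  · simpa using continuous_fst
  · simp only [Fin.cons_succ]; fun_prop

theorem exists_jointDensity_cons_le {β : ℝ} (hβ : 0 < β) (m : ℕ) :
    ∃ K : ℝ, 0 ≤ K ∧ ∀ s (x : Fin m → ℝ), jointDensity β (m + 1) (Fin.cons s x) ≤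
      K * ∏ i, Real.exp (-(β / 4) * x i ^ 2) := by
  obtain ⟨K, hK0, hK⟩ := exists_weight_le hβ (m + 1)
  refine ⟨normConst β (m + 1) * K, mul_nonneg (normConst_pos hβ _).le hK0, fun s x => ?_⟩
  rw [jointDensity, mul_assoc]
  refine mul_le_mul_of_nonneg_left ((hK _).trans ?_) (normConst_pos hβ _).le
  refine mul_le_mul_of_nonneg_left ?_ hK0
  rw [Fin.prod_univ_succ]
  simp only [Fin.cons_zero, Fin.cons_succ]
  refine mul_le_of_le_one_left (by positivity) (Real.exp_le_one_iff.2 ?_)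
  nlinarith [sq_nonneg s]

theorem integrable_jointDensity_cons {β : ℝ} (hβ : 0 < β) (m : ℕ) (s : ℝ) :
    Integrable fun x : Fin m → ℝ => jointDensity β (m + 1) (Fin.cons s x) := by
  obtain ⟨K, -, hK⟩ := exists_jointDensity_cons_le hβ m
  refine ((integrable_prod_gaussian hβ m).const_mul K).mono' ?_ (Eventually.of_forall fun x => ?_)
  · exact ((continuous_jointDensity hβ _).comp
      ((continuous_cons m).comp (Continuous.prodMk_right s))).aestronglyMeasurable
  · rw [Real.norm_of_nonneg (jointDensity_nonneg hβ _ _)]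
    exact hK s x

/-- Continuity by dominated convergence: for fixed `x` with `|x j| ≠ |s|` the cutoff does not change
near `s`. -/
theorem continuous_innermostDensity {β : ℝ} (hβ : 0 < β) (m : ℕ) :
    Continuous (innermostDensity β m) := by
  obtain ⟨K, hK0, hK⟩ := exists_jointDensity_cons_le hβ m
  refine continuous_iff_continuousAt.2 fun s₀ => ?_
  refine continuousAt_of_dominated (bound := fun x => K * ∏ i, Real.exp (-(β / 4) * x i ^ 2))
    (Eventually.of_forall fun s => ?_) (Eventually.of_forall fun s =>
      Eventually.of_forall fun x => ?_) ((integrable_prod_gaussian hβ m).const_mul K) ?_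
  · exact ((integrable_jointDensity_cons hβ m s).indicator
      (measurableSet_forall_abs_lt m s)).aestronglyMeasurable
  · refine (norm_indicator_le_norm_self _ _).trans ?_
    rw [Real.norm_of_nonneg (jointDensity_nonneg hβ _ _)]
    exact hK s x
  · have hne : ∀ᵐ x : Fin m → ℝ, ∀ j, |x j| ≠ |s₀| := by
      rw [ae_all_iff]
      intro j
      have h := (Measure.quasiMeasurePreserving_eval (fun _ : Fin m => (volume : Measure ℝ)) j)
      exact h.ae (measure_eq_zero_iff_ae_notMem.1 (volume_abs_eq |s₀|))
    filter_upwards [hne] with x hx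
    have hcont : ContinuousAt (fun s => jointDensity β (m + 1) (Fin.cons s x)) s₀ :=
      ((continuous_jointDensity hβ _).comp
        ((continuous_cons m).comp (Continuous.prodMk_left x))).continuousAt
    by_cases hall : ∀ j, |s₀| < |x j|
    · have hev : ∀ᶠ s in 𝓝 s₀, ∀ j, |s| < |x j| :=
        eventually_all.2 fun j =>
          continuous_abs.continuousAt.eventually_lt continuousAt_const (hall j)
      refine hcont.congr ?_
      filter_upwards [hev] with s hs
      exact (Set.indicator_of_mem (s := {x : Fin m → ℝ | ∀ j, |s| < |x j|}) hs
        (fun x => jointDensity β (m + 1) (Fin.cons s x))).symm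
    · push Not at hall
      obtain ⟨j, hj⟩ := hall
      have hj' : |x j| < |s₀| := lt_of_le_of_ne hj (hx j)
      have hev : ∀ᶠ s in 𝓝 s₀, |x j| < |s| :=
        continuousAt_const.eventually_lt continuous_abs.continuousAt hj'
      refine (continuousAt_const (y := (0 : ℝ))).congr ?_
      filter_upwards [hev] with s hs
      refine (Set.indicator_of_notMem (s := {x : Fin m → ℝ | ∀ j, |s| < |x j|}) ?_
        (fun x => jointDensity β (m + 1) (Fin.cons s x))).symm
      exact fun h => lt_asymm hs (h j)

theorem innermostDensity_nonneg {β : ℝ} (hβ : 0 < β) (m : ℕ) (s : ℝ) :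
    0 ≤ innermostDensity β m s :=
  integral_nonneg fun _ => Set.indicator_nonneg (fun _ _ => jointDensity_nonneg hβ _ _) _

theorem measurableSet_gap (n : ℕ) (ε : ℝ) :
    MeasurableSet {x : Fin n → ℝ | ∀ i, x i ∉ Set.Ioo (-ε) ε} := by
  rw [Set.ofPred_forall]
  exact MeasurableSet.iInter fun i => (measurableSet_Ioo.preimage (measurable_pi_apply i)).compl

/-- The probability that some eigenvalue lies in `(-ε, ε)`, computed from the position of the
eigenvalue of smallest modulus. -/
theorem betaEnsemble_compl_gap {β : ℝ} (hβ : 0 < β) (m : ℕ) (ε : ℝ) :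
    betaEnsemble β (m + 1) {x | ∀ i, x i ∉ Set.Ioo (-ε) ε}ᶜ =
      (m + 1 : ℕ) * ∫⁻ s in Set.Ioo (-ε) ε, ENNReal.ofReal (innermostDensity β m s) := by
  have hB := (measurableSet_gap (m + 1) ε).compl
  set B := {x : Fin (m + 1) → ℝ | ∀ i, x i ∉ Set.Ioo (-ε) ε}ᶜ with hBdef
  have hmem : ∀ x : Fin (m + 1) → ℝ, x ∈ B ↔ ∃ i, |x i| < ε := by
    intro x
    simp only [hBdef, Set.mem_compl_iff, Set.mem_ofPred_eq, Set.mem_Ioo, ← abs_lt, not_forall,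
      not_not]
  have hF : Measurable fun x : Fin (m + 1) → ℝ => ENNReal.ofReal (jointDensity β (m + 1) x) :=
    (continuous_jointDensity hβ _).measurable.ennreal_ofReal
  rw [betaEnsemble, withDensity_apply _ hB, ← lintegral_indicator hB,
    lintegral_eq_mul_lintegral_argmin (hF.indicator hB) (u := fun s => |s|) ?_ measurable_abs
      volume_abs_eq]
  · congr 1
    rw [← lintegral_indicator measurableSet_Ioo]
    refine lintegral_congr fun s => ?_
    by_cases hs : s ∈ Set.Ioo (-ε) ε
    · rw [Set.indicator_of_mem hs, innermostDensity, ofReal_integral_eq_lintegral_ofReal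
        ((integrable_jointDensity_cons hβ m s).indicator (measurableSet_forall_abs_lt m s))
        (Eventually.of_forall fun _ =>
          Set.indicator_nonneg (fun _ _ => jointDensity_nonneg hβ _ _) _)]
      refine lintegral_congr fun x => ?_
      by_cases hx : x ∈ {x : Fin m → ℝ | ∀ j, |s| < |x j|}
      · rw [Set.indicator_of_mem hx, Set.indicator_of_mem hx, Set.indicator_of_mem]
        rw [hmem]
        exact ⟨0, abs_lt.2 hs⟩
      · rw [Set.indicator_of_notMem hx, Set.indicator_of_notMem hx, ENNReal.ofReal_zero]
    · rw [Set.indicator_of_notMem hs]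
      refine lintegral_eq_zero_of_ae_eq_zero (Eventually.of_forall fun x => ?_)
      by_cases hx : x ∈ {x : Fin m → ℝ | ∀ j, |s| < |x j|}
      · rw [Set.indicator_of_mem hx, Set.indicator_of_notMem]
        · rfl
        · rw [hmem]
          rintro ⟨i, hi⟩
          refine hs (abs_lt.1 ?_)
          induction i using Fin.cases with
          | zero => simpa using hi
          | succ j => exact (hx j).trans (by simpa using hi)
      · rw [Set.indicator_of_notMem hx]; rfl
  · intro σ x
    have : x ∘ σ ∈ B ↔ x ∈ B := by
      rw [hmem, hmem]
      exact ⟨fun ⟨i, hi⟩ => ⟨σ i, hi⟩, fun ⟨i, hi⟩ => ⟨σ.symm i, by simpa using hi⟩⟩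
    by_cases hx : x ∈ B
    · rw [Set.indicator_of_mem hx, Set.indicator_of_mem (this.2 hx), jointDensity, jointDensity,
        weight_comp_perm]
    · rw [Set.indicator_of_notMem hx, Set.indicator_of_notMem (fun h => hx (this.1 h))]

theorem betaGap_eq {β : ℝ} (hβ : 0 < β) (m : ℕ) {ε : ℝ} (hε : 0 ≤ ε) :
    betaGap β (m + 1) ε = 1 - (m + 1) * ∫ s in (-ε)..ε, innermostDensity β m s := by
  have := isProbabilityMeasure_betaEnsemble hβ (m + 1)
  have h := probReal_compl_eq_one_sub (μ := betaEnsemble β (m + 1)) (measurableSet_gap (m + 1) ε)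
  have h2 : (betaEnsemble β (m + 1)).real {x | ∀ i, x i ∉ Set.Ioo (-ε) ε}ᶜ =
      (m + 1) * ∫ s in (-ε)..ε, innermostDensity β m s := by
    rw [measureReal_def, betaEnsemble_compl_gap hβ, ENNReal.toReal_mul,
      intervalIntegral.integral_of_le (by linarith), integral_Ioc_eq_integral_Ioo,
      integral_eq_lintegral_of_nonneg_ae
        (Eventually.of_forall (innermostDensity_nonneg hβ m))
        (continuous_innermostDensity hβ m).aestronglyMeasurable, ENNReal.toReal_natCast]
    push_cast
    rfl
  rw [betaGap]
  linarith

theorem hasDerivAt_integral_innermostDensity {β : ℝ} (hβ : 0 < β) (m : ℕ) (ε : ℝ) :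
    HasDerivAt (fun ε => 1 - (m + 1) * ∫ s in (-ε)..ε, innermostDensity β m s)
      (-(m + 1) * (innermostDensity β m ε + innermostDensity β m (-ε))) ε := by
  have hc := continuous_innermostDensity hβ m
  have h : ∀ a, HasDerivAt (fun u => ∫ s in (0 : ℝ)..u, innermostDensity β m s)
      (innermostDensity β m a) a := fun a =>
    intervalIntegral.integral_hasDerivAt_right (hc.intervalIntegrable _ _)
      (hc.stronglyMeasurableAtFilter _ _) hc.continuousAt
  have h2 := ((h ε).sub ((h (-ε)).comp ε (hasDerivAt_neg ε))).const_mul ((m : ℝ) + 1)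
  have h3 := h2.const_sub 1
  have hval : -(m + 1) * (innermostDensity β m ε + innermostDensity β m (-ε)) =
      -((m + 1) * (innermostDensity β m ε - innermostDensity β m (-ε) * -1)) := by ring
  rw [hval]
  refine h3.congr_of_eventuallyEq (Eventually.of_forall fun u => ?_)
  simp only [Pi.sub_apply, Function.comp_apply]
  rw [intervalIntegral.integral_interval_sub_left (hc.intervalIntegrable _ _)
    (hc.intervalIntegrable _ _)]

/-- The interaction with an eigenvalue `0` contributes the factor `∏ |x_j| ^ β`. -/
theorem jointDensity_cons_zero {β : ℝ} (hβ : 0 < β) (m : ℕ) (x : Fin m → ℝ) :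
    jointDensity β (m + 1) (Fin.cons 0 x) =
      normConst β (m + 1) / normConst β m * (jointDensity β m x * |∏ i, x i| ^ β) := by
  have h0 := (normConst_pos hβ m).ne'
  rw [jointDensity, jointDensity, weight_eq, weight_eq, absVandermonde_cons, Fin.sum_univ_succ,
    Finset.abs_prod, ← Real.finsetProd_rpow _ _ fun _ _ => abs_nonneg _]
  simp only [Fin.cons_zero, Fin.cons_succ, sub_zero]
  field_simp
  ring_nf

/-- Up to constants `|∏ x_i| ^ β` times the density of size `m` is the density of size `m + 1` on
the slice where one coordinate is `0`, and this slice is dominated by a Gaussian. -/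
theorem integrable_abs_prod_rpow {β : ℝ} (hβ : 0 < β) (m : ℕ) :
    Integrable (fun x : Fin m → ℝ => |∏ i, x i| ^ β) (betaEnsemble β m) := by
  have hF : Measurable fun x : Fin m → ℝ => ENNReal.ofReal (jointDensity β m x) :=
    (continuous_jointDensity hβ _).measurable.ennreal_ofReal
  rw [betaEnsemble, integrable_withDensity_iff_integrable_smul' hF (by simp)]
  have h := (integrable_jointDensity_cons hβ m 0).const_mul
    (normConst β m / normConst β (m + 1))
  refine h.congr (Eventually.of_forall fun x => ?_)
  beta_reduce
  rw [jointDensity_cons_zero hβ, ENNReal.toReal_ofReal (jointDensity_nonneg hβ _ _), smul_eq_mul]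
  have h0 := (normConst_pos hβ m).ne'
  have h1 := (normConst_pos hβ (m + 1)).ne'
  field_simp

/-- At the origin the condition `|s| < |x_j|` only excludes a null set. -/
theorem innermostDensity_zero {β : ℝ} (hβ : 0 < β) (m : ℕ) :
    innermostDensity β m 0 =
      normConst β (m + 1) / normConst β m * ∫ x, |∏ i, x i| ^ β ∂(betaEnsemble β m) := by
  have hF : Measurable fun x : Fin m → ℝ => ENNReal.ofReal (jointDensity β m x) :=
    (continuous_jointDensity hβ _).measurable.ennreal_ofReal
  rw [betaEnsemble, integral_withDensity_eq_integral_toReal_smul hF (by simp),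
    ← integral_const_mul, innermostDensity]
  refine integral_congr_ae ?_
  have hne : ∀ᵐ x : Fin m → ℝ, ∀ j, x j ≠ 0 := by
    rw [ae_all_iff]
    intro j
    have h := (Measure.quasiMeasurePreserving_eval (fun _ : Fin m => (volume : Measure ℝ)) j)
    exact h.ae (Measure.ae_ne volume 0)
  filter_upwards [hne] with x hx
  rw [Set.indicator_of_mem, jointDensity_cons_zero hβ,
    ENNReal.toReal_ofReal (jointDensity_nonneg hβ _ _), smul_eq_mul]
  intro j
  simpa using hx j

theorem hasRightDerivAtZero_betaGap {β : ℝ} (hβ : 0 < β) (m : ℕ) :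
    HasRightDerivAtZero (betaGap β (m + 1))
      (-2 * (m + 1 : ℕ) * (normConst β (m + 1) / normConst β m) *
        ∫ x, |∏ i, x i| ^ β ∂(betaEnsemble β m)) := by
  have hval : -2 * (m + 1 : ℕ) * (normConst β (m + 1) / normConst β m) *
      ∫ x, |∏ i, x i| ^ β ∂(betaEnsemble β m) =
        -(m + 1) * (innermostDensity β m 0 + innermostDensity β m (-0)) := by
    rw [neg_zero, innermostDensity_zero hβ]
    push_cast
    ring
  have hderiv : ∀ ε : ℝ, 0 < ε → HasDerivAt (betaGap β (m + 1))
      (-(m + 1) * (innermostDensity β m ε + innermostDensity β m (-ε))) ε := fun ε hε =>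
    (hasDerivAt_integral_innermostDensity hβ m ε).congr_of_eventuallyEq
      ((eventually_gt_nhds hε).mono fun u hu => betaGap_eq hβ m hu.le)
  have hc := continuous_innermostDensity hβ m
  refine ⟨fun ε hε => (hderiv ε hε).differentiableAt, ?_, ?_⟩
  · rw [hval]
    have hcont : Continuous fun ε : ℝ =>
        -((m : ℝ) + 1) * (innermostDensity β m ε + innermostDensity β m (-ε)) := by fun_prop
    refine ((hcont.tendsto 0).mono_left nhdsWithin_le_nhds).congr' ?_
    filter_upwards [self_mem_nhdsWithin] with ε hε
    exact (hderiv ε hε).deriv.symm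
  · rw [hval]
    exact (hasDerivAt_integral_innermostDensity hβ m 0).hasDerivWithinAt.congr
      (fun u hu => betaGap_eq hβ m hu) (betaGap_eq hβ m le_rfl)

/-! ### The secular equation of a bordered symmetric matrix -/

/-- The change of variables `a = t - ∑ cᵢ² / (t - μᵢ)`. To the right of all poles the secular
function increases from `-∞` to `+∞`, so it maps this half-line bijectively onto `ℝ`. -/
theorem lintegral_secular {ι : Type*} [Fintype ι] (μ c : ι → ℝ) (hc : ∀ i, c i ≠ 0)
    (G : ℝ → ℝ≥0∞) :
    ∫⁻ a, G a = ∫⁻ t in {t | ∀ i, μ i < t},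
      ENNReal.ofReal (1 + ∑ i, c i ^ 2 / (t - μ i) ^ 2) * G (t - ∑ i, c i ^ 2 / (t - μ i)) := by
  set U : Set ℝ := {t | ∀ i, μ i < t} with hU
  have hUm : MeasurableSet U := by
    rw [hU, Set.ofPred_forall]
    exact MeasurableSet.iInter fun i => measurableSet_lt measurable_const measurable_id
  set h : ℝ → ℝ := fun t => t - ∑ i, c i ^ 2 / (t - μ i) with hh
  set h' : ℝ → ℝ := fun t => 1 + ∑ i, c i ^ 2 / (t - μ i) ^ 2 with hh'
  have hderiv : ∀ t ∈ U, HasDerivAt h (h' t) t := by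
    intro t ht
    have h1 : ∀ i ∈ Finset.univ, HasDerivAt (fun t => c i ^ 2 / (t - μ i))
        (-(c i ^ 2 / (t - μ i) ^ 2)) t := by
      intro i _
      have hne : t - μ i ≠ 0 := sub_ne_zero.2 (ht i).ne'
      have := (hasDerivAt_const t (c i ^ 2)).fun_div ((hasDerivAt_id' t).sub_const (μ i)) hne
      refine this.congr_deriv ?_
      ring
    have h2 := (hasDerivAt_id' t).fun_sub (HasDerivAt.fun_sum h1)
    refine h2.congr_deriv ?_
    rw [Finset.sum_neg_distrib, sub_neg_eq_add]
  have hmono : StrictMonoOn h U := by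
    intro s hs t ht hst
    have : ∑ i, c i ^ 2 / (t - μ i) ≤ ∑ i, c i ^ 2 / (s - μ i) :=
      Finset.sum_le_sum fun i _ =>
        div_le_div_of_nonneg_left (sq_nonneg _) (sub_pos.2 (hs i)) (by linarith)
    simp only [hh]
    linarith
  have hcont : ContinuousOn h U := fun t ht => (hderiv t ht).continuousAt.continuousWithinAt
  have hconn : U.OrdConnected := ⟨fun s hs t _ r hr i => lt_of_lt_of_le (hs i) hr.1⟩
  have himage : h '' U = Set.univ := by
    refine Set.eq_univ_of_forall fun a => ?_
    obtain ⟨t₁, ht₁, h₁⟩ : ∃ t ∈ U, h t ≤ a := by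
      rcases isEmpty_or_nonempty ι with hι | hι
      · exact ⟨a, fun i => hι.elim i, by simp [hh]⟩
      · obtain ⟨i₀, -, hi₀⟩ := Finset.exists_max_image Finset.univ μ Finset.univ_nonempty
        -- just to the right of the largest pole `μ i₀` its summand alone exceeds any bound
        set δ : ℝ := min 1 (c i₀ ^ 2 / (|a| + |μ i₀| + 1)) with hδ
        have hpos : 0 < |a| + |μ i₀| + 1 := by positivity
        have hδ0 : 0 < δ := lt_min one_pos (div_pos (by have := hc i₀; positivity) hpos)
        have hmem : μ i₀ + δ ∈ U := fun i => by
          have := hi₀ i (Finset.mem_univ _); linarith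
        refine ⟨μ i₀ + δ, hmem, ?_⟩
        have hδ1 : |a| + |μ i₀| + 1 ≤ c i₀ ^ 2 / δ := by
          rw [le_div_iff₀ hδ0]
          have : δ ≤ c i₀ ^ 2 / (|a| + |μ i₀| + 1) := min_le_right _ _
          rw [le_div_iff₀ hpos] at this
          linarith
        have hsum : c i₀ ^ 2 / δ ≤ ∑ i, c i ^ 2 / (μ i₀ + δ - μ i) := by
          have := Finset.single_le_sum (f := fun i => c i ^ 2 / (μ i₀ + δ - μ i))
            (fun i _ => div_nonneg (sq_nonneg _) (sub_pos.2 (hmem i)).le) (Finset.mem_univ i₀)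
          simpa using this
        have hδ2 : δ ≤ 1 := min_le_left _ _
        have e1 := neg_abs_le a
        have e2 := le_abs_self (μ i₀)
        simp only [hh]
        linarith
    obtain ⟨t₂, ht₂, h₂⟩ : ∃ t ∈ U, a ≤ h t := by
      -- at distance at least one from all poles the sum is at most `∑ cᵢ²`
      refine ⟨max t₁ (|a| + ∑ i, c i ^ 2 + ∑ i, (|μ i| + 1)), fun i =>
        lt_of_lt_of_le (ht₁ i) (le_max_left _ _), ?_⟩
      set t := max t₁ (|a| + ∑ i, c i ^ 2 + ∑ i, (|μ i| + 1)) with ht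
      have hle : |a| + ∑ i, c i ^ 2 + ∑ i, (|μ i| + 1) ≤ t := le_max_right _ _
      have hc0 : 0 ≤ ∑ i, c i ^ 2 := Finset.sum_nonneg fun _ _ => sq_nonneg _
      have hμ0 : 0 ≤ ∑ i, (|μ i| + 1) := Finset.sum_nonneg fun _ _ => by positivity
      have hsum : ∑ i, c i ^ 2 / (t - μ i) ≤ ∑ i, c i ^ 2 := by
        refine Finset.sum_le_sum fun i _ => div_le_self (sq_nonneg _) ?_
        have := Finset.single_le_sum (f := fun i => |μ i| + 1)
          (fun i _ => by positivity) (Finset.mem_univ i)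
        have e1 := le_abs_self (μ i)
        have e2 := abs_nonneg a
        linarith
      have e2 := le_abs_self a
      simp only [hh]
      linarith
    exact (hconn.isPreconnected.image h hcont).ordConnected.out ⟨t₁, ht₁, rfl⟩ ⟨t₂, ht₂, rfl⟩
      ⟨h₁, h₂⟩
  have key := lintegral_image_eq_lintegral_abs_deriv_mul hUm
    (fun t ht => (hderiv t ht).hasDerivWithinAt) hmono.injOn G
  rw [himage, setLIntegral_univ] at key
  rw [key]
  refine lintegral_congr fun t => ?_
  have : 0 ≤ h' t := add_nonneg zero_le_one (Finset.sum_nonneg fun i _ => by positivity)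
  rw [abs_of_nonneg this]

theorem lintegral_comp_linearMap {E : Type*} [NormedAddCommGroup E] [NormedSpace ℝ E]
    [MeasurableSpace E] [BorelSpace E] [FiniteDimensional ℝ E] (ν : Measure E)
    [ν.IsAddHaarMeasure] {f : E →ₗ[ℝ] E} (hf : LinearMap.det f ≠ 0) {F : E → ℝ≥0∞}
    (hF : Measurable F) :
    ∫⁻ x, F x ∂ν = ENNReal.ofReal |LinearMap.det f| * ∫⁻ x, F (f x) ∂ν := by
  have h := Measure.map_linearMap_addHaar_eq_smul_addHaar ν hf
  have hm : Measurable f := f.continuous_of_finiteDimensional.measurable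
  rw [← lintegral_map hF hm, h, lintegral_smul_measure, smul_eq_mul, ← mul_assoc,
    ← ENNReal.ofReal_mul (abs_nonneg _), ← abs_mul, mul_inv_cancel₀ hf, abs_one,
    ENNReal.ofReal_one, one_mul]

section Spectral

variable {ι : Type*} [Fintype ι] [DecidableEq ι]

theorem exists_orthogonal_diagonalization {A : Matrix ι ι ℝ} (hA : A.IsHermitian) :
    ∃ O : Matrix ι ι ℝ, O.transpose * O = 1 ∧ O * O.transpose = 1 ∧
      A = O * Matrix.diagonal hA.eigenvalues * O.transpose := by
  refine ⟨hA.eigenvectorUnitary, ?_, ?_, ?_⟩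
  · have := Unitary.coe_star_mul_self hA.eigenvectorUnitary
    rwa [Matrix.star_eq_conjTranspose, Matrix.conjTranspose_eq_transpose_of_trivial] at this
  · have := Unitary.coe_mul_star_self hA.eigenvectorUnitary
    rwa [Unitary.coe_star, Matrix.star_eq_conjTranspose,
      Matrix.conjTranspose_eq_transpose_of_trivial] at this
  · have := hA.spectral_theorem
    rw [Unitary.conjStarAlgAut_apply, Matrix.star_eq_conjTranspose,
      Matrix.conjTranspose_eq_transpose_of_trivial] at this
    exact this

theorem smul_one_sub_diagonalization {A O : Matrix ι ι ℝ} {μ : ι → ℝ}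
    (hO : O * O.transpose = 1) (hA : A = O * Matrix.diagonal μ * O.transpose) (t : ℝ) :
    t • (1 : Matrix ι ι ℝ) - A = O * Matrix.diagonal (fun i => t - μ i) * O.transpose := by
  have : Matrix.diagonal (fun i => t - μ i) = t • (1 : Matrix ι ι ℝ) - Matrix.diagonal μ := by
    ext i j
    by_cases h : i = j
    · simp [h]
    · simp [h]
  rw [this, Matrix.mul_sub, Matrix.sub_mul, ← hA, Matrix.mul_smul, Matrix.smul_mul, mul_one, hO]

theorem posDef_smul_one_sub_iff {A : Matrix ι ι ℝ} (hA : A.IsHermitian) (t : ℝ) :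
    (t • (1 : Matrix ι ι ℝ) - A).PosDef ↔ ∀ i, hA.eigenvalues i < t := by
  obtain ⟨O, h1, h2, h3⟩ := exists_orthogonal_diagonalization hA
  rw [smul_one_sub_diagonalization h2 h3 t]
  have hu : IsUnit O := ⟨⟨O, O.transpose, h2, h1⟩, rfl⟩
  have := Matrix.IsUnit.posDef_star_right_conjugate_iff hu
    (x := Matrix.diagonal fun i => t - hA.eigenvalues i)
  rw [Matrix.star_eq_conjTranspose, Matrix.conjTranspose_eq_transpose_of_trivial] at this
  rw [this, Matrix.posDef_diagonal_iff]
  simp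

end Spectral

/-- Integration over the border `(a, b)` of a fixed symmetric matrix `A` in terms of the top
eigenvalue `t` and the corresponding eigenvector `(1, y)` of the bordered matrix: `b = (t - A) y`
and `a = t - ⟨y, b⟩`. The change of variables `y ↦ b` is linear for fixed `t`, and `t ↦ a` for
fixed `b` is given by the secular function. The border `b` ranges over a space `V` with
coordinates `e`. -/
theorem lintegral_border {ι : Type*} [Fintype ι] [DecidableEq ι] {V : Type*}
    [NormedAddCommGroup V] [NormedSpace ℝ V] [MeasurableSpace V] [BorelSpace V]
    [FiniteDimensional ℝ V] (ν : Measure V) [ν.IsAddHaarMeasure] (e : V ≃ₗ[ℝ] (ι → ℝ))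
    {A : Matrix ι ι ℝ} (hA : A.IsHermitian) {G : ℝ → V → ℝ≥0∞}
    (hG : Measurable (Function.uncurry G)) :
    ∫⁻ b, (∫⁻ a, G a b) ∂ν = ∫⁻ t in {t : ℝ | (t • (1 : Matrix ι ι ℝ) - A).PosDef},
      ∫⁻ y, ENNReal.ofReal (|(t • (1 : Matrix ι ι ℝ) - A).det| * (1 + e y ⬝ᵥ e y)) *
        G (t - e y ⬝ᵥ ((t • (1 : Matrix ι ι ℝ) - A).mulVec (e y)))
          (e.symm ((t • (1 : Matrix ι ι ℝ) - A).mulVec (e y))) ∂ν := by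
  obtain ⟨O, h1, h2, h3⟩ := exists_orthogonal_diagonalization hA
  set μ := hA.eigenvalues with hμ
  have hset : {t : ℝ | (t • (1 : Matrix ι ι ℝ) - A).PosDef} = {t | ∀ i, μ i < t} := by
    ext t; exact posDef_smul_one_sub_iff hA t
  rw [hset]
  have hUm : MeasurableSet {t : ℝ | ∀ i, μ i < t} := by
    rw [Set.ofPred_forall]
    exact MeasurableSet.iInter fun i => measurableSet_lt measurable_const measurable_id
  -- coordinates of `b` in the eigenbasis
  set c : V → ι → ℝ := fun b => O.transpose.mulVec (e b) with hc
  have hcm : Measurable c := by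
    have : c = ⇑(O.transpose.mulVecLin ∘ₗ e.toLinearMap) := by
      rfl
    rw [this]
    exact (LinearMap.continuous_of_finiteDimensional _).measurable
  have hci : ∀ i, Measurable fun b => c b i := fun i => (measurable_pi_apply i).comp hcm
  have hae : ∀ᵐ b ∂ν, ∀ i, c b i ≠ 0 := by
    rw [ae_all_iff]
    intro i
    set ℓ : V →ₗ[ℝ] ℝ := LinearMap.proj i ∘ₗ O.transpose.mulVecLin ∘ₗ e.toLinearMap with hℓ
    have hℓc : ∀ b, ℓ b = c b i := fun b => rfl
    have hne : ℓ.ker ≠ ⊤ := by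
      intro htop
      have h0 := LinearMap.ker_eq_top.1 htop
      have h4 : ℓ (e.symm (O.mulVec (Pi.single i 1))) = 0 := by rw [h0]; rfl
      rw [hℓc] at h4
      simp only [hc, LinearEquiv.apply_symm_apply, Matrix.mulVec_mulVec, h1, Matrix.one_mulVec,
        Pi.single_eq_same] at h4
      exact one_ne_zero h4
    have h0 := Measure.addHaar_submodule ν _ hne
    filter_upwards [measure_eq_zero_iff_ae_notMem.1 h0] with b hb h5
    exact hb (by rw [SetLike.mem_coe, LinearMap.mem_ker, hℓc, h5])
  obtain ⟨F, hF⟩ : ∃ F : ℝ → V → ℝ≥0∞, ∀ t b, F t b =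
      ENNReal.ofReal (1 + ∑ i, c b i ^ 2 / (t - μ i) ^ 2) *
        G (t - ∑ i, c b i ^ 2 / (t - μ i)) b := ⟨_, fun _ _ => rfl⟩
  have hFm : Measurable (Function.uncurry F) := by
    have hci' : ∀ i, Measurable fun p : ℝ × V => c p.2 i := fun i => (hci i).comp measurable_snd
    simp only [Function.uncurry_def, hF]
    refine Measurable.mul (Measurable.ennreal_ofReal ?_) (hG.comp (Measurable.prodMk ?_ ?_))
    · fun_prop
    · fun_prop
    · exact measurable_snd
  have hstep : ∀ t, (∀ i, μ i < t) → ∫⁻ b, F t b ∂ν =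
      ∫⁻ y, ENNReal.ofReal (|(t • (1 : Matrix ι ι ℝ) - A).det| * (1 + e y ⬝ᵥ e y)) *
        G (t - e y ⬝ᵥ ((t • (1 : Matrix ι ι ℝ) - A).mulVec (e y)))
          (e.symm ((t • (1 : Matrix ι ι ℝ) - A).mulVec (e y))) ∂ν := by
    intro t ht
    have hM := smul_one_sub_diagonalization h2 h3 t
    set M := t • (1 : Matrix ι ι ℝ) - A with hMdef
    set f : V →ₗ[ℝ] V := e.symm.toLinearMap ∘ₗ M.mulVecLin ∘ₗ e.toLinearMap with hf
    have hdet : LinearMap.det f = M.det := by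
      have := LinearMap.det_conj M.mulVecLin e.symm
      rw [LinearEquiv.symm_symm] at this
      rw [hf, this, ← Matrix.toLin'_apply', LinearMap.det_toLin']
    have hfx : ∀ y, f y = e.symm (M.mulVec (e y)) := fun y => by simp [hf]
    have hdet0 : LinearMap.det f ≠ 0 := by
      rw [hdet]
      exact ((posDef_smul_one_sub_iff hA t).2 ht).det_pos.ne'
    have hcf : ∀ y i, c (f y) i = (t - μ i) * c y i := by
      intro y i
      simp only [hc, hfx, LinearEquiv.apply_symm_apply]
      rw [Matrix.mulVec_mulVec, hM, ← mul_assoc, ← mul_assoc, h1, one_mul,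
        ← Matrix.mulVec_mulVec, Matrix.mulVec_diagonal]
    have hnorm : ∀ y, ∑ i, c y i ^ 2 = e y ⬝ᵥ e y := by
      intro y
      have : ∑ i, c y i ^ 2 = c y ⬝ᵥ c y := by simp [dotProduct, sq]
      rw [this]
      simp only [hc]
      rw [Matrix.dotProduct_mulVec, Matrix.vecMul_transpose, Matrix.mulVec_mulVec, h2,
        Matrix.one_mulVec]
    have hquad : ∀ y, ∑ i, (t - μ i) * c y i ^ 2 = e y ⬝ᵥ M.mulVec (e y) := by
      intro y
      have : ∑ i, (t - μ i) * c y i ^ 2 =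
          c y ⬝ᵥ (Matrix.diagonal fun i => t - μ i).mulVec (c y) := by
        simp only [dotProduct, Matrix.mulVec_diagonal]
        exact Finset.sum_congr rfl fun i _ => by ring
      rw [this]
      simp only [hc]
      rw [hM, Matrix.mulVec_mulVec, Matrix.dotProduct_mulVec, ← Matrix.mulVec_transpose,
        Matrix.mulVec_mulVec, Matrix.transpose_mul, Matrix.transpose_transpose,
        Matrix.diagonal_transpose, dotProduct_comm]
    have hF' : Measurable (F t) := hFm.of_uncurry_left
    rw [lintegral_comp_linearMap ν hdet0 hF', ← lintegral_const_mul']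
    · refine lintegral_congr fun y => ?_
      have hne : ∀ i, t - μ i ≠ 0 := fun i => (sub_pos.2 (ht i)).ne'
      simp only [hF]
      rw [← mul_assoc, ← ENNReal.ofReal_mul (abs_nonneg _), hdet]
      have e1 : ∑ i, c (f y) i ^ 2 / (t - μ i) ^ 2 = e y ⬝ᵥ e y := by
        rw [← hnorm]
        refine Finset.sum_congr rfl fun i _ => ?_
        rw [hcf]
        field_simp [hne i]
      have e2 : ∑ i, c (f y) i ^ 2 / (t - μ i) = e y ⬝ᵥ M.mulVec (e y) := by
        rw [← hquad]
        refine Finset.sum_congr rfl fun i _ => ?_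
        rw [hcf]
        field_simp [hne i]
      rw [e1, e2, hfx]
    · exact ENNReal.ofReal_ne_top
  calc ∫⁻ b, (∫⁻ a, G a b) ∂ν = ∫⁻ b, (∫⁻ t in {t | ∀ i, μ i < t}, F t b) ∂ν := by
        refine lintegral_congr_ae ?_
        filter_upwards [hae] with b hb
        simp only [hF]
        exact lintegral_secular μ (c b) hb fun a => G a b
    _ = ∫⁻ t in {t | ∀ i, μ i < t}, ∫⁻ b, F t b ∂ν :=
        lintegral_lintegral_swap (hFm.comp measurable_swap).aemeasurable
    _ = _ := setLIntegral_congr_fun hUm hstep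

/-! ### Multiplicative spectral functions -/

/-- The product of `φ` over the real eigenvalues of `M`, counted with their algebraic
multiplicity. -/
def spectralProd {ι : Type*} [Fintype ι] [DecidableEq ι] (φ : ℝ → ℝ≥0∞) (M : Matrix ι ι ℝ) :
    ℝ≥0∞ :=
  (M.charpoly.roots.map φ).prod

section SpectralProd

variable {ι κ : Type*} [Fintype ι] [DecidableEq ι] [Fintype κ] [DecidableEq κ]

theorem mem_roots_charpoly_iff (M : Matrix ι ι ℝ) (t : ℝ) :
    t ∈ M.charpoly.roots ↔ (t • (1 : Matrix ι ι ℝ) - M).det = 0 := by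
  rw [Polynomial.mem_roots M.charpoly_monic.ne_zero, Polynomial.IsRoot, Matrix.eval_charpoly,
    Matrix.scalar_apply, ← Matrix.smul_one_eq_diagonal]

theorem spectralProd_mul (φ ψ : ℝ → ℝ≥0∞) (M : Matrix ι ι ℝ) :
    spectralProd (fun x => φ x * ψ x) M = spectralProd φ M * spectralProd ψ M := by
  simp [spectralProd, Multiset.prod_map_mul]

theorem spectralProd_one (M : Matrix ι ι ℝ) : spectralProd (fun _ => 1) M = 1 := by
  simp [spectralProd]

/-- For the indicator of `U` the spectral product is the indicator of the matrices all of whose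
real eigenvalues lie in `U`. -/
theorem spectralProd_indicator (U : Set ℝ) (M : Matrix ι ι ℝ) :
    spectralProd (U.indicator 1) M =
      {M : Matrix ι ι ℝ | ∀ t, t ∉ U → (t • (1 : Matrix ι ι ℝ) - M).det ≠ 0}.indicator 1 M := by
  by_cases h : M ∈ {M : Matrix ι ι ℝ | ∀ t, t ∉ U → (t • (1 : Matrix ι ι ℝ) - M).det ≠ 0}
  · rw [Set.indicator_of_mem h, spectralProd, Pi.one_apply]
    refine Multiset.prod_eq_one fun x hx => ?_
    obtain ⟨t, ht, rfl⟩ := Multiset.mem_map.1 hx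
    rw [Set.indicator_of_mem, Pi.one_apply]
    by_contra hU
    exact h t hU ((mem_roots_charpoly_iff M t).1 ht)
  · rw [Set.indicator_of_notMem h, spectralProd]
    rw [Set.mem_ofPred_eq] at h
    push Not at h
    obtain ⟨t, hU, ht⟩ := h
    refine Multiset.prod_eq_zero (Multiset.mem_map.2 ⟨t, (mem_roots_charpoly_iff M t).2 ht, ?_⟩)
    rw [Set.indicator_of_notMem hU]

theorem spectralProd_smul_one_add (φ : ℝ → ℝ≥0∞) (t : ℝ) (M : Matrix ι ι ℝ) :
    spectralProd φ (t • (1 : Matrix ι ι ℝ) + M) = spectralProd (fun x => φ (t + x)) M := by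
  have h := Matrix.charpoly_sub_scalar (t • (1 : Matrix ι ι ℝ) + M) t
  rw [Matrix.scalar_apply, ← Matrix.smul_one_eq_diagonal, add_sub_cancel_left] at h
  have h2 := Polynomial.map_roots_comp_C_mul_X_add_C (t • (1 : Matrix ι ι ℝ) + M).charpoly 1 t
    isUnit_one
  rw [Polynomial.C_1, one_mul, ← h] at h2
  rw [spectralProd, spectralProd, ← h2, Multiset.map_map]
  simp [add_comm]

/-- `A B` and `B A` have the same eigenvalues, up to the multiplicity of the eigenvalue `0`. -/
theorem spectralProd_mul_comm (φ : ℝ → ℝ≥0∞) (A : Matrix ι κ ℝ) (B : Matrix κ ι ℝ)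
    (h : Fintype.card κ ≤ Fintype.card ι) :
    spectralProd φ (A * B) =
      φ 0 ^ (Fintype.card ι - Fintype.card κ) * spectralProd φ (B * A) := by
  rw [spectralProd, spectralProd, Matrix.charpoly_mul_comm_of_le A B h, Polynomial.roots_mul]
  · simp [Multiset.map_nsmul, Multiset.prod_nsmul]
  · exact mul_ne_zero (pow_ne_zero _ Polynomial.X_ne_zero) (B * A).charpoly_monic.ne_zero

theorem spectralProd_eq_prod_eigenvalues (φ : ℝ → ℝ≥0∞) {M : Matrix ι ι ℝ} (hM : M.IsHermitian) :
    spectralProd φ M = ∏ i, φ (hM.eigenvalues i) := by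
  rw [spectralProd, hM.roots_charpoly_eq_eigenvalues]
  simp

theorem spectralProd_abs {M : Matrix ι ι ℝ} (hM : M.IsHermitian) :
    spectralProd (fun x => ENNReal.ofReal |x|) M = ENNReal.ofReal |M.det| := by
  rw [spectralProd_eq_prod_eigenvalues _ hM, ← ENNReal.ofReal_prod_of_nonneg
    (fun _ _ => abs_nonneg _), ← Finset.abs_prod, hM.det_eq_prod_eigenvalues]
  simp

theorem spectralProd_gaussian {M : Matrix ι ι ℝ} (hM : M.IsHermitian) :
    spectralProd (fun x => ENNReal.ofReal (Real.exp (-(1 / 2) * x ^ 2))) M =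
      ENNReal.ofReal (Real.exp (-(1 / 2) * (M * M).trace)) := by
  rw [spectralProd_eq_prod_eigenvalues _ hM, ← ENNReal.ofReal_prod_of_nonneg
    (fun _ _ => (Real.exp_nonneg _)), ← Real.exp_sum, ← Finset.mul_sum]
  obtain ⟨O, h1, h2, h3⟩ := exists_orthogonal_diagonalization hM
  have h4 : (M * M).trace = ∑ i, hM.eigenvalues i ^ 2 := by
    generalize hM.eigenvalues = μ at h3
    subst h3
    have : O * Matrix.diagonal μ * O.transpose * (O * Matrix.diagonal μ * O.transpose) =
        O * (Matrix.diagonal (fun i => μ i ^ 2) * O.transpose) := by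
      have h5 : Matrix.diagonal (fun i => μ i ^ 2) = Matrix.diagonal μ * Matrix.diagonal μ := by
        rw [Matrix.diagonal_mul_diagonal]; simp [sq]
      rw [h5]
      calc _ = O * Matrix.diagonal μ * (O.transpose * O) * Matrix.diagonal μ * O.transpose := by
            simp only [mul_assoc]
        _ = _ := by rw [h1]; simp only [mul_assoc, mul_one]
    rw [this, Matrix.trace_mul_comm, mul_assoc, h1, mul_one, Matrix.trace_diagonal]
  rw [h4]

end SpectralProd

/-! ### Hermitian matrices over a star algebra as real symmetric matrices -/

/-- The properties of `ℝ`, `ℂ` and the quaternions that matter here: the real basis `b` of the star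
algebra `K` is orthonormal for the inner product `re (star x * y)`, and the self-adjoint elements
are the real ones, `re` being the real part. -/
structure IsOrthonormalStarBasis {K : Type} [NormedRing K] [NormedAlgebra ℝ K] [StarRing K]
    {d : ℕ} (b : Basis (Fin d) ℝ K) (re : K →ₗ[ℝ] ℝ) : Prop where
  star_smul : ∀ (r : ℝ) (x : K), star (r • x) = r • star x
  re_one : re 1 = 1
  eq_algebraMap : ∀ x : K, star x = x → x = algebraMap ℝ K (re x)
  re_star_mul : ∀ i j, re (star (b i) * b j) = if i = j then 1 else 0

/-- The real matrix of left multiplication by `A`, in the real coordinates given by `b`. -/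
def realify {K : Type} [NormedRing K] [NormedAlgebra ℝ K] {d : ℕ} (b : Basis (Fin d) ℝ K)
    {m n : Type*} (A : Matrix m n K) : Matrix (m × Fin d) (n × Fin d) ℝ :=
  Matrix.of fun p q => b.repr (A p.1 q.1 * b q.2) p.2

section Realify

variable {K : Type} [NormedRing K] [NormedAlgebra ℝ K] {d : ℕ} {b : Basis (Fin d) ℝ K}

theorem repr_mul_eq_sum (x y : K) (r : Fin d) :
    b.repr (x * y) r = ∑ u, b.repr y u * b.repr (x * b u) r := by
  conv_lhs => rw [← b.sum_repr y, Finset.mul_sum, map_sum, Finsupp.finsetSum_apply]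
  simp

theorem realify_mulVec {m n : Type*} [Fintype n] (A : Matrix m n K) (v : n → K) :
    (realify b A).mulVec (fun q => b.repr (v q.1) q.2) = fun p => b.repr (A.mulVec v p.1) p.2 := by
  funext p
  simp only [Matrix.mulVec, dotProduct, realify, Matrix.of_apply, Fintype.sum_prod_type, map_sum,
    Finsupp.finsetSum_apply]
  refine Finset.sum_congr rfl fun j _ => ?_
  rw [repr_mul_eq_sum]
  exact Finset.sum_congr rfl fun _ _ => mul_comm _ _

theorem realify_mul {l m n : Type*} [Fintype m] (A : Matrix l m K) (B : Matrix m n K) :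
    realify b (A * B) = realify b A * realify b B := by
  ext p q
  simp only [Matrix.mul_apply, realify, Matrix.of_apply, Fintype.sum_prod_type, Finset.sum_mul,
    map_sum, Finsupp.finsetSum_apply]
  refine Finset.sum_congr rfl fun j _ => ?_
  rw [mul_assoc, repr_mul_eq_sum]
  exact Finset.sum_congr rfl fun _ _ => mul_comm _ _

theorem realify_add {m n : Type*} (A B : Matrix m n K) :
    realify b (A + B) = realify b A + realify b B := by
  ext p q; simp [realify, add_mul]

theorem realify_sub {m n : Type*} (A B : Matrix m n K) :
    realify b (A - B) = realify b A - realify b B := by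
  ext p q; simp [realify, sub_mul]

theorem realify_smul {m n : Type*} (r : ℝ) (A : Matrix m n K) :
    realify b (r • A) = r • realify b A := by
  ext p q; simp [realify]

theorem realify_one {m : Type*} [DecidableEq m] : realify b (1 : Matrix m m K) = 1 := by
  ext p q
  by_cases h1 : p.1 = q.1 <;> by_cases h2 : p.2 = q.2 <;>
    simp [realify, Matrix.one_apply, h1, h2, Prod.ext_iff]

theorem continuous_realify {m n : Type*} :
    Continuous fun A : Matrix m n K => realify b A := by
  have hb : ∀ r, Continuous fun x : K => b.repr x r := fun r => by
    have : FiniteDimensional ℝ K := b.finiteDimensional_of_finite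
    exact (b.coord r).continuous_of_finiteDimensional
  refine continuous_matrix fun p q => ?_
  simp only [realify, Matrix.of_apply]
  exact (hb _).comp ((continuous_id.matrix_elem p.1 q.1).mul continuous_const)

end Realify

namespace IsOrthonormalStarBasis

variable {K : Type} [NormedRing K] [NormedAlgebra ℝ K] [StarRing K] {d : ℕ}
  {b : Basis (Fin d) ℝ K} {re : K →ₗ[ℝ] ℝ}

theorem re_algebraMap (hb : IsOrthonormalStarBasis b re) (r : ℝ) : re (algebraMap ℝ K r) = r := by
  rw [Algebra.algebraMap_eq_smul_one, map_smul, hb.re_one, smul_eq_mul, mul_one]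

theorem star_algebraMap (hb : IsOrthonormalStarBasis b re) (r : ℝ) :
    star (algebraMap ℝ K r) = algebraMap ℝ K r := by
  rw [Algebra.algebraMap_eq_smul_one, hb.star_smul, star_one]

theorem repr_eq_re (hb : IsOrthonormalStarBasis b re) (x : K) (i : Fin d) :
    b.repr x i = re (star (b i) * x) := by
  conv_rhs => rw [← b.sum_repr x, Finset.mul_sum, map_sum]
  simp [hb.re_star_mul]

theorem re_star_mul_eq_sum (hb : IsOrthonormalStarBasis b re) (x y : K) :
    re (star x * y) = ∑ i, b.repr x i * b.repr y i := by
  conv_lhs => rw [← b.sum_repr x]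
  simp [star_sum, hb.star_smul, Finset.sum_mul, hb.repr_eq_re]

theorem re_star (hb : IsOrthonormalStarBasis b re) (x : K) : re (star x) = re x := by
  have h1 := hb.re_star_mul_eq_sum x 1
  have h2 := hb.re_star_mul_eq_sum 1 x
  rw [mul_one] at h1
  rw [star_one, one_mul] at h2
  rw [h1, h2]
  exact Finset.sum_congr rfl fun _ _ => mul_comm _ _

theorem star_mul_self_eq (hb : IsOrthonormalStarBasis b re) (x : K) :
    star x * x = algebraMap ℝ K (∑ i, b.repr x i ^ 2) := by
  rw [hb.eq_algebraMap (star x * x) (by simp), hb.re_star_mul_eq_sum]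
  simp [sq]

theorem realify_conjTranspose (hb : IsOrthonormalStarBasis b re) {m n : Type*} (A : Matrix m n K) :
    realify b A.conjTranspose = (realify b A).transpose := by
  ext p q
  simp only [realify, Matrix.of_apply, Matrix.conjTranspose_apply, Matrix.transpose_apply]
  rw [hb.repr_eq_re, hb.repr_eq_re, ← hb.re_star]
  simp [mul_assoc]

theorem realify_isHermitian (hb : IsOrthonormalStarBasis b re) {m : Type*} {A : Matrix m m K}
    (hA : A.IsHermitian) :
    (realify b A).IsHermitian := by
  rw [Matrix.IsHermitian, Matrix.conjTranspose_eq_transpose_of_trivial,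
    ← hb.realify_conjTranspose, hA]

end IsOrthonormalStarBasis

/-! ### Coordinates of Hermitian matrices -/

section Vectors

variable {K : Type} [NormedRing K] [NormedAlgebra ℝ K] {d : ℕ} {b : Basis (Fin d) ℝ K}

/-- The vector over `K` with real coordinates `y`. -/
def toVec (b : Basis (Fin d) ℝ K) {m : ℕ} (y : Fin m → Fin d → ℝ) : Fin m → K :=
  fun i => ∑ k, y i k • b k

theorem continuous_toVec {m : ℕ} :
    Continuous (toVec b : (Fin m → Fin d → ℝ) → Fin m → K) := by
  unfold toVec; fun_prop

theorem repr_toVec {m : ℕ} (y : Fin m → Fin d → ℝ) (i : Fin m) (k : Fin d) :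
    b.repr (toVec b y i) k = y i k := by
  rw [toVec, b.repr_sum_self]

theorem toVec_repr {m : ℕ} (v : Fin m → K) : toVec b (fun i k => b.repr (v i) k) = v := by
  funext i
  exact b.sum_repr (v i)

/-- The coordinates of a Hermitian matrix. -/
def coordOf (b : Basis (Fin d) ℝ K) (re : K →ₗ[ℝ] ℝ) (n : ℕ) :
    Matrix (Fin n) (Fin n) K →ₗ[ℝ] Coord d n where
  toFun M := (fun i => re (M i i), fun p k => b.repr (M p.1.1 p.1.2) k)
  map_add' M N := by ext <;> simp
  map_smul' r M := by ext <;> simp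

theorem continuous_coordOf (re : K →ₗ[ℝ] ℝ) (n : ℕ) : Continuous (coordOf b re n) := by
  have : FiniteDimensional ℝ K := b.finiteDimensional_of_finite
  exact LinearMap.continuous_of_finiteDimensional _

end Vectors

section Coordinates

variable {K : Type} [NormedRing K] [NormedAlgebra ℝ K] [StarRing K] {d : ℕ}
  {b : Basis (Fin d) ℝ K} {re : K →ₗ[ℝ] ℝ}

theorem hermitian_apply_of_lt {n : ℕ} (e : Fin d → K) (ω : Coord d n) {i j : Fin n} (h : i < j) :
    hermitian e ω i j = ∑ k, ω.2 ⟨(i, j), h⟩ k • e k := by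
  simp [hermitian, h]

theorem hermitian_apply_of_gt {n : ℕ} (e : Fin d → K) (ω : Coord d n) {i j : Fin n} (h : j < i) :
    hermitian e ω i j = star (∑ k, ω.2 ⟨(j, i), h⟩ k • e k) := by
  simp [hermitian, h, not_lt_of_gt h]

theorem hermitian_apply_self {n : ℕ} (e : Fin d → K) (ω : Coord d n) (i : Fin n) :
    hermitian e ω i i = algebraMap ℝ K (ω.1 i) := by
  simp [hermitian]

theorem isHermitian_hermitian (hb : IsOrthonormalStarBasis b re) {n : ℕ} (ω : Coord d n) :
    (hermitian b ω).IsHermitian := by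
  refine Matrix.IsHermitian.ext fun i j => ?_
  rcases lt_trichotomy i j with h | rfl | h
  · rw [hermitian_apply_of_lt b ω h, hermitian_apply_of_gt b ω h, star_star]
  · rw [hermitian_apply_self, hb.star_algebraMap]
  · rw [hermitian_apply_of_lt b ω h, hermitian_apply_of_gt b ω h]

theorem hermitian_add (hb : IsOrthonormalStarBasis b re) {n : ℕ} (ω ω' : Coord d n) :
    hermitian b (ω + ω') = hermitian b ω + hermitian b ω' := by
  ext i j
  rw [Matrix.add_apply]
  rcases lt_trichotomy i j with h | rfl | h
  · simp [hermitian_apply_of_lt b _ h, add_smul, Finset.sum_add_distrib]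
  · simp [hermitian_apply_self]
  · simp [hermitian_apply_of_gt b _ h, add_smul, Finset.sum_add_distrib, hb.star_smul]

theorem hermitian_smul (hb : IsOrthonormalStarBasis b re) {n : ℕ} (r : ℝ) (ω : Coord d n) :
    hermitian b (r • ω) = r • hermitian b ω := by
  ext i j
  rw [Matrix.smul_apply]
  rcases lt_trichotomy i j with h | rfl | h
  · simp [hermitian_apply_of_lt b _ h, Finset.smul_sum, smul_smul]
  · simp [hermitian_apply_self, Algebra.algebraMap_eq_smul_one, smul_smul]
  · simp [hermitian_apply_of_gt b _ h, Finset.smul_sum, smul_smul, hb.star_smul]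

/-- `hermitian` as a linear map. -/
def hermitianLinearMap (hb : IsOrthonormalStarBasis b re) (n : ℕ) :
    Coord d n →ₗ[ℝ] Matrix (Fin n) (Fin n) K where
  toFun := hermitian b
  map_add' := hermitian_add hb
  map_smul' := hermitian_smul hb

theorem continuous_hermitian (hb : IsOrthonormalStarBasis b re) (n : ℕ) :
    Continuous (hermitian b : Coord d n → _) :=
  (hermitianLinearMap hb n).continuous_of_finiteDimensional

/-- The coordinates of the scalar matrix `t`. -/
def scalarCoord (d n : ℕ) (t : ℝ) : Coord d n := (fun _ => t, 0)

theorem hermitian_scalarCoord {n : ℕ} (t : ℝ) :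
    hermitian b (scalarCoord d n t) = t • (1 : Matrix (Fin n) (Fin n) K) := by
  ext i j
  rcases eq_or_ne i j with rfl | h
  · simp [hermitian_apply_self, scalarCoord, Algebra.algebraMap_eq_smul_one]
  · rcases h.lt_or_gt with h' | h'
    · simp [hermitian_apply_of_lt b _ h', scalarCoord, h]
    · simp [hermitian_apply_of_gt b _ h', scalarCoord, h]

theorem continuous_scalarCoord (n : ℕ) : Continuous (scalarCoord d n) := by
  unfold scalarCoord; fun_prop

theorem hermitian_sub (hb : IsOrthonormalStarBasis b re) {n : ℕ} (ω ω' : Coord d n) :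
    hermitian b (ω - ω') = hermitian b ω - hermitian b ω' :=
  (hermitianLinearMap hb n).map_sub ω ω'

theorem hermitian_coordOf (hb : IsOrthonormalStarBasis b re) {n : ℕ}
    {M : Matrix (Fin n) (Fin n) K} (hM : M.IsHermitian) : hermitian b (coordOf b re n M) = M := by
  ext i j
  rcases lt_trichotomy i j with h | rfl | h
  · rw [hermitian_apply_of_lt b _ h]
    exact b.sum_repr (M i j)
  · rw [hermitian_apply_self]
    exact (hb.eq_algebraMap _ (hM.apply i i)).symm
  · rw [hermitian_apply_of_gt b _ h, ← hM.apply i j]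
    exact congrArg star (b.sum_repr (M j i))

theorem coordOf_hermitian (hb : IsOrthonormalStarBasis b re) {n : ℕ} (ω : Coord d n) :
    coordOf b re n (hermitian b ω) = ω := by
  refine Prod.ext ?_ ?_
  · funext i
    simp [coordOf, hermitian_apply_self, hb.re_algebraMap]
  · funext p k
    have : b.repr (∑ k, ω.2 p k • b k) k = ω.2 p k := by
      rw [b.repr_sum_self]
    simpa [coordOf, hermitian_apply_of_lt b ω p.2] using this

theorem star_dotProduct_self (hb : IsOrthonormalStarBasis b re) {m : ℕ} (v : Fin m → K) :
    star v ⬝ᵥ v = algebraMap ℝ K (∑ i, ∑ k, b.repr (v i) k ^ 2) := by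
  simp [dotProduct, hb.star_mul_self_eq]

end Coordinates

/-! ### Deflation of a bordered Hermitian matrix -/

section Deflation

variable {K : Type} [NormedRing K] [StarRing K] {m : ℕ}

/-- The `(m + 1) × m` matrix whose columns span the orthogonal complement of `(1, y)`. -/
def complementFrame (y : Fin m → K) : Matrix (Fin (m + 1)) (Fin m) K :=
  Matrix.of (Fin.cons (-star y) (1 : Matrix (Fin m) (Fin m) K))

theorem complementFrame_zero (y : Fin m → K) (j : Fin m) :
    complementFrame y 0 j = -star (y j) := rfl

theorem complementFrame_succ (y : Fin m → K) (i j : Fin m) :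
    complementFrame y i.succ j = (1 : Matrix (Fin m) (Fin m) K) i j := rfl

theorem sum_one_mul {K : Type} [NormedRing K] (i : Fin m) (f : Fin m → K) :
    ∑ k, (1 : Matrix (Fin m) (Fin m) K) i k * f k = f i := by
  simp [Matrix.one_apply]

theorem star_one_apply (i j : Fin m) :
    star ((1 : Matrix (Fin m) (Fin m) K) i j) = (1 : Matrix (Fin m) (Fin m) K) j i := by
  have := congrFun (congrFun (Matrix.conjTranspose_one (α := K) (n := Fin m)) j) i
  rwa [Matrix.conjTranspose_apply] at this

theorem complementFrame_conjTranspose_mul_self (y : Fin m → K) :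
    (complementFrame y).conjTranspose * complementFrame y = 1 + Matrix.vecMulVec y (star y) := by
  ext i j
  rw [Matrix.mul_apply, Fin.sum_univ_succ]
  simp only [Matrix.conjTranspose_apply, complementFrame_zero, complementFrame_succ,
    star_one_apply, sum_one_mul, star_neg, star_star, neg_mul_neg, Matrix.add_apply,
    Matrix.vecMulVec_apply, Pi.star_apply]
  rw [add_comm]

variable [NormedAlgebra ℝ K] {d : ℕ} {b : Basis (Fin d) ℝ K} {re : K →ₗ[ℝ] ℝ}

/-- The Hermitian matrix with corner `a`, first column `v` below the corner, and lower right
block `D`. -/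
def bordered (a : ℝ) (v : Fin m → K) (D : Matrix (Fin m) (Fin m) K) :
    Matrix (Fin (m + 1)) (Fin (m + 1)) K :=
  Matrix.of (Fin.cons (Fin.cons (algebraMap ℝ K a) (star v)) fun i => Fin.cons (v i) (D i))

theorem bordered_zero_zero (a : ℝ) (v : Fin m → K) (D : Matrix (Fin m) (Fin m) K) :
    bordered a v D 0 0 = algebraMap ℝ K a := rfl

theorem bordered_zero_succ (a : ℝ) (v : Fin m → K) (D : Matrix (Fin m) (Fin m) K) (j : Fin m) :
    bordered a v D 0 j.succ = star (v j) := rfl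

theorem bordered_succ_zero (a : ℝ) (v : Fin m → K) (D : Matrix (Fin m) (Fin m) K) (i : Fin m) :
    bordered a v D i.succ 0 = v i := rfl

theorem bordered_succ_succ (a : ℝ) (v : Fin m → K) (D : Matrix (Fin m) (Fin m) K)
    (i j : Fin m) : bordered a v D i.succ j.succ = D i j := rfl

/-- If `(1, y)` is an eigenvector of a bordered matrix with eigenvalue `t`, the matrix is `t` plus
a matrix living on the orthogonal complement of `(1, y)`. -/
theorem bordered_eq {D : Matrix (Fin m) (Fin m) K} (hD : D.IsHermitian)
    (hb : IsOrthonormalStarBasis b re) (y : Fin m → K) (t s : ℝ)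
    (hs : algebraMap ℝ K s = star y ⬝ᵥ (t • (1 : Matrix (Fin m) (Fin m) K) - D).mulVec y) :
    bordered (t - s) ((t • (1 : Matrix (Fin m) (Fin m) K) - D).mulVec y) D =
      t • (1 : Matrix (Fin (m + 1)) (Fin (m + 1)) K) + complementFrame y *
        ((D - t • (1 : Matrix (Fin m) (Fin m) K)) * (complementFrame y).conjTranspose) := by
  set E := D - t • (1 : Matrix (Fin m) (Fin m) K) with hE
  have hE' : t • (1 : Matrix (Fin m) (Fin m) K) - D = -E := by rw [hE, neg_sub]
  have hEh : E.IsHermitian := by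
    refine hD.sub ?_
    refine Matrix.IsHermitian.ext fun i j => ?_
    by_cases h : i = j
    · simp [h, hb.star_smul]
    · simp [Matrix.one_apply_ne h, Matrix.one_apply_ne (Ne.symm h)]
  rw [hE'] at hs ⊢
  have h10 : ∀ k, (E * (complementFrame y).conjTranspose) k 0 = -(E.mulVec y k) := by
    intro k
    rw [Matrix.mul_apply]
    simp [complementFrame_zero, Matrix.mulVec, dotProduct]
  have h11 : ∀ k j, (E * (complementFrame y).conjTranspose) k j.succ = E k j := by
    intro k j
    rw [Matrix.mul_apply]
    simp only [Matrix.conjTranspose_apply, complementFrame_succ, star_one_apply]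
    simp [Matrix.one_apply]
  have hstar : ∀ j, star (E.mulVec y j) = ∑ k, star (y k) * E k j := by
    intro j
    rw [Matrix.mulVec, dotProduct, star_sum]
    refine Finset.sum_congr rfl fun k _ => ?_
    rw [star_mul, hEh.apply]
  ext i j
  rw [Matrix.add_apply, Matrix.smul_apply, Matrix.mul_apply]
  induction i using Fin.cases with
  | zero =>
    induction j using Fin.cases with
    | zero =>
      simp only [bordered_zero_zero, complementFrame_zero, h10, map_sub, hs,
        Matrix.neg_mulVec, dotProduct, Pi.neg_apply, Pi.star_apply, mul_neg, neg_mul, neg_neg,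
        Finset.sum_neg_distrib, sub_neg_eq_add, Matrix.one_apply_eq,
        Algebra.algebraMap_eq_smul_one]
    | succ j =>
      simp only [bordered_zero_succ, complementFrame_zero, h11, Matrix.neg_mulVec, Pi.neg_apply,
        star_neg, hstar, neg_mul, Finset.sum_neg_distrib,
        Matrix.one_apply_ne (Fin.succ_ne_zero j).symm, smul_zero, zero_add]
  | succ i =>
    induction j using Fin.cases with
    | zero =>
      simp only [bordered_succ_zero, complementFrame_succ, h10, sum_one_mul, Matrix.neg_mulVec,
        Pi.neg_apply, Matrix.one_apply_ne (Fin.succ_ne_zero i), smul_zero, zero_add]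
    | succ j =>
      simp only [bordered_succ_succ, complementFrame_succ, h11, sum_one_mul]
      rw [hE, Matrix.sub_apply, Matrix.smul_apply]
      by_cases h : i = j
      · subst h; simp only [Matrix.one_apply_eq]; abel
      · simp [h]

/-- The positive square root of `1 + y y*`. -/
def rootFrame (b : Basis (Fin d) ℝ K) (y : Fin m → K) : Matrix (Fin m) (Fin m) K :=
  1 + (Real.sqrt (1 + ∑ i, ∑ k, b.repr (y i) k ^ 2) + 1)⁻¹ • Matrix.vecMulVec y (star y)

theorem vecMulVec_mul_self (hb : IsOrthonormalStarBasis b re) (y : Fin m → K) :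
    Matrix.vecMulVec y (star y) * Matrix.vecMulVec y (star y) =
      (∑ i, ∑ k, b.repr (y i) k ^ 2) • Matrix.vecMulVec y (star y) := by
  ext i j
  rw [Matrix.mul_apply]
  simp only [Matrix.vecMulVec_apply, Matrix.smul_apply]
  have h : ∀ k, y i * star y k * (y k * star y j) = y i * ((star y k * y k) * star y j) := by
    intro k; simp only [mul_assoc]
  simp only [h]
  rw [← Finset.mul_sum, ← Finset.sum_mul]
  have := star_dotProduct_self hb y
  rw [dotProduct] at this
  rw [this, Algebra.algebraMap_eq_smul_one, smul_mul_assoc, one_mul, mul_smul_comm]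

theorem rootFrame_mul_self (hb : IsOrthonormalStarBasis b re) (y : Fin m → K) :
    rootFrame b y * rootFrame b y = 1 + Matrix.vecMulVec y (star y) := by
  have hP := vecMulVec_mul_self hb y
  rw [rootFrame]
  set r : ℝ := ∑ i, ∑ k, b.repr (y i) k ^ 2 with hr
  set P := Matrix.vecMulVec y (star y)
  have hr0 : 0 ≤ r := Finset.sum_nonneg fun _ _ => Finset.sum_nonneg fun _ _ => sq_nonneg _
  set q := Real.sqrt (1 + r) with hq
  have hq2 : q * q = 1 + r := Real.mul_self_sqrt (by linarith)
  have hq0 : 0 ≤ q := Real.sqrt_nonneg _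
  have hq1 : q + 1 ≠ 0 := by positivity
  have : (1 + (q + 1)⁻¹ • P) * (1 + (q + 1)⁻¹ • P) =
      1 + ((q + 1)⁻¹ + (q + 1)⁻¹ + (q + 1)⁻¹ * (q + 1)⁻¹ * r) • P := by
    rw [mul_add, add_mul, add_mul, smul_mul_smul_comm, hP, smul_smul, one_mul, one_mul, mul_one,
      add_smul, add_smul]
    abel
  rw [this]
  have hc : (q + 1)⁻¹ + (q + 1)⁻¹ + (q + 1)⁻¹ * (q + 1)⁻¹ * r = 1 := by
    have : r = q * q - 1 := by linarith
    rw [this]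
    field_simp
    ring
  rw [hc, one_smul]

theorem isHermitian_rootFrame (hb : IsOrthonormalStarBasis b re) (y : Fin m → K) :
    (rootFrame b y).conjTranspose = rootFrame b y := by
  refine Matrix.IsHermitian.ext fun i j => ?_
  by_cases h : i = j
  · simp [h, rootFrame, Matrix.vecMulVec_apply, hb.star_smul]
  · simp [rootFrame, Matrix.vecMulVec_apply, hb.star_smul, Matrix.one_apply_ne h,
      Matrix.one_apply_ne (Ne.symm h)]

theorem exists_rootFrame_inverse (hb : IsOrthonormalStarBasis b re) (y : Fin m → K) :
    ∃ T, rootFrame b y * T = 1 ∧ T * rootFrame b y = 1 := by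
  have hP := vecMulVec_mul_self hb y
  have hS := rootFrame_mul_self hb y
  set r : ℝ := ∑ i, ∑ k, b.repr (y i) k ^ 2 with hr
  set P := Matrix.vecMulVec y (star y) with hPdef
  have hr0 : 0 ≤ r := Finset.sum_nonneg fun _ _ => Finset.sum_nonneg fun _ _ => sq_nonneg _
  -- Sherman–Morrison: `1 - P / (1 + r)` inverts `1 + P`
  set R := 1 - (1 + r)⁻¹ • P with hR
  have hcoef : (1 : ℝ) - (1 + r)⁻¹ - (1 + r)⁻¹ * r = 0 := by
    have : 1 + r ≠ 0 := by positivity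
    field_simp
    ring
  have h1 : (1 + P) * R = 1 := by
    have : (1 + P) * R = 1 + ((1 : ℝ) - (1 + r)⁻¹ - (1 + r)⁻¹ * r) • P := by
      rw [hR, add_mul, one_mul, mul_sub, mul_one, mul_smul_comm, hP, smul_smul, sub_smul, sub_smul,
        one_smul]
      abel
    rw [this, hcoef, zero_smul, add_zero]
  have h2 : R * (1 + P) = 1 := by
    have : R * (1 + P) = 1 + ((1 : ℝ) - (1 + r)⁻¹ - (1 + r)⁻¹ * r) • P := by
      rw [hR, mul_add, mul_one, sub_mul, one_mul, smul_mul_assoc, hP, smul_smul, sub_smul, sub_smul,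
        one_smul]
      abel
    rw [this, hcoef, zero_smul, add_zero]
  refine ⟨rootFrame b y * R, by rw [← mul_assoc, hS, h1], ?_⟩
  have h3 : R * rootFrame b y * rootFrame b y = 1 := by rw [mul_assoc, hS, h2]
  have h4 : rootFrame b y * (rootFrame b y * R) = 1 := by rw [← mul_assoc, hS, h1]
  have h5 : R * rootFrame b y = rootFrame b y * R := by
    calc R * rootFrame b y = R * rootFrame b y * (rootFrame b y * (rootFrame b y * R)) := by
          rw [h4, mul_one]
      _ = (R * rootFrame b y * rootFrame b y) * (rootFrame b y * R) := by simp only [mul_assoc]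
      _ = _ := by rw [h3, one_mul]
  rw [← h5, h3]

/-- The eigenvalues of the bordered matrix with eigenpair `t`, `(1, y)` are `t`, with the
multiplicity `d` of the real representation, and those of `t + S (D - t) S`, where
`S² = 1 + y y*`. -/
theorem spectralProd_bordered (φ : ℝ → ℝ≥0∞) {D : Matrix (Fin m) (Fin m) K} (hD : D.IsHermitian)
    (hb : IsOrthonormalStarBasis b re) (y : Fin m → K) (t s : ℝ)
    (hs : algebraMap ℝ K s = star y ⬝ᵥ (t • (1 : Matrix (Fin m) (Fin m) K) - D).mulVec y) :
    spectralProd φ (realify b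
        (bordered (t - s) ((t • (1 : Matrix (Fin m) (Fin m) K) - D).mulVec y) D)) =
      φ t ^ d * spectralProd φ (realify b (t • (1 : Matrix (Fin m) (Fin m) K) +
        rootFrame b y * (D - t • (1 : Matrix (Fin m) (Fin m) K)) *
          (rootFrame b y).conjTranspose)) := by
  have hcard : Fintype.card (Fin (m + 1) × Fin d) - Fintype.card (Fin m × Fin d) = d := by
    simp [add_mul]
  have hle : Fintype.card (Fin m × Fin d) ≤ Fintype.card (Fin (m + 1) × Fin d) := by
    simp [add_mul]
  rw [bordered_eq hD hb y t s hs, realify_add, realify_smul, realify_one,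
    spectralProd_smul_one_add, realify_mul, spectralProd_mul_comm _ _ _ hle, hcard, add_zero,
    ← realify_mul, Matrix.mul_assoc, complementFrame_conjTranspose_mul_self,
    ← rootFrame_mul_self hb, ← mul_assoc, realify_mul, spectralProd_mul_comm _ _ _ le_rfl,
    Nat.sub_self, pow_zero, one_mul,
    ← realify_mul, ← mul_assoc, isHermitian_rootFrame hb, realify_add, realify_smul, realify_one,
    spectralProd_smul_one_add]

end Deflation

/-! ### Splitting off the first row of the coordinates -/

instance isAddHaarMeasure_volume_pi_pi (m d : ℕ) :
    (volume : Measure (Fin m → Fin d → ℝ)).IsAddHaarMeasure := by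
  have : (volume : Measure (Fin d → ℝ)).IsAddHaarMeasure := inferInstance
  infer_instance

instance isAddHaarMeasure_volume_coord (d n : ℕ) :
    (volume : Measure (Coord d n)).IsAddHaarMeasure := by
  have : (volume : Measure (Fin d → ℝ)).IsAddHaarMeasure := inferInstance
  have : (volume : Measure ({p : Fin n × Fin n // p.1 < p.2} → Fin d → ℝ)).IsAddHaarMeasure :=
    inferInstance
  exact Measure.prod.instIsAddHaarMeasure volume volume

/-- The positions above the diagonal: those in the first row, and the others. -/
def upperEquiv (m : ℕ) : Fin m ⊕ {p : Fin m × Fin m // p.1 < p.2} ≃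
    {p : Fin (m + 1) × Fin (m + 1) // p.1 < p.2} :=
  Equiv.ofBijective
    (Sum.elim (fun j => ⟨(0, j.succ), Fin.succ_pos j⟩)
      fun p => ⟨(p.1.1.succ, p.1.2.succ), Fin.succ_lt_succ_iff.2 p.2⟩) (by
    constructor
    · rintro (i | ⟨⟨i, j⟩, h⟩) (i' | ⟨⟨i', j'⟩, h'⟩) H
      · simpa using H
      · have := congrArg (fun p => p.1.1) H
        exact absurd this.symm (Fin.succ_ne_zero _)
      · have := congrArg (fun p => p.1.1) H
        exact absurd this (Fin.succ_ne_zero _)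
      · simpa using H
    · rintro ⟨⟨i, j⟩, h⟩
      induction j using Fin.cases with
      | zero => exact absurd h (Fin.not_lt_zero i)
      | succ j =>
        induction i using Fin.cases with
        | zero => exact ⟨Sum.inl j, rfl⟩
        | succ i => exact ⟨Sum.inr ⟨(i, j), Fin.succ_lt_succ_iff.1 h⟩, rfl⟩)

/-- The coordinates of the matrix with corner `a`, the rest `y` of the first row, and lower right
block with coordinates `D`. -/
def glue {d m : ℕ} (a : ℝ) (y : Fin m → Fin d → ℝ) (D : Coord d m) : Coord d (m + 1) :=
  (Fin.cons a D.1, fun p => Sum.elim y D.2 ((upperEquiv m).symm p))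

theorem measurePreserving_glue (d m : ℕ) :
    MeasurePreserving (fun q : (ℝ × (Fin m → ℝ)) ×
      ((Fin m → Fin d → ℝ) × ({p : Fin m × Fin m // p.1 < p.2} → Fin d → ℝ)) =>
        glue q.1.1 q.2.1 (q.1.2, q.2.2)) := by
  have h1 := (volume_preserving_piFinSuccAbove (fun _ : Fin (m + 1) => ℝ) 0).symm
  have h2 := (volume_measurePreserving_piCongrLeft (fun _ => Fin d → ℝ) (upperEquiv m)).comp
    (volume_measurePreserving_sumPiEquivProdPi_symm
      (fun _ : Fin m ⊕ {p : Fin m × Fin m // p.1 < p.2} => Fin d → ℝ))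
  have h3 := h1.prod h2
  have h4 : (fun q : (ℝ × (Fin m → ℝ)) ×
      ((Fin m → Fin d → ℝ) × ({p : Fin m × Fin m // p.1 < p.2} → Fin d → ℝ)) =>
        glue q.1.1 q.2.1 (q.1.2, q.2.2)) = Prod.map
      (MeasurableEquiv.piFinSuccAbove (fun _ : Fin (m + 1) => ℝ) 0).symm
      (MeasurableEquiv.piCongrLeft (fun _ => Fin d → ℝ) (upperEquiv m) ∘
        (MeasurableEquiv.sumPiEquivProdPi
          (fun _ : Fin m ⊕ {p : Fin m × Fin m // p.1 < p.2} => Fin d → ℝ)).symm) := by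
    funext q
    refine Prod.ext ?_ ?_
    · simp [glue, MeasurableEquiv.piFinSuccAbove, Fin.insertNthEquiv]
    · funext p
      obtain ⟨s, rfl⟩ := (upperEquiv m).surjective p
      have := Equiv.piCongrLeft_apply_apply
        (fun _ : {p : Fin (m + 1) × Fin (m + 1) // p.1 < p.2} => Fin d → ℝ) (upperEquiv m)
        ((MeasurableEquiv.sumPiEquivProdPi
          (fun _ : Fin m ⊕ {p : Fin m × Fin m // p.1 < p.2} => Fin d → ℝ)).symm q.2) s
      refine Eq.trans ?_ this.symm
      simp only [glue, Equiv.symm_apply_apply]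
      rcases s with s | s <;> rfl
  rw [h4]
  exact h3

theorem measurable_glue (d m : ℕ) :
    Measurable fun q : ℝ × (Fin m → Fin d → ℝ) × Coord d m => glue q.1 q.2.1 q.2.2 := by
  have h := (measurePreserving_glue d m).measurable
  have h2 : Measurable fun q : ℝ × (Fin m → Fin d → ℝ) × Coord d m =>
      (((q.1, q.2.2.1), (q.2.1, q.2.2.2)) : (ℝ × (Fin m → ℝ)) ×
      ((Fin m → Fin d → ℝ) × ({p : Fin m × Fin m // p.1 < p.2} → Fin d → ℝ))) := by fun_prop
  exact h.comp h2

theorem lintegral_coord_succ {d m : ℕ} {F : Coord d (m + 1) → ℝ≥0∞} (hF : Measurable F) :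
    ∫⁻ ω, F ω = ∫⁻ D : Coord d m, ∫⁻ y : Fin m → Fin d → ℝ, ∫⁻ a : ℝ, F (glue a y D) := by
  have hFg : Measurable fun q : ℝ × (Fin m → Fin d → ℝ) × Coord d m => F (glue q.1 q.2.1 q.2.2) :=
    hF.comp (measurable_glue d m)
  have hFq : Measurable fun q : (ℝ × (Fin m → ℝ)) ×
      ((Fin m → Fin d → ℝ) × ({p : Fin m × Fin m // p.1 < p.2} → Fin d → ℝ)) =>
        F (glue q.1.1 q.2.1 (q.1.2, q.2.2)) := hF.comp (measurePreserving_glue d m).measurable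
  rw [← (measurePreserving_glue d m).lintegral_comp hF, Measure.volume_eq_prod,
    lintegral_prod _ hFq.aemeasurable, Measure.volume_eq_prod ℝ,
    lintegral_prod_symm' _ hFq.lintegral_prod_right']
  have hFD : Measurable fun D : Coord d m => ∫⁻ y : Fin m → Fin d → ℝ, ∫⁻ a : ℝ,
      F (glue a y D) := by
    have h1 : Measurable fun q : (Coord d m × (Fin m → Fin d → ℝ)) × ℝ =>
        F (glue q.2 q.1.2 q.1.1) :=
      hFg.comp (f := fun q : (Coord d m × (Fin m → Fin d → ℝ)) × ℝ => (q.2, q.1.2, q.1.1))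
        (by fun_prop)
    exact h1.lintegral_prod_right'.lintegral_prod_right'
  refine Eq.trans ?_ (lintegral_prod _ hFD.aemeasurable).symm
  refine lintegral_congr fun D₁ => ?_
  have h2 : Measurable fun q : ℝ × ((Fin m → Fin d → ℝ) ×
      ({p : Fin m × Fin m // p.1 < p.2} → Fin d → ℝ)) => F (glue q.1 q.2.1 (D₁, q.2.2)) :=
    hFq.comp (f := fun q : ℝ × ((Fin m → Fin d → ℝ) ×
      ({p : Fin m × Fin m // p.1 < p.2} → Fin d → ℝ)) => ((q.1, D₁), q.2)) (by fun_prop)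
  rw [lintegral_lintegral_swap h2.aemeasurable]
  exact lintegral_prod_symm' _ (h2.comp measurable_swap).lintegral_prod_right'

/-! ### Measurability of spectral products -/

/-- The functions `φ` for which the product of `φ` over the spectrum is a measurable function of
the matrix. -/
structure SpectrallyMeasurable {K : Type} [NormedRing K] [NormedAlgebra ℝ K] [StarRing K] {d : ℕ}
    (b : Basis (Fin d) ℝ K) (φ : ℝ → ℝ≥0∞) : Prop where
  measurable : Measurable φ
  measurable_spectralProd : ∀ n : ℕ, Measurable fun ω : Coord d n =>
    spectralProd φ (realify b (hermitian b ω))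

/-- The set of matrices with an eigenvalue in a compact set is closed, being the projection of a
closed set along a compact space. -/
theorem measurableSet_forall_det_ne {X : Type*} [TopologicalSpace X] [MeasurableSpace X]
    [OpensMeasurableSpace X] {ι : Type*} [Fintype ι] [DecidableEq ι] {f : X → Matrix ι ι ℝ}
    (hf : Continuous f) {U : Set ℝ} (hU : IsSigmaCompact Uᶜ) :
    MeasurableSet {x | ∀ t, t ∉ U → (t • (1 : Matrix ι ι ℝ) - f x).det ≠ 0} := by
  obtain ⟨C, hC, hCU⟩ := hU
  have h : {x | ∀ t, t ∉ U → (t • (1 : Matrix ι ι ℝ) - f x).det ≠ 0} =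
      (⋃ n, Prod.snd '' {p : C n × X | ((p.1 : ℝ) • (1 : Matrix ι ι ℝ) - f p.2).det = 0})ᶜ := by
    ext x
    simp only [Set.mem_ofPred_eq, Set.mem_compl_iff, Set.mem_iUnion, Set.mem_image, not_exists,
      not_and, Prod.forall, Subtype.forall]
    constructor
    · rintro H n t ht x' h0 rfl
      exact H t (by rw [← Set.mem_compl_iff, ← hCU]; exact Set.mem_iUnion.2 ⟨n, ht⟩) h0
    · intro H t ht h0
      rw [← Set.mem_compl_iff, ← hCU] at ht
      obtain ⟨n, hn⟩ := Set.mem_iUnion.1 ht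
      exact H n t hn x h0 rfl
  rw [h]
  refine (MeasurableSet.iUnion fun n => IsClosed.measurableSet ?_).compl
  have : CompactSpace (C n) := isCompact_iff_compactSpace.1 (hC n)
  refine isClosedMap_snd_of_compactSpace _ (isClosed_singleton.preimage (f := fun p : C n × X =>
    ((p.1 : ℝ) • (1 : Matrix ι ι ℝ) - f p.2).det) ?_)
  exact Continuous.matrix_det (by fun_prop)

namespace SpectrallyMeasurable

variable {K : Type} [NormedRing K] [NormedAlgebra ℝ K] [StarRing K] {d : ℕ}
  {b : Basis (Fin d) ℝ K} {re : K →ₗ[ℝ] ℝ}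

theorem one : SpectrallyMeasurable b fun _ => 1 :=
  ⟨measurable_const, fun n => by simp only [spectralProd_one]; exact measurable_const⟩

theorem mul {φ ψ : ℝ → ℝ≥0∞} (hφ : SpectrallyMeasurable b φ) (hψ : SpectrallyMeasurable b ψ) :
    SpectrallyMeasurable b fun x => φ x * ψ x :=
  ⟨hφ.measurable.mul hψ.measurable, fun n => by
    simp only [spectralProd_mul]
    exact (hφ.measurable_spectralProd n).mul (hψ.measurable_spectralProd n)⟩

theorem continuous_realify_hermitian (hb : IsOrthonormalStarBasis b re) (n : ℕ) :
    Continuous fun ω : Coord d n => realify b (hermitian b ω) :=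
  continuous_realify.comp (continuous_hermitian hb n)

theorem indicator (hb : IsOrthonormalStarBasis b re) {U : Set ℝ} (hU : IsSigmaCompact Uᶜ)
    (hUm : MeasurableSet U) : SpectrallyMeasurable b (U.indicator 1) :=
  ⟨measurable_one.indicator hUm, fun n => by
    simp only [spectralProd_indicator]
    exact measurable_one.indicator (measurableSet_forall_det_ne
      (continuous_realify_hermitian hb n) hU)⟩

theorem ofReal_abs (hb : IsOrthonormalStarBasis b re) :
    SpectrallyMeasurable b fun x => ENNReal.ofReal |x| :=
  ⟨by fun_prop, fun n => by
    simp only [spectralProd_abs (hb.realify_isHermitian (isHermitian_hermitian hb _))]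
    exact ((continuous_realify_hermitian hb n).matrix_det.measurable.abs).ennreal_ofReal⟩

theorem gaussian (hb : IsOrthonormalStarBasis b re) :
    SpectrallyMeasurable b fun x => ENNReal.ofReal (Real.exp (-(1 / 2) * x ^ 2)) :=
  ⟨by fun_prop, fun n => by
    simp only [spectralProd_gaussian (hb.realify_isHermitian (isHermitian_hermitian hb _))]
    have := continuous_realify_hermitian hb n
    exact (Continuous.measurable (by fun_prop)).ennreal_ofReal⟩

theorem comp_sub {φ : ℝ → ℝ≥0∞} (hφ : SpectrallyMeasurable b φ)
    (hb : IsOrthonormalStarBasis b re) (t : ℝ) : SpectrallyMeasurable b fun x => φ (-t + x) :=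
  ⟨hφ.measurable.comp (by fun_prop), fun n => by
    have h : ∀ ω : Coord d n, spectralProd (fun x => φ (-t + x)) (realify b (hermitian b ω)) =
        spectralProd φ (realify b (hermitian b (scalarCoord d n (-t) + ω))) := by
      intro ω
      rw [hermitian_add hb, hermitian_scalarCoord, realify_add, realify_smul, realify_one,
        spectralProd_smul_one_add]
    simp only [h]
    exact (hφ.measurable_spectralProd n).comp (by fun_prop)⟩

end SpectrallyMeasurable

/-! ### Congruence by the square root of `1 + y y*` -/

theorem continuous_linearMap_det {X V : Type*} [TopologicalSpace X] [NormedAddCommGroup V]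
    [NormedSpace ℝ V] [FiniteDimensional ℝ V] {f : X → V →ₗ[ℝ] V}
    (hf : ∀ v, Continuous fun x => f x v) : Continuous fun x => LinearMap.det (f x) := by
  let B := Module.finBasis ℝ V
  simp only [← LinearMap.det_toMatrix B]
  refine Continuous.matrix_det (continuous_matrix fun i j => ?_)
  simp only [LinearMap.toMatrix_apply]
  exact (B.coord i).continuous_of_finiteDimensional.comp (hf (B j))

theorem spectralProd_indicator_Iio {ι : Type*} [Fintype ι] [DecidableEq ι] {M : Matrix ι ι ℝ}
    (hM : M.IsHermitian) (t : ℝ) :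
    spectralProd ((Set.Iio t).indicator 1) M =
      {t : ℝ | (t • (1 : Matrix ι ι ℝ) - M).PosDef}.indicator 1 t := by
  rw [spectralProd_eq_prod_eigenvalues _ hM]
  by_cases h : t ∈ {t : ℝ | (t • (1 : Matrix ι ι ℝ) - M).PosDef}
  · rw [Set.indicator_of_mem h, Pi.one_apply]
    refine Finset.prod_eq_one fun i _ => ?_
    rw [Set.indicator_of_mem, Pi.one_apply]
    exact (posDef_smul_one_sub_iff hM t).1 h i
  · rw [Set.indicator_of_notMem h]
    rw [Set.mem_ofPred_eq, posDef_smul_one_sub_iff hM] at h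
    push Not at h
    obtain ⟨i, hi⟩ := h
    refine Finset.prod_eq_zero (Finset.mem_univ i) (Set.indicator_of_notMem ?_ _)
    simpa using hi

/-- The function `|x|` restricted to `x < 0`. Its product over the spectrum of `Q - t` is the
Jacobian factor `|det (Q - t)|` together with the condition that `t` exceeds all eigenvalues. -/
def negAbs (x : ℝ) : ℝ≥0∞ := ENNReal.ofReal |x| * (Set.Iio (0 : ℝ)).indicator 1 x

theorem spectralProd_negAbs {ι : Type*} [Fintype ι] [DecidableEq ι] {M : Matrix ι ι ℝ}
    (hM : M.IsHermitian) :
    spectralProd negAbs M =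
      ENNReal.ofReal |M.det| * {M : Matrix ι ι ℝ | (-M).PosDef}.indicator 1 M := by
  have h : spectralProd negAbs M = _ := spectralProd_mul _ _ M
  have h2 := spectralProd_indicator_Iio hM 0
  have h3 : {t : ℝ | (t • (1 : Matrix ι ι ℝ) - M).PosDef}.indicator (1 : ℝ → ℝ≥0∞) 0 =
      {M : Matrix ι ι ℝ | (-M).PosDef}.indicator 1 M := by
    classical
    simp only [Set.indicator_apply, Set.mem_ofPred_eq, zero_smul, zero_sub, Pi.one_apply]
  rw [h, spectralProd_abs hM, h2, h3]

theorem spectralProd_negAbs_congruence {ι : Type*} [Fintype ι] [DecidableEq ι]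
    {M S : Matrix ι ι ℝ} (hM : M.IsHermitian) (hS : IsUnit S) :
    spectralProd negAbs (S * M * S.transpose) =
      ENNReal.ofReal (S.det ^ 2) * spectralProd negAbs M := by
  have hM' : (S * M * S.transpose).IsHermitian := by
    have := Matrix.isHermitian_mul_mul_conjTranspose S hM
    rwa [Matrix.conjTranspose_eq_transpose_of_trivial] at this
  rw [spectralProd_negAbs hM, spectralProd_negAbs hM', ← mul_assoc,
    ← ENNReal.ofReal_mul (sq_nonneg _)]
  congr 1
  · rw [Matrix.det_mul, Matrix.det_mul, Matrix.det_transpose, abs_mul, abs_mul, ← sq_abs S.det]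
    congr 1
    ring
  · have h := Matrix.IsUnit.posDef_star_right_conjugate_iff hS (x := -M)
    rw [Matrix.star_eq_conjTranspose, Matrix.conjTranspose_eq_transpose_of_trivial, mul_neg,
      neg_mul] at h
    classical
    simp only [Set.indicator_apply, Set.mem_ofPred_eq, h, Pi.one_apply]

section Recursion

variable {K : Type} [NormedRing K] [NormedAlgebra ℝ K] [StarRing K] {d : ℕ}
  {b : Basis (Fin d) ℝ K} {re : K →ₗ[ℝ] ℝ}

theorem spectrallyMeasurable_negAbs (hb : IsOrthonormalStarBasis b re) :
    SpectrallyMeasurable b negAbs :=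
  (SpectrallyMeasurable.ofReal_abs hb).mul (SpectrallyMeasurable.indicator hb
    (by rw [Set.compl_Iio]; exact isSigmaCompact_univ.of_isClosed_subset isClosed_Ici
          (Set.subset_univ _)) measurableSet_Iio)

theorem IsOrthonormalStarBasis.continuousStar (hb : IsOrthonormalStarBasis b re) :
    ContinuousStar K := by
  have : FiniteDimensional ℝ K := b.finiteDimensional_of_finite
  let L : K →ₗ[ℝ] K := { toFun := star, map_add' := star_add, map_smul' := hb.star_smul }
  exact ⟨L.continuous_of_finiteDimensional⟩

theorem continuous_rootFrame (hb : IsOrthonormalStarBasis b re) {m : ℕ} :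
    Continuous fun y : Fin m → Fin d → ℝ => rootFrame b (toVec b y) := by
  have := hb.continuousStar
  have h1 : Continuous (toVec b : (Fin m → Fin d → ℝ) → Fin m → K) := continuous_toVec
  have h2 : ∀ i, Continuous fun y : Fin m → Fin d → ℝ => toVec b y i := fun i =>
    (continuous_apply i).comp h1
  have h3 : Continuous fun y : Fin m → Fin d → ℝ =>
      (Real.sqrt (1 + ∑ i, ∑ k, y i k ^ 2) + 1)⁻¹ :=
    Continuous.inv₀ (by fun_prop) fun y => by positivity
  have h4 : Continuous fun y : Fin m → Fin d → ℝ =>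
      Matrix.vecMulVec (toVec b y) (star (toVec b y)) := by
    refine continuous_matrix fun i j => ?_
    simp only [Matrix.vecMulVec_apply, Pi.star_apply]
    exact (h2 i).mul (h2 j).star
  simp only [rootFrame, repr_toVec]
  exact continuous_const.add (h3.smul h4)

/-- Congruence by the square root of `1 + y y*`, in coordinates. -/
def congruence (hb : IsOrthonormalStarBasis b re) {m : ℕ} (y : Fin m → Fin d → ℝ) :
    Coord d m →ₗ[ℝ] Coord d m where
  toFun ω := coordOf b re m (rootFrame b (toVec b y) * hermitian b ω *
    (rootFrame b (toVec b y)).conjTranspose)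
  map_add' ω ω' := by rw [hermitian_add hb, mul_add, add_mul, map_add]
  map_smul' r ω := by
    rw [hermitian_smul hb, mul_smul_comm, smul_mul_assoc, map_smul, RingHom.id_apply]

theorem hermitian_congruence (hb : IsOrthonormalStarBasis b re) {m : ℕ} (y : Fin m → Fin d → ℝ)
    (ω : Coord d m) : hermitian b (congruence hb y ω) = rootFrame b (toVec b y) *
      hermitian b ω * (rootFrame b (toVec b y)).conjTranspose :=
  hermitian_coordOf hb (Matrix.isHermitian_mul_mul_conjTranspose _ (isHermitian_hermitian hb ω))

theorem det_congruence_ne_zero (hb : IsOrthonormalStarBasis b re) {m : ℕ}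
    (y : Fin m → Fin d → ℝ) : LinearMap.det (congruence hb y) ≠ 0 := by
  obtain ⟨T, h1, h2⟩ := exists_rootFrame_inverse hb (toVec b y)
  have hinj : Function.Injective (congruence hb y) := by
    intro ω ω' h
    have h3 := congrArg (fun ω => T * hermitian b ω * T.conjTranspose) h
    simp only [hermitian_congruence] at h3
    have h4 : ∀ M : Matrix (Fin m) (Fin m) K, T * (rootFrame b (toVec b y) * M *
        (rootFrame b (toVec b y)).conjTranspose) * T.conjTranspose = M := by
      intro M
      calc _ = (T * rootFrame b (toVec b y)) * M *
            ((rootFrame b (toVec b y)).conjTranspose * T.conjTranspose) := by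
              simp only [mul_assoc]
        _ = M := by
              rw [← Matrix.conjTranspose_mul, h2, Matrix.conjTranspose_one, one_mul, mul_one]
    rw [h4, h4] at h3
    rw [← coordOf_hermitian hb ω, h3, coordOf_hermitian hb]
  intro h0
  exact (LinearMap.bot_lt_ker_of_det_eq_zero h0).ne' (LinearMap.ker_eq_bot.2 hinj)

theorem continuous_congruence (hb : IsOrthonormalStarBasis b re) (m : ℕ) :
    Continuous fun q : (Fin m → Fin d → ℝ) × Coord d m => congruence hb q.1 q.2 := by
  have := hb.continuousStar
  have h1 : Continuous fun q : (Fin m → Fin d → ℝ) × Coord d m => rootFrame b (toVec b q.1) :=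
    (continuous_rootFrame hb).comp continuous_fst
  have h2 : Continuous fun q : (Fin m → Fin d → ℝ) × Coord d m => hermitian b q.2 :=
    (continuous_hermitian hb m).comp continuous_snd
  exact (continuous_coordOf re m).comp ((h1.mul h2).mul h1.matrix_conjTranspose)

theorem isUnit_realify_rootFrame (hb : IsOrthonormalStarBasis b re) {m : ℕ} (y : Fin m → K) :
    IsUnit (realify b (rootFrame b y)) := by
  obtain ⟨T, h1, h2⟩ := exists_rootFrame_inverse hb y
  refine ⟨⟨realify b (rootFrame b y), realify b T, ?_, ?_⟩, rfl⟩
  · rw [← realify_mul, h1, realify_one]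
  · rw [← realify_mul, h2, realify_one]

theorem spectralProd_negAbs_hermitian_congruence (hb : IsOrthonormalStarBasis b re) {m : ℕ}
    (y : Fin m → Fin d → ℝ) (ω : Coord d m) :
    spectralProd negAbs (realify b (hermitian b (congruence hb y ω))) =
      ENNReal.ofReal ((realify b (rootFrame b (toVec b y))).det ^ 2) *
        spectralProd negAbs (realify b (hermitian b ω)) := by
  rw [hermitian_congruence, realify_mul, realify_mul, hb.realify_conjTranspose,
    spectralProd_negAbs_congruence (hb.realify_isHermitian (isHermitian_hermitian hb ω))
      (isUnit_realify_rootFrame hb _)]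

/-- The Jacobian of the congruence, including its effect on the factor `|det|`. -/
def congruenceJacobian (hb : IsOrthonormalStarBasis b re) {m : ℕ} (y : Fin m → Fin d → ℝ) : ℝ :=
  |LinearMap.det (congruence hb y)| * (realify b (rootFrame b (toVec b y))).det ^ 2

theorem congruenceJacobian_pos (hb : IsOrthonormalStarBasis b re) {m : ℕ}
    (y : Fin m → Fin d → ℝ) : 0 < congruenceJacobian hb y :=
  mul_pos (abs_pos.2 (det_congruence_ne_zero hb y)) (sq_pos_of_ne_zero
    ((Matrix.isUnit_iff_isUnit_det _).1 (isUnit_realify_rootFrame hb _)).ne_zero)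

theorem continuous_congruenceJacobian (hb : IsOrthonormalStarBasis b re) (m : ℕ) :
    Continuous fun y : Fin m → Fin d → ℝ => congruenceJacobian hb y := by
  have h1 : Continuous fun y : Fin m → Fin d → ℝ => LinearMap.det (congruence hb y) :=
    continuous_linearMap_det fun ω => by
      have h := continuous_congruence hb m
      fun_prop
  have h2 : Continuous fun y : Fin m → Fin d → ℝ => (realify b (rootFrame b (toVec b y))).det :=
    (continuous_realify.comp (continuous_rootFrame hb)).matrix_det
  exact h1.abs.mul (h2.pow 2)

/-- The substitution `E ↦ t + S E S` with `S² = 1 + y y*`. It multiplies `|det E|` by `det S ^ 2`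
and preserves negative definiteness, so the factor `negAbs` is carried along. -/
theorem lintegral_congruence (hb : IsOrthonormalStarBasis b re) {φ : ℝ → ℝ≥0∞}
    (hφ : SpectrallyMeasurable b φ) {m : ℕ} (y : Fin m → Fin d → ℝ) (t : ℝ) :
    ∫⁻ E : Coord d m, spectralProd negAbs (realify b (hermitian b E)) *
        spectralProd φ (realify b (hermitian b (scalarCoord d m t + congruence hb y E))) =
      ENNReal.ofReal (congruenceJacobian hb y)⁻¹ * ∫⁻ ω : Coord d m,
        spectralProd (fun x => φ x * negAbs (-t + x)) (realify b (hermitian b ω)) := by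
  have hN := spectrallyMeasurable_negAbs hb (b := b)
  have hJ := congruenceJacobian_pos hb y
  set F : Coord d m → ℝ≥0∞ := fun E => spectralProd negAbs (realify b (hermitian b E)) *
    spectralProd φ (realify b (hermitian b (scalarCoord d m t + E))) with hF
  have hFm : Measurable F := (hN.measurable_spectralProd m).mul
    ((hφ.measurable_spectralProd m).comp (by fun_prop))
  have h1 := lintegral_comp_linearMap volume (det_congruence_ne_zero hb y) hFm
  have h2 : ∫⁻ E, F (congruence hb y E) =
      ENNReal.ofReal ((realify b (rootFrame b (toVec b y))).det ^ 2) *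
      ∫⁻ E : Coord d m, spectralProd negAbs (realify b (hermitian b E)) *
        spectralProd φ (realify b (hermitian b (scalarCoord d m t + congruence hb y E))) := by
    rw [← lintegral_const_mul' _ _ ENNReal.ofReal_ne_top]
    refine lintegral_congr fun E => ?_
    simp only [hF]
    rw [spectralProd_negAbs_hermitian_congruence, mul_assoc]
  rw [h2, ← mul_assoc, ← ENNReal.ofReal_mul (abs_nonneg _)] at h1
  have h3 : ∫⁻ E, F E = ∫⁻ ω : Coord d m,
      spectralProd (fun x => φ x * negAbs (-t + x)) (realify b (hermitian b ω)) := by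
    rw [← lintegral_add_left_eq_self F (scalarCoord d m (-t))]
    refine lintegral_congr fun ω => ?_
    have e1 : scalarCoord d m t + (scalarCoord d m (-t) + ω) = ω := by
      have : scalarCoord d m t + scalarCoord d m (-t) = 0 := by
        ext <;> simp [scalarCoord]
      rw [← add_assoc, this, zero_add]
    simp only [hF]
    rw [e1, hermitian_add hb, hermitian_scalarCoord, realify_add, realify_smul, realify_one,
      spectralProd_smul_one_add, spectralProd_mul, mul_comm]
  rw [← h3, h1, ← mul_assoc, ← ENNReal.ofReal_mul (inv_nonneg.2 hJ.le)]
  have : (congruenceJacobian hb y)⁻¹ * (|LinearMap.det (congruence hb y)| *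
      (realify b (rootFrame b (toVec b y))).det ^ 2) = 1 := inv_mul_cancel₀ hJ.ne'
  rw [this, ENNReal.ofReal_one, one_mul]

/-! ### Integration over bordered Hermitian matrices -/

/-- The coordinates contain the first row `y`; the first column is its conjugate. -/
theorem hermitian_glue {m : ℕ} (a : ℝ) (y : Fin m → Fin d → ℝ) (D : Coord d m) :
    hermitian b (glue a y D) = bordered a (star (toVec b y)) (hermitian b D) := by
  ext i j
  induction i using Fin.cases with
  | zero =>
    induction j using Fin.cases with
    | zero => simp [hermitian_apply_self, glue, bordered_zero_zero]
    | succ j =>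
      rw [hermitian_apply_of_lt _ _ (Fin.succ_pos j), bordered_zero_succ, Pi.star_apply, star_star]
      have : (upperEquiv m).symm ⟨(0, j.succ), Fin.succ_pos j⟩ = Sum.inl j :=
        (upperEquiv m).symm_apply_eq.2 rfl
      simp [glue, this, toVec]
  | succ i =>
    induction j using Fin.cases with
    | zero =>
      rw [hermitian_apply_of_gt _ _ (Fin.succ_pos i), bordered_succ_zero, Pi.star_apply]
      have : (upperEquiv m).symm ⟨(0, i.succ), Fin.succ_pos i⟩ = Sum.inl i :=
        (upperEquiv m).symm_apply_eq.2 rfl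
      simp [glue, this, toVec]
    | succ j =>
      rw [bordered_succ_succ]
      have key : ∀ {i j : Fin m} (h : i < j), (upperEquiv m).symm
          ⟨(i.succ, j.succ), Fin.succ_lt_succ_iff.2 h⟩ = Sum.inr ⟨(i, j), h⟩ := fun h =>
        (upperEquiv m).symm_apply_eq.2 rfl
      rcases lt_trichotomy i j with h | rfl | h
      · rw [hermitian_apply_of_lt _ _ h, hermitian_apply_of_lt _ _ (Fin.succ_lt_succ_iff.2 h)]
        simp [glue, key h]
      · simp [hermitian_apply_self, glue]
      · rw [hermitian_apply_of_gt _ _ h, hermitian_apply_of_gt _ _ (Fin.succ_lt_succ_iff.2 h)]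
        simp [glue, key h]

/-- The involution `star` on vectors, in coordinates. -/
def starCoord (hb : IsOrthonormalStarBasis b re) (m : ℕ) :
    (Fin m → Fin d → ℝ) →ₗ[ℝ] (Fin m → Fin d → ℝ) where
  toFun y := fun i k => b.repr (star (toVec b y i)) k
  map_add' y z := by
    ext i k
    simp [toVec, add_smul, Finset.sum_add_distrib]
  map_smul' r y := by
    ext i k
    simp [toVec, mul_smul, ← Finset.smul_sum, hb.star_smul]

theorem toVec_starCoord (hb : IsOrthonormalStarBasis b re) {m : ℕ} (y : Fin m → Fin d → ℝ) :
    toVec b (starCoord hb m y) = star (toVec b y) :=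
  toVec_repr (star (toVec b y))

theorem starCoord_starCoord (hb : IsOrthonormalStarBasis b re) {m : ℕ}
    (y : Fin m → Fin d → ℝ) : starCoord hb m (starCoord hb m y) = y := by
  funext i k
  show b.repr (star (toVec b (starCoord hb m y) i)) k = y i k
  rw [toVec_starCoord, Pi.star_apply, star_star, repr_toVec]

theorem lintegral_starCoord (hb : IsOrthonormalStarBasis b re) {m : ℕ}
    {F : (Fin m → Fin d → ℝ) → ℝ≥0∞} (hF : Measurable F) :
    ∫⁻ y, F (starCoord hb m y) = ∫⁻ y, F y := by
  have h1 : LinearMap.det (starCoord hb m) * LinearMap.det (starCoord hb m) = 1 := by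
    rw [← LinearMap.det_comp]
    have : starCoord hb m ∘ₗ starCoord hb m = LinearMap.id := by
      exact LinearMap.ext fun y => starCoord_starCoord hb y
    rw [this, LinearMap.det_id]
  have h2 : |LinearMap.det (starCoord hb m)| = 1 := by
    rcases mul_self_eq_one_iff.1 h1 with h | h <;> simp [h]
  have h3 : LinearMap.det (starCoord hb m) ≠ 0 := fun h => by simp [h] at h1
  rw [lintegral_comp_linearMap volume h3 hF, h2, ENNReal.ofReal_one, one_mul]

end Recursion

/-! ### Splitting off the largest eigenvalue -/

/-- Flattening of the real coordinates of a vector over `K`. -/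
def flatten (m d : ℕ) : (Fin m → Fin d → ℝ) ≃ₗ[ℝ] (Fin m × Fin d → ℝ) :=
  (LinearEquiv.curry ℝ ℝ (Fin m) (Fin d)).symm

theorem flatten_apply {d m : ℕ} (y : Fin m → Fin d → ℝ) (p : Fin m × Fin d) :
    flatten m d y p = y p.1 p.2 := rfl

theorem realify_mulVec_flatten {K : Type} [NormedRing K] [NormedAlgebra ℝ K] {d m : ℕ}
    (b : Basis (Fin d) ℝ K) (M : Matrix (Fin m) (Fin m) K) (y : Fin m → Fin d → ℝ) :
    (realify b M).mulVec (flatten m d y) = fun p => b.repr (M.mulVec (toVec b y) p.1) p.2 := by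
  rw [← realify_mulVec]
  congr 1
  funext p
  rw [flatten_apply, repr_toVec]

theorem toVec_flatten_symm_mulVec {K : Type} [NormedRing K] [NormedAlgebra ℝ K] {d m : ℕ}
    (b : Basis (Fin d) ℝ K) (M : Matrix (Fin m) (Fin m) K)
    (y : Fin m → Fin d → ℝ) :
    toVec b ((flatten m d).symm ((realify b M).mulVec (flatten m d y))) =
      M.mulVec (toVec b y) := by
  rw [realify_mulVec_flatten]
  exact toVec_repr _

section Recursion

variable {K : Type} [NormedRing K] [NormedAlgebra ℝ K] [StarRing K] {d : ℕ}
  {b : Basis (Fin d) ℝ K} {re : K →ₗ[ℝ] ℝ}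

theorem algebraMap_flatten_dotProduct (hb : IsOrthonormalStarBasis b re) {m : ℕ}
    {M : Matrix (Fin m) (Fin m) K} (hM : M.IsHermitian) (y : Fin m → Fin d → ℝ) :
    algebraMap ℝ K (flatten m d y ⬝ᵥ (realify b M).mulVec (flatten m d y)) =
      star (toVec b y) ⬝ᵥ M.mulVec (toVec b y) := by
  have hstar : star (star (toVec b y) ⬝ᵥ M.mulVec (toVec b y)) =
      star (toVec b y) ⬝ᵥ M.mulVec (toVec b y) := by
    simp only [dotProduct, Matrix.mulVec, star_sum, star_mul, Pi.star_apply, star_star,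
      Finset.mul_sum]
    rw [Finset.sum_comm]
    refine Finset.sum_congr rfl fun i _ => Finset.sum_congr rfl fun j _ => ?_
    rw [hM.apply, mul_assoc]
  rw [hb.eq_algebraMap _ hstar]
  congr 1
  simp only [dotProduct, map_sum, Pi.star_apply, hb.re_star_mul_eq_sum, Fintype.sum_prod_type,
    realify_mulVec_flatten, flatten_apply, repr_toVec]

/-- The integrand after the change of variables: `t` is the largest eigenvalue, `(1, y)` its
eigenvector and `D` the lower right block. -/
def deflatedIntegrand (hb : IsOrthonormalStarBasis b re) (φ : ℝ → ℝ≥0∞) {m : ℕ} (t : ℝ)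
    (y : Fin m → Fin d → ℝ) (D : Coord d m) : ℝ≥0∞ :=
  ENNReal.ofReal (1 + flatten m d y ⬝ᵥ flatten m d y) * φ t ^ d *
    (spectralProd negAbs (realify b (hermitian b (scalarCoord d m (-t) + D))) *
      spectralProd φ (realify b (hermitian b
        (scalarCoord d m t + congruence hb y (scalarCoord d m (-t) + D)))))

theorem measurable_deflatedIntegrand (hb : IsOrthonormalStarBasis b re) {φ : ℝ → ℝ≥0∞}
    (hφ : SpectrallyMeasurable b φ) (m : ℕ) :
    Measurable fun q : ℝ × (Fin m → Fin d → ℝ) × Coord d m =>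
      deflatedIntegrand hb φ q.1 q.2.1 q.2.2 := by
  have : OpensMeasurableSpace (ℝ × (Fin m → Fin d → ℝ) × Coord d m) := Prod.opensMeasurableSpace
  have hs : Continuous (scalarCoord d m) := continuous_scalarCoord m
  have hc := continuous_congruence hb m
  have h1 : Continuous fun q : ℝ × (Fin m → Fin d → ℝ) × Coord d m =>
      scalarCoord d m (-q.1) + q.2.2 := by fun_prop
  have h2 : Continuous fun q : ℝ × (Fin m → Fin d → ℝ) × Coord d m =>
      scalarCoord d m q.1 + congruence hb q.2.1 (scalarCoord d m (-q.1) + q.2.2) :=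
    (hs.comp continuous_fst).add (hc.comp (g := fun q : (Fin m → Fin d → ℝ) × Coord d m =>
      congruence hb q.1 q.2) (f := fun q : ℝ × (Fin m → Fin d → ℝ) × Coord d m =>
        (q.2.1, scalarCoord d m (-q.1) + q.2.2)) (by fun_prop))
  have h3 : Measurable fun q : ℝ × (Fin m → Fin d → ℝ) × Coord d m =>
      ENNReal.ofReal (1 + flatten m d q.2.1 ⬝ᵥ flatten m d q.2.1) := by
    simp only [dotProduct, flatten_apply]
    fun_prop
  have h4 : Measurable fun q : ℝ × (Fin m → Fin d → ℝ) × Coord d m => φ q.1 ^ d :=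
    (hφ.measurable.comp measurable_fst).pow_const d
  exact (h3.mul h4).mul
    ((((spectrallyMeasurable_negAbs hb).measurable_spectralProd m).comp h1.measurable).mul
      ((hφ.measurable_spectralProd m).comp h2.measurable))

/-- The change of variables from the border of a matrix to its largest eigenvalue and the
corresponding eigenvector. The condition that `t` exceeds all eigenvalues of `D` is contained in
`deflatedIntegrand`, through the factor `negAbs`. -/
theorem lintegral_bordered_eq (hb : IsOrthonormalStarBasis b re) {φ : ℝ → ℝ≥0∞}
    (hφ : SpectrallyMeasurable b φ) {m : ℕ} (D : Coord d m) :
    ∫⁻ y : Fin m → Fin d → ℝ, ∫⁻ a : ℝ,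
        spectralProd φ (realify b (hermitian b (glue a y D))) =
      ∫⁻ t : ℝ, ∫⁻ y : Fin m → Fin d → ℝ, deflatedIntegrand hb φ t y D := by
  have hD := isHermitian_hermitian hb D
  have hA := hb.realify_isHermitian hD
  have hgm := measurable_glue d m
  have hm1 : Measurable fun q : (Fin m → Fin d → ℝ) × ℝ =>
      spectralProd φ (realify b (hermitian b (glue q.2 q.1 D))) :=
    (hφ.measurable_spectralProd (m + 1)).comp
      (hgm.comp (f := fun q : (Fin m → Fin d → ℝ) × ℝ => (q.2, q.1, D)) (by fun_prop))
  rw [← lintegral_starCoord hb hm1.lintegral_prod_right']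
  have hglue : ∀ a y, hermitian b (glue a (starCoord hb m y) D) =
      bordered a (toVec b y) (hermitian b D) := by
    intro a y
    rw [hermitian_glue, toVec_starCoord, star_star]
  simp only [hglue]
  have hsm : Measurable (starCoord hb m) :=
    ((starCoord hb m).continuous_of_finiteDimensional).measurable
  have hG : Measurable (Function.uncurry fun (a : ℝ) (y : Fin m → Fin d → ℝ) =>
      spectralProd φ (realify b (bordered a (toVec b y) (hermitian b D)))) := by
    simp only [Function.uncurry_def, ← hglue]
    exact hm1.comp (f := fun q : ℝ × (Fin m → Fin d → ℝ) => (starCoord hb m q.2, q.1))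
      (by fun_prop)
  rw [lintegral_border volume (flatten m d) hA hG]
  have hset : MeasurableSet {t : ℝ | (t • (1 : Matrix (Fin m × Fin d) (Fin m × Fin d) ℝ) -
      realify b (hermitian b D)).PosDef} := by
    have : {t : ℝ | (t • (1 : Matrix (Fin m × Fin d) (Fin m × Fin d) ℝ) -
        realify b (hermitian b D)).PosDef} = {t | ∀ i, hA.eigenvalues i < t} := by
      ext t; exact posDef_smul_one_sub_iff hA t
    rw [this, Set.ofPred_forall]
    exact MeasurableSet.iInter fun i => measurableSet_lt measurable_const measurable_id
  rw [← lintegral_indicator hset]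
  refine lintegral_congr fun t => ?_
  have hshift : realify b (hermitian b (scalarCoord d m (-t) + D)) =
      -(t • (1 : Matrix (Fin m × Fin d) (Fin m × Fin d) ℝ) - realify b (hermitian b D)) := by
    rw [hermitian_add hb, hermitian_scalarCoord, realify_add, realify_smul, realify_one, neg_smul]
    abel
  have hsub : t • (1 : Matrix (Fin m × Fin d) (Fin m × Fin d) ℝ) - realify b (hermitian b D) =
      realify b (t • (1 : Matrix (Fin m) (Fin m) K) - hermitian b D) := by
    rw [realify_sub, realify_smul, realify_one]
  have hN : spectralProd negAbs (realify b (hermitian b (scalarCoord d m (-t) + D))) =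
      ENNReal.ofReal |(t • (1 : Matrix (Fin m × Fin d) (Fin m × Fin d) ℝ) -
        realify b (hermitian b D)).det| *
      {M : Matrix (Fin m × Fin d) (Fin m × Fin d) ℝ | (-M).PosDef}.indicator 1
        (realify b (hermitian b (scalarCoord d m (-t) + D))) := by
    rw [spectralProd_negAbs (hb.realify_isHermitian (isHermitian_hermitian hb _)), hshift,
      Matrix.det_neg, abs_mul, abs_pow, abs_neg, abs_one, one_pow, one_mul]
  by_cases ht : (t • (1 : Matrix (Fin m × Fin d) (Fin m × Fin d) ℝ) -
      realify b (hermitian b D)).PosDef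
  · have ht' : t ∈ {t : ℝ | (t • (1 : Matrix (Fin m × Fin d) (Fin m × Fin d) ℝ) -
        realify b (hermitian b D)).PosDef} := ht
    rw [Set.indicator_of_mem ht']
    refine lintegral_congr fun y => ?_
    rw [Set.indicator_of_mem (by rw [hshift, Set.mem_ofPred_eq, neg_neg]; exact ht), Pi.one_apply,
      mul_one] at hN
    have hherm : (t • (1 : Matrix (Fin m) (Fin m) K) - hermitian b D).IsHermitian := by
      rw [← hermitian_scalarCoord (b := b), ← hermitian_sub hb]
      exact isHermitian_hermitian hb _
    rw [deflatedIntegrand, hN]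
    have hbord := spectralProd_bordered φ hD hb (toVec b y) t _
      (algebraMap_flatten_dotProduct hb hherm y)
    have hcong : t • (1 : Matrix (Fin m) (Fin m) K) + rootFrame b (toVec b y) *
        (hermitian b D - t • (1 : Matrix (Fin m) (Fin m) K)) *
          (rootFrame b (toVec b y)).conjTranspose =
        hermitian b (scalarCoord d m t + congruence hb y (scalarCoord d m (-t) + D)) := by
      rw [hermitian_add hb, hermitian_congruence, hermitian_add hb, hermitian_scalarCoord,
        hermitian_scalarCoord, neg_smul, neg_add_eq_sub]
    rw [hcong] at hbord
    rw [hsub, toVec_flatten_symm_mulVec, hbord, ENNReal.ofReal_mul (abs_nonneg _)]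
    ring
  · have ht' : t ∉ {t : ℝ | (t • (1 : Matrix (Fin m × Fin d) (Fin m × Fin d) ℝ) -
        realify b (hermitian b D)).PosDef} := ht
    rw [Set.indicator_of_notMem ht']
    rw [Set.indicator_of_notMem (by rw [hshift, Set.mem_ofPred_eq, neg_neg]; exact ht),
      mul_zero] at hN
    simp [deflatedIntegrand, hN]

/-- Splitting off the largest eigenvalue `t`: the remaining matrix, of size `m`, enters through the
Jacobian factor `|det (Q - t)|` and the condition that all its eigenvalues are less than `t`. The
constant, an integral over the directions of the eigenvector, does not depend on `φ`. -/
theorem exists_lintegral_spectralProd_succ (hb : IsOrthonormalStarBasis b re) (m : ℕ) :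
    ∃ C : ℝ≥0∞, ∀ φ, SpectrallyMeasurable b φ →
      ∫⁻ ω : Coord d (m + 1), spectralProd φ (realify b (hermitian b ω)) =
        C * ∫⁻ t : ℝ, φ t ^ d * ∫⁻ ω : Coord d m,
          spectralProd (fun x => φ x * negAbs (-t + x)) (realify b (hermitian b ω)) := by
  set c : (Fin m → Fin d → ℝ) → ℝ≥0∞ := fun y =>
    ENNReal.ofReal (1 + flatten m d y ⬝ᵥ flatten m d y) *
      ENNReal.ofReal (congruenceJacobian hb y)⁻¹ with hc
  have hcm : Measurable c := by
    have h1 : Measurable fun y : Fin m → Fin d → ℝ =>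
        ENNReal.ofReal (1 + flatten m d y ⬝ᵥ flatten m d y) := by
      simp only [dotProduct, flatten_apply]
      fun_prop
    exact h1.mul (continuous_congruenceJacobian hb m).measurable.inv.ennreal_ofReal
  refine ⟨∫⁻ y, c y, fun φ hφ => ?_⟩
  have hmeas := measurable_deflatedIntegrand hb hφ m
  have hm1 : Measurable fun q : (Coord d m × ℝ) × (Fin m → Fin d → ℝ) =>
      deflatedIntegrand hb φ q.1.2 q.2 q.1.1 :=
    hmeas.comp (f := fun q : (Coord d m × ℝ) × (Fin m → Fin d → ℝ) => (q.1.2, q.2, q.1.1))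
      (by fun_prop)
  have hm2 : ∀ t, Measurable fun q : Coord d m × (Fin m → Fin d → ℝ) =>
      deflatedIntegrand hb φ t q.2 q.1 := fun t =>
    hmeas.comp (f := fun q : Coord d m × (Fin m → Fin d → ℝ) => (t, q.2, q.1)) (by fun_prop)
  have hinner : ∀ t y, ∫⁻ D : Coord d m, deflatedIntegrand hb φ t y D =
      c y * (φ t ^ d * ∫⁻ ω : Coord d m,
        spectralProd (fun x => φ x * negAbs (-t + x)) (realify b (hermitian b ω))) := by
    intro t y
    -- translate `D` by the scalar matrix `-t`
    have hs := lintegral_add_left_eq_self (μ := (volume : Measure (Coord d m)))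
      (fun E : Coord d m => ENNReal.ofReal (1 + flatten m d y ⬝ᵥ flatten m d y) * φ t ^ d *
        (spectralProd negAbs (realify b (hermitian b E)) * spectralProd φ (realify b (hermitian b
          (scalarCoord d m t + congruence hb y E))))) (scalarCoord d m (-t))
    refine hs.trans ?_
    rw [lintegral_const_mul, lintegral_congruence hb hφ y t]
    · simp only [hc]; ring
    · have h1 : Continuous fun E : Coord d m => scalarCoord d m t + congruence hb y E :=
        continuous_const.add (congruence hb y).continuous_of_finiteDimensional
      exact ((spectrallyMeasurable_negAbs hb).measurable_spectralProd m).mul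
        ((hφ.measurable_spectralProd m).comp h1.measurable)
  have hJ : Measurable fun t : ℝ => φ t ^ d * ∫⁻ ω : Coord d m,
      spectralProd (fun x => φ x * negAbs (-t + x)) (realify b (hermitian b ω)) := by
    refine (hφ.measurable.pow_const d).mul ?_
    have hsplit : ∀ t (ω : Coord d m),
        spectralProd (fun x => φ x * negAbs (-t + x)) (realify b (hermitian b ω)) =
          spectralProd φ (realify b (hermitian b ω)) *
            spectralProd negAbs (realify b (hermitian b (scalarCoord d m (-t) + ω))) := by
      intro t ω
      rw [spectralProd_mul, hermitian_add hb, hermitian_scalarCoord, realify_add, realify_smul,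
        realify_one, spectralProd_smul_one_add]
    simp only [hsplit]
    have h1 : Continuous fun q : ℝ × Coord d m => scalarCoord d m (-q.1) + q.2 := by
      have := continuous_scalarCoord (d := d) m
      fun_prop
    exact (((hφ.measurable_spectralProd m).comp measurable_snd).mul
      (((spectrallyMeasurable_negAbs hb).measurable_spectralProd m).comp
        h1.measurable)).lintegral_prod_right'
  calc ∫⁻ ω : Coord d (m + 1), spectralProd φ (realify b (hermitian b ω))
      = ∫⁻ D : Coord d m, ∫⁻ t : ℝ, ∫⁻ y : Fin m → Fin d → ℝ, deflatedIntegrand hb φ t y D := by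
        rw [lintegral_coord_succ (hφ.measurable_spectralProd (m + 1))]
        exact lintegral_congr fun D => lintegral_bordered_eq hb hφ D
    _ = ∫⁻ t : ℝ, ∫⁻ D : Coord d m, ∫⁻ y : Fin m → Fin d → ℝ, deflatedIntegrand hb φ t y D :=
        lintegral_lintegral_swap hm1.lintegral_prod_right'.aemeasurable
    _ = ∫⁻ t : ℝ, ∫⁻ y : Fin m → Fin d → ℝ, ∫⁻ D : Coord d m, deflatedIntegrand hb φ t y D :=
        lintegral_congr fun t => lintegral_lintegral_swap (hm2 t).aemeasurable
    _ = _ := by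
        simp only [hinner]
        simp only [lintegral_mul_const _ hcm]
        rw [lintegral_const_mul _ hJ]

/-! ### The Weyl integration formula -/

/-- The integral of a product function against `∏_{i < j} |x_j - x_i| ^ d`. -/
def vandermondeIntegral (d m : ℕ) (φ : ℝ → ℝ≥0∞) : ℝ≥0∞ :=
  ∫⁻ x : Fin m → ℝ, ENNReal.ofReal (absVandermonde d x) * ∏ i, φ (x i) ^ d

theorem measurable_negAbs : Measurable negAbs := by
  unfold negAbs
  exact (by fun_prop : Measurable fun x : ℝ => ENNReal.ofReal |x|).mul
    (measurable_one.indicator measurableSet_Iio)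

theorem measurable_vandermondeIntegral_mul_negAbs {d : ℕ} (hd : d ≠ 0) (m : ℕ) {φ : ℝ → ℝ≥0∞}
    (hφ : Measurable φ) :
    Measurable fun t : ℝ => vandermondeIntegral d m fun x => φ x * negAbs (-t + x) := by
  have hd' : (0 : ℝ) < d := by positivity
  have h1 : Measurable fun q : ℝ × (Fin m → ℝ) => ENNReal.ofReal (absVandermonde d q.2) :=
    ((continuous_absVandermonde hd' m).measurable.comp measurable_snd).ennreal_ofReal
  have h2 : Measurable fun q : ℝ × (Fin m → ℝ) =>
      ∏ i, (φ (q.2 i) * negAbs (-q.1 + q.2 i)) ^ d := by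
    refine Finset.measurable_fun_prod _ fun i _ => Measurable.pow_const ?_ d
    exact (hφ.comp (f := fun q : ℝ × (Fin m → ℝ) => q.2 i) (by fun_prop)).mul
      (measurable_negAbs.comp (f := fun q : ℝ × (Fin m → ℝ) => -q.1 + q.2 i) (by fun_prop))
  exact (h1.mul h2).lintegral_prod_right'

/-- Splitting off the largest coordinate `t`. This is the recursion of
`exists_lintegral_spectralProd_succ`, with another constant. -/
theorem vandermondeIntegral_succ {d : ℕ} (hd : d ≠ 0) (m : ℕ) {φ : ℝ → ℝ≥0∞}
    (hφ : Measurable φ) :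
    vandermondeIntegral d (m + 1) φ = (m + 1 : ℕ) *
      ∫⁻ t, φ t ^ d * vandermondeIntegral d m fun x => φ x * negAbs (-t + x) := by
  have hd' : (0 : ℝ) < d := by positivity
  have hg : Measurable fun x : Fin (m + 1) → ℝ =>
      ENNReal.ofReal (absVandermonde d x) * ∏ i, φ (x i) ^ d :=
    (continuous_absVandermonde hd' _).measurable.ennreal_ofReal.mul
      (Finset.measurable_fun_prod _ fun i _ => (hφ.comp (measurable_pi_apply i)).pow_const d)
  have hsymm : ∀ (σ : Equiv.Perm (Fin (m + 1))) (x : Fin (m + 1) → ℝ),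
      ENNReal.ofReal (absVandermonde d (x ∘ σ)) * ∏ i, φ ((x ∘ σ) i) ^ d =
        ENNReal.ofReal (absVandermonde d x) * ∏ i, φ (x i) ^ d := by
    intro σ x
    rw [absVandermonde_comp_perm]
    congr 1
    exact Equiv.prod_comp σ fun i => φ (x i) ^ d
  rw [vandermondeIntegral, lintegral_eq_mul_lintegral_argmin hg hsymm (u := fun s => -s)
    measurable_neg (fun c => by simp [neg_eq_iff_eq_neg])]
  congr 1
  refine lintegral_congr fun t => ?_
  have hm : Measurable fun x : Fin m → ℝ => ENNReal.ofReal (absVandermonde d x) *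
      ∏ i, (φ (x i) * negAbs (-t + x i)) ^ d := by
    refine (continuous_absVandermonde hd' _).measurable.ennreal_ofReal.mul
      (Finset.measurable_fun_prod _ fun i _ => Measurable.pow_const ?_ d)
    exact (hφ.comp (measurable_pi_apply i)).mul (measurable_negAbs.comp (by fun_prop))
  rw [vandermondeIntegral, ← lintegral_const_mul _ hm]
  refine lintegral_congr fun x => ?_
  by_cases hx : x ∈ {x : Fin m → ℝ | ∀ j, -t < -x j}
  · rw [Set.indicator_of_mem hx, absVandermonde_cons, Fin.prod_univ_succ,
      ENNReal.ofReal_mul (Finset.prod_nonneg fun _ _ => by positivity),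
      ENNReal.ofReal_prod_of_nonneg (fun _ _ => by positivity)]
    simp only [Fin.cons_zero, Fin.cons_succ, mul_pow, Finset.prod_mul_distrib]
    have h1 : ∏ j, ENNReal.ofReal (|x j - t| ^ (d : ℝ)) = ∏ j, negAbs (-t + x j) ^ d := by
      refine Finset.prod_congr rfl fun j _ => ?_
      have hj : x j < t := neg_lt_neg_iff.1 (hx j)
      rw [negAbs, Set.indicator_of_mem (by simp; linarith), Pi.one_apply, mul_one,
        Real.rpow_natCast, ENNReal.ofReal_pow (abs_nonneg _), neg_add_eq_sub]
    rw [h1]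
    ring
  · rw [Set.indicator_of_notMem hx]
    have : ∃ j, ¬ x j < t := by
      by_contra! H
      exact hx fun j => neg_lt_neg (H j)
    obtain ⟨j, hj⟩ := this
    have h0 : ∏ i, (φ (x i) * negAbs (-t + x i)) ^ d = 0 := by
      refine Finset.prod_eq_zero (Finset.mem_univ j) ?_
      rw [negAbs, Set.indicator_of_notMem (by simp; linarith), mul_zero, mul_zero, zero_pow hd]
    rw [h0, mul_zero, mul_zero]

/-- The Weyl integration formula for product functions of the eigenvalues, up to a constant. In
the real representation of a Hermitian matrix over `K` each eigenvalue is repeated `d` times. -/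
theorem exists_lintegral_spectralProd (hb : IsOrthonormalStarBasis b re) (hd : d ≠ 0) (n : ℕ) :
    ∃ C : ℝ≥0∞, ∀ φ, SpectrallyMeasurable b φ →
      ∫⁻ ω : Coord d n, spectralProd φ (realify b (hermitian b ω)) =
        C * vandermondeIntegral d n φ := by
  induction n with
  | zero =>
    refine ⟨1, fun φ _ => ?_⟩
    have h1 : ∀ ω : Coord d 0, spectralProd φ (realify b (hermitian b ω)) = 1 := by
      intro ω
      rw [spectralProd_eq_prod_eigenvalues φ
        (hb.realify_isHermitian (isHermitian_hermitian hb ω))]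
      simp
    have h2 : (volume : Measure (Coord d 0)) Set.univ = 1 := by
      rw [Measure.volume_eq_prod, ← Set.univ_prod_univ, Measure.prod_prod]
      simp [volume_pi]
    have h3 : (volume : Measure (Fin 0 → ℝ)) Set.univ = 1 := by simp [volume_pi]
    simp only [h1, vandermondeIntegral, absVandermonde]
    simp [h2, h3]
  | succ m ih =>
    obtain ⟨C₀, hC₀⟩ := ih
    obtain ⟨C, hC⟩ := exists_lintegral_spectralProd_succ hb m
    refine ⟨C * C₀ * ((m + 1 : ℕ) : ℝ≥0∞)⁻¹, fun φ hφ => ?_⟩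
    have hneg : ∀ t, SpectrallyMeasurable b fun x => φ x * negAbs (-t + x) := fun t =>
      hφ.mul ((spectrallyMeasurable_negAbs hb).comp_sub hb t)
    rw [hC φ hφ, vandermondeIntegral_succ hd m hφ.measurable, ← mul_assoc,
      mul_assoc (C * C₀), ENNReal.inv_mul_cancel (by simp) (ENNReal.natCast_ne_top _), mul_one,
      mul_assoc]
    congr 1
    simp only [hC₀ _ (hneg _)]
    rw [← lintegral_const_mul]
    · exact lintegral_congr fun t => by ring
    · exact (hφ.measurable.pow_const d).mul (measurable_vandermondeIntegral_mul_negAbs hd m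
        hφ.measurable)

end Recursion

/-! ### The Gaussian density -/

theorem pi_withDensity_ofReal {ι α : Type*} [Fintype ι] [MeasurableSpace α] (ν : Measure α)
    [SigmaFinite ν] {p : α → ℝ} (hp : Integrable p ν) (h0 : 0 ≤ p) :
    Measure.pi (fun _ : ι => ν.withDensity fun a => ENNReal.ofReal (p a)) =
      (Measure.pi fun _ : ι => ν).withDensity fun x => ENNReal.ofReal (∏ i, p (x i)) := by
  have : IsFiniteMeasure (ν.withDensity fun a => ENNReal.ofReal (p a)) :=
    isFiniteMeasure_withDensity_ofReal hp.2
  refine Measure.pi_eq fun s hs => ?_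
  rw [withDensity_apply _ (MeasurableSet.univ_pi hs), Measure.restrict_pi_pi]
  have hi : ∀ i, Integrable p (ν.restrict (s i)) := fun i => hp.restrict
  rw [← ofReal_integral_eq_lintegral_ofReal (Integrable.fintype_prod hi)
    (Eventually.of_forall fun x => Finset.prod_nonneg fun i _ => h0 _),
    integral_fintype_prod_eq_prod (fun _ : ι => p),
    ENNReal.ofReal_prod_of_nonneg fun i _ => integral_nonneg h0]
  refine Finset.prod_congr rfl fun i _ => ?_
  rw [withDensity_apply _ (hs i), ofReal_integral_eq_lintegral_ofReal (hi i)
    (Eventually.of_forall h0)]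

instance isProbabilityMeasure_gaussianEnsemble (d n : ℕ) :
    IsProbabilityMeasure (gaussianEnsemble d n) := by
  unfold gaussianEnsemble
  infer_instance

theorem gaussianPDFReal_zero_inv {c : ℝ≥0} (x : ℝ) :
    gaussianPDFReal 0 c⁻¹ x = (√(2 * Real.pi * (c⁻¹ : ℝ≥0)))⁻¹ * Real.exp (-(c / 2) * x ^ 2) := by
  rw [gaussianPDFReal]
  congr 2
  rw [sub_zero, NNReal.coe_inv, neg_div, neg_mul, neg_inj]
  by_cases hc : (c : ℝ) = 0
  · simp [hc]
  · field_simp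

theorem exists_gaussianEnsemble_eq {d : ℕ} (hd : d ≠ 0) (n : ℕ) :
    ∃ c : ℝ≥0∞, gaussianEnsemble d n = c • (volume : Measure (Coord d n)).withDensity
      fun ω => ENNReal.ofReal (Real.exp (-(d / 2) *
        (∑ i, ω.1 i ^ 2 + 2 * ∑ p, ∑ k, ω.2 p k ^ 2))) := by
  have hd1 : (d : ℝ≥0)⁻¹ ≠ 0 := by positivity
  have hd2 : (2 * (d : ℝ≥0))⁻¹ ≠ 0 := by positivity
  obtain ⟨c₁, hc₁, h₁⟩ : ∃ c : ℝ, 0 ≤ c ∧ ∀ x, gaussianPDFReal 0 (d : ℝ≥0)⁻¹ x =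
      c * Real.exp (-(d / 2) * x ^ 2) := by
    refine ⟨_, ?_, fun x => gaussianPDFReal_zero_inv x⟩
    positivity
  obtain ⟨c₂, hc₂, h₂⟩ : ∃ c : ℝ, 0 ≤ c ∧ ∀ x, gaussianPDFReal 0 (2 * (d : ℝ≥0))⁻¹ x =
      c * Real.exp (-(2 * d / 2) * x ^ 2) := by
    refine ⟨_, ?_, fun x => gaussianPDFReal_zero_inv x⟩
    positivity
  have hprod : ∀ v : ℝ≥0, Integrable (fun y : Fin d → ℝ => ∏ k, gaussianPDFReal 0 v (y k)) := by
    intro v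
    exact Integrable.fintype_prod (f := fun _ : Fin d => gaussianPDFReal 0 v)
      fun _ => integrable_gaussianPDFReal 0 v
  have hmeas : ∀ v : ℝ≥0, Measurable (fun y : Fin d → ℝ => ∏ k, gaussianPDFReal 0 v (y k)) :=
    fun v => Finset.measurable_fun_prod _ fun k _ =>
      (measurable_gaussianPDFReal 0 v).comp (measurable_pi_apply k)
  have hpi : ∀ v : ℝ≥0, v ≠ 0 → ∀ ι : Type, ∀ _ : Fintype ι,
      Measure.pi (fun _ : ι => gaussianReal 0 v) = (volume : Measure (ι → ℝ)).withDensity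
        fun y => ENNReal.ofReal (∏ k, gaussianPDFReal 0 v (y k)) := by
    intro v hv ι _
    simp only [gaussianReal_of_var_ne_zero 0 hv]
    exact pi_withDensity_ofReal volume (integrable_gaussianPDFReal 0 v)
      (gaussianPDFReal_nonneg 0 v)
  have hpi2 := pi_withDensity_ofReal (ι := {p : Fin n × Fin n // p.1 < p.2})
    (volume : Measure (Fin d → ℝ)) (hprod (2 * (d : ℝ≥0))⁻¹)
    fun y => Finset.prod_nonneg fun k _ => gaussianPDFReal_nonneg _ _ _
  refine ⟨ENNReal.ofReal ((∏ _i : Fin n, c₁) *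
    ∏ _p : {p : Fin n × Fin n // p.1 < p.2}, ∏ _k : Fin d, c₂), ?_⟩
  rw [gaussianEnsemble, hpi _ hd1, hpi _ hd2, hpi2, prod_withDensity, ← withDensity_smul]
  · congr 1
    funext ω
    simp only [h₁, h₂, Pi.smul_apply, smul_eq_mul]
    rw [← ENNReal.ofReal_mul (by positivity), ← ENNReal.ofReal_mul (by positivity)]
    congr 1
    simp only [Finset.prod_mul_distrib, ← Real.exp_sum]
    rw [mul_mul_mul_comm, ← Real.exp_add]
    congr 2
    simp only [← Finset.mul_sum]
    ring
  · fun_prop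
  · exact (Finset.measurable_fun_prod _ fun k _ =>
      (measurable_gaussianPDFReal 0 _).comp (measurable_pi_apply k)).ennreal_ofReal
  · exact (Finset.measurable_fun_prod _ fun k _ =>
      (hmeas _).comp (measurable_pi_apply k)).ennreal_ofReal

theorem sum_prod_eq_diag_add {n : ℕ} {f : Fin n → Fin n → ℝ} (hf : ∀ i j, f i j = f j i) :
    ∑ i, ∑ j, f i j =
      ∑ i, f i i + 2 * ∑ p : {p : Fin n × Fin n // p.1 < p.2}, f p.1.1 p.1.2 := by
  have h1 : ∑ p : {p : Fin n × Fin n // p.1 < p.2}, f p.1.1 p.1.2 =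
      ∑ i, ∑ j, if i < j then f i j else 0 := by
    rw [← Fintype.sum_prod_type' (fun i j => if i < j then f i j else 0), ← Finset.sum_filter]
    exact (Finset.sum_subtype _ (by simp) fun p : Fin n × Fin n => f p.1 p.2).symm
  have h2 : ∑ i, ∑ j, (if i < j then f i j else 0) = ∑ i, ∑ j, if j < i then f i j else 0 := by
    rw [Finset.sum_comm]
    simp only [hf]
  have h3 : ∑ i, f i i = ∑ i, ∑ j, if i = j then f i j else 0 := by simp
  rw [two_mul, h1]
  nth_rw 2 [h2]
  rw [h3]
  simp only [← Finset.sum_add_distrib]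
  refine Finset.sum_congr rfl fun i _ => Finset.sum_congr rfl fun j _ => ?_
  rcases lt_trichotomy i j with h | h | h
  · simp [h, h.ne, h.le]
  · simp [h]
  · simp [h, h.ne', h.le]

/-- Eigenvalues are detected by the real representation, where determinants are available. -/
theorem isEigenvalue_iff_det_eq_zero {K : Type} [NormedRing K] [NormedAlgebra ℝ K] {d : ℕ}
    (b : Basis (Fin d) ℝ K) {n : ℕ} (Q : Matrix (Fin n) (Fin n) K) (t : ℝ) :
    IsEigenvalue Q t ↔
      (t • (1 : Matrix (Fin n × Fin d) (Fin n × Fin d) ℝ) - realify b Q).det = 0 := by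
  rw [← Matrix.exists_mulVec_eq_zero_iff]
  have key : ∀ y : Fin n → Fin d → ℝ, (t • (1 : Matrix (Fin n × Fin d) (Fin n × Fin d) ℝ) -
      realify b Q).mulVec (flatten n d y) = 0 ↔ Q.mulVec (toVec b y) = t • toVec b y := by
    intro y
    rw [Matrix.sub_mulVec, Matrix.smul_mulVec, Matrix.one_mulVec, sub_eq_zero,
      realify_mulVec_flatten]
    constructor
    · intro h
      funext i
      refine b.ext_elem fun k => ?_
      have := congrFun h (i, k)
      simp only [Pi.smul_apply, flatten_apply, smul_eq_mul] at this
      rw [← this, Pi.smul_apply, map_smul, Finsupp.smul_apply, repr_toVec, smul_eq_mul]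
    · intro h
      funext p
      simp only [h, Pi.smul_apply, map_smul, Finsupp.smul_apply, repr_toVec, flatten_apply]
  constructor
  · rintro ⟨v, hv, h⟩
    refine ⟨flatten n d fun i k => b.repr (v i) k, ?_, (key _).2 (by rw [toVec_repr]; exact h)⟩
    intro h0
    refine hv ?_
    have h1 : (fun i k => b.repr (v i) k) = (0 : Fin n → Fin d → ℝ) :=
      (LinearEquiv.map_eq_zero_iff _).1 h0
    funext i
    exact b.ext_elem fun k => by simpa using congrFun (congrFun h1 i) k
  · rintro ⟨w, hw, h⟩
    obtain ⟨y, rfl⟩ := (flatten n d).surjective w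
    refine ⟨toVec b y, fun h0 => hw ?_, (key y).1 h⟩
    have : y = 0 := by
      funext i k
      rw [← repr_toVec (b := b) y i k, h0]
      simp
    rw [this, map_zero]

/-! ### The eigenvalue distribution of the Gaussian matrix ensembles -/

section Transfer

variable {K : Type} [NormedRing K] [NormedAlgebra ℝ K] [StarRing K] {d : ℕ}
  {b : Basis (Fin d) ℝ K} {re : K →ₗ[ℝ] ℝ}

/-- The involution is an isometry: `star x * x` and `x * star x` are real numbers which agree
because multiplication is associative. -/
theorem IsOrthonormalStarBasis.sum_repr_star_sq (hb : IsOrthonormalStarBasis b re) (x : K) :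
    ∑ k, b.repr (star x) k ^ 2 = ∑ k, b.repr x k ^ 2 := by
  by_cases hx : x = 0
  · simp [hx]
  have h1 := hb.star_mul_self_eq x
  have h2 := hb.star_mul_self_eq (star x)
  rw [star_star] at h2
  have h3 : (∑ k, b.repr (star x) k ^ 2) • x = (∑ k, b.repr x k ^ 2) • x := by
    rw [Algebra.smul_def, ← h2, mul_assoc, h1, ← Algebra.commutes, Algebra.smul_def]
  exact smul_left_injective ℝ hx h3

/-- The exponent of the Gaussian density is `tr Q²`, up to a factor. -/
theorem trace_realify_hermitian_sq (hb : IsOrthonormalStarBasis b re) {n : ℕ} (ω : Coord d n) :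
    (realify b (hermitian b ω) * realify b (hermitian b ω)).trace =
      d * (∑ i, ω.1 i ^ 2 + 2 * ∑ p, ∑ k, ω.2 p k ^ 2) := by
  obtain ⟨A, hAdef⟩ : ∃ A, A = hermitian b ω := ⟨_, rfl⟩
  have hA : A.IsHermitian := hAdef ▸ isHermitian_hermitian hb ω
  rw [← hAdef, ← realify_mul]
  have hdiag : ∀ i, (A * A) i i = algebraMap ℝ K (∑ j, ∑ k, b.repr (A i j) k ^ 2) := by
    intro i
    rw [Matrix.mul_apply, map_sum]
    refine Finset.sum_congr rfl fun j _ => ?_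
    rw [← hb.sum_repr_star_sq, hA.apply, ← hb.star_mul_self_eq, hA.apply]
  have htr : (realify b (A * A)).trace = d * ∑ i, ∑ j, ∑ k, b.repr (A i j) k ^ 2 := by
    simp only [Matrix.trace, Matrix.diag_apply, realify, Matrix.of_apply, Fintype.sum_prod_type,
      hdiag]
    rw [Finset.mul_sum]
    refine Finset.sum_congr rfl fun i _ => ?_
    generalize ∑ j, ∑ k, b.repr (A i j) k ^ 2 = r
    simp [← Algebra.smul_def]
  rw [htr, sum_prod_eq_diag_add fun i j => by rw [← hb.sum_repr_star_sq, hA.apply]]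
  congr 2
  · refine Finset.sum_congr rfl fun i _ => ?_
    rw [hAdef, hermitian_apply_self]
    have h1 := hb.star_mul_self_eq (algebraMap ℝ K (ω.1 i))
    rw [hb.star_algebraMap, ← map_mul] at h1
    have h2 := congrArg re h1
    rw [hb.re_algebraMap, hb.re_algebraMap] at h2
    rw [← h2, sq]
  · congr 1
    refine Finset.sum_congr rfl fun p _ => ?_
    rw [hAdef, hermitian_apply_of_lt b ω p.2]
    refine Finset.sum_congr rfl fun k _ => ?_
    rw [b.repr_sum_self]

/-- The Weyl integration formula with the Gaussian factor inserted. -/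
theorem exists_lintegral_gaussianEnsemble (hb : IsOrthonormalStarBasis b re) (hd : d ≠ 0) (n : ℕ) :
    ∃ c : ℝ≥0∞, ∀ φ, SpectrallyMeasurable b φ →
      ∫⁻ ω, spectralProd φ (realify b (hermitian b ω)) ∂(gaussianEnsemble d n) =
        c * ∫⁻ x : Fin n → ℝ, ENNReal.ofReal (weight d n x) * ∏ i, φ (x i) ^ d := by
  obtain ⟨c, hc⟩ := exists_gaussianEnsemble_eq hd n
  obtain ⟨C, hC⟩ := exists_lintegral_spectralProd hb hd n
  refine ⟨c * C, fun φ hφ => ?_⟩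
  have hg := SpectrallyMeasurable.gaussian hb
  rw [hc, lintegral_smul_measure, lintegral_withDensity_eq_lintegral_mul _ (by fun_prop)
    (hφ.measurable_spectralProd n)]
  have h1 : ∀ ω : Coord d n, ENNReal.ofReal (Real.exp (-(d / 2) *
      (∑ i, ω.1 i ^ 2 + 2 * ∑ p, ∑ k, ω.2 p k ^ 2))) =
        spectralProd (fun x => ENNReal.ofReal (Real.exp (-(1 / 2) * x ^ 2)))
          (realify b (hermitian b ω)) := by
    intro ω
    rw [spectralProd_gaussian (hb.realify_isHermitian (isHermitian_hermitian hb _)),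
      trace_realify_hermitian_sq hb]
    congr 2
    ring
  simp only [Pi.mul_apply, h1, ← spectralProd_mul]
  rw [hC _ (hg.mul hφ), smul_eq_mul, mul_assoc]
  congr 2
  refine lintegral_congr fun x => ?_
  simp only [mul_pow, Finset.prod_mul_distrib]
  rw [← mul_assoc, weight_eq, mul_comm (Real.exp _),
    ENNReal.ofReal_mul (absVandermonde_nonneg _ _)]
  congr 2
  simp only [← ENNReal.ofReal_pow (Real.exp_nonneg _), ← Real.exp_nat_mul]
  rw [← ENNReal.ofReal_prod_of_nonneg fun _ _ => Real.exp_nonneg _, ← Real.exp_sum,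
    Finset.mul_sum]
  congr 2
  exact Finset.sum_congr rfl fun i _ => by ring

/-- The eigenvalues of the matrix ensemble are distributed as the `β`-ensemble, `β = d`. The
constant of the Weyl integration formula is determined by both measures being probability
measures. -/
theorem lintegral_gaussianEnsemble_spectralProd (hb : IsOrthonormalStarBasis b re) (hd : d ≠ 0)
    (n : ℕ) {φ : ℝ → ℝ≥0∞} (hφ : SpectrallyMeasurable b φ) :
    ∫⁻ ω, spectralProd φ (realify b (hermitian b ω)) ∂(gaussianEnsemble d n) =
      ∫⁻ x, ∏ i, φ (x i) ^ d ∂(betaEnsemble d n) := by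
  have hβ : (0 : ℝ) < d := by positivity
  have := isProbabilityMeasure_betaEnsemble hβ n
  obtain ⟨c, hc⟩ := exists_lintegral_gaussianEnsemble hb hd n
  have hbeta : ∀ ψ : ℝ → ℝ≥0∞, Measurable ψ → ∫⁻ x, ∏ i, ψ (x i) ^ d ∂(betaEnsemble d n) =
      ENNReal.ofReal (normConst d n) *
        ∫⁻ x : Fin n → ℝ, ENNReal.ofReal (weight d n x) * ∏ i, ψ (x i) ^ d := by
    intro ψ hψ
    have h1 : Measurable fun x : Fin n → ℝ => ∏ i, ψ (x i) ^ d :=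
      Finset.measurable_fun_prod _ fun i _ => (hψ.comp (measurable_pi_apply i)).pow_const d
    have h2 : Measurable fun x : Fin n → ℝ => ENNReal.ofReal (weight d n x) :=
      (continuous_weight hβ n).measurable.ennreal_ofReal
    rw [betaEnsemble, lintegral_withDensity_eq_lintegral_mul _
      (continuous_jointDensity hβ n).measurable.ennreal_ofReal h1,
      ← lintegral_const_mul (f := fun x : Fin n → ℝ => ENNReal.ofReal (weight d n x) *
        ∏ i, ψ (x i) ^ d) _ (h2.mul h1)]
    refine lintegral_congr fun x => ?_
    rw [Pi.mul_apply, jointDensity, ENNReal.ofReal_mul (normConst_pos hβ n).le, mul_assoc]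
  have h1 := hc _ SpectrallyMeasurable.one
  have h2 := hbeta (fun _ => 1) measurable_const
  simp only [spectralProd_one, one_pow, Finset.prod_const_one, mul_one, lintegral_const,
    measure_univ] at h1 h2
  have h3 : c = ENNReal.ofReal (normConst d n) := by
    calc c = c * (ENNReal.ofReal (normConst d n) *
          ∫⁻ x : Fin n → ℝ, ENNReal.ofReal (weight d n x)) := by rw [← h2, mul_one]
      _ = ENNReal.ofReal (normConst d n) *
          (c * ∫⁻ x : Fin n → ℝ, ENNReal.ofReal (weight d n x)) := by ring
      _ = _ := by rw [← h1, mul_one]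
  rw [hc φ hφ, hbeta φ hφ.measurable, h3]

theorem matrixGap_eq_betaGap (hb : IsOrthonormalStarBasis b re) (hd : d ≠ 0) (n : ℕ) :
    matrixGap b n = betaGap d n := by
  funext ε
  have hσ : IsSigmaCompact ((Set.Ioo (-ε) ε)ᶜ)ᶜ := by
    rw [compl_compl, isSigmaCompact_iff_sigmaCompactSpace]
    have : LocallyCompactSpace (Set.Ioo (-ε) ε) := isOpen_Ioo.locallyCompactSpace
    infer_instance
  have hmeas := measurableSet_forall_det_ne
    (SpectrallyMeasurable.continuous_realify_hermitian hb n) hσ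
  have h := lintegral_gaussianEnsemble_spectralProd hb hd n
    (SpectrallyMeasurable.indicator hb hσ measurableSet_Ioo.compl)
  -- on both sides the gap event is the product of the indicator of the complement of `(-ε, ε)`
  have hset : {ω : Coord d n | ∀ t ∈ Set.Ioo (-ε) ε, ¬ IsEigenvalue (hermitian b ω) t} =
      {ω | ∀ t, t ∉ (Set.Ioo (-ε) ε)ᶜ → (t • (1 : Matrix (Fin n × Fin d) (Fin n × Fin d) ℝ) -
        realify b (hermitian b ω)).det ≠ 0} := by
    ext ω
    simp only [Set.mem_ofPred_eq, Set.mem_compl_iff, not_not,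
      isEigenvalue_iff_det_eq_zero b, ne_eq]
  have h1 : ∀ ω : Coord d n, spectralProd ((Set.Ioo (-ε) ε)ᶜ.indicator 1)
      (realify b (hermitian b ω)) =
        {ω : Coord d n | ∀ t ∈ Set.Ioo (-ε) ε, ¬ IsEigenvalue (hermitian b ω) t}.indicator 1 ω := by
    intro ω
    rw [spectralProd_indicator, hset]
    rfl
  have h2 : ∀ x : Fin n → ℝ, ∏ i, (Set.Ioo (-ε) ε)ᶜ.indicator (1 : ℝ → ℝ≥0∞) (x i) ^ d =
      {x : Fin n → ℝ | ∀ i, x i ∉ Set.Ioo (-ε) ε}.indicator 1 x := by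
    intro x
    by_cases hx : x ∈ {x : Fin n → ℝ | ∀ i, x i ∉ Set.Ioo (-ε) ε}
    · rw [Set.indicator_of_mem hx, Pi.one_apply]
      refine Finset.prod_eq_one fun i _ => ?_
      rw [Set.indicator_of_mem (hx i), Pi.one_apply, one_pow]
    · rw [Set.indicator_of_notMem hx]
      rw [Set.mem_ofPred_eq] at hx
      push Not at hx
      obtain ⟨i, hi⟩ := hx
      refine Finset.prod_eq_zero (Finset.mem_univ i) ?_
      rw [Set.indicator_of_notMem (by simpa using hi), zero_pow hd]
  simp only [h1, h2] at h
  rw [lintegral_indicator_one (hset ▸ hmeas), lintegral_indicator_one (measurableSet_gap n ε)] at h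
  rw [matrixGap, betaGap, Measure.real, Measure.real, h]

theorem integrable_and_integral_abs_det (hb : IsOrthonormalStarBasis b re) (hd : d ≠ 0) (n : ℕ) :
    Integrable (fun ω => |(realify b (hermitian b ω)).det|) (gaussianEnsemble d n) ∧
      ∫ ω, |(realify b (hermitian b ω)).det| ∂(gaussianEnsemble d n) =
        ∫ x, |∏ i, x i| ^ (d : ℝ) ∂(betaEnsemble d n) := by
  have hβ : (0 : ℝ) < d := by positivity
  have h := lintegral_gaussianEnsemble_spectralProd hb hd n (SpectrallyMeasurable.ofReal_abs hb)
  have h1 : ∀ x : Fin n → ℝ, ∏ i, ENNReal.ofReal |x i| ^ d =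
      ENNReal.ofReal (|∏ i, x i| ^ (d : ℝ)) := by
    intro x
    rw [Finset.prod_pow, ← ENNReal.ofReal_prod_of_nonneg fun _ _ => abs_nonneg _,
      ← Finset.abs_prod, Real.rpow_natCast, ENNReal.ofReal_pow (abs_nonneg _)]
  simp only [spectralProd_abs (hb.realify_isHermitian (isHermitian_hermitian hb _)), h1] at h
  have hint := integrable_abs_prod_rpow hβ n
  have hm : Measurable fun ω : Coord d n => |(realify b (hermitian b ω)).det| :=
    (SpectrallyMeasurable.continuous_realify_hermitian hb n).matrix_det.measurable.abs
  have h0 : ∀ x : Fin n → ℝ, 0 ≤ |∏ i, x i| ^ (d : ℝ) := fun x => by positivity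
  constructor
  · refine ⟨hm.aestronglyMeasurable, ?_⟩
    rw [hasFiniteIntegral_iff_ofReal (Eventually.of_forall fun _ => abs_nonneg _), h]
    exact (hasFiniteIntegral_iff_ofReal (Eventually.of_forall h0)).1 hint.2
  · rw [integral_eq_lintegral_of_nonneg_ae (Eventually.of_forall fun _ => abs_nonneg _)
      hm.aestronglyMeasurable, h, integral_eq_lintegral_of_nonneg_ae (Eventually.of_forall h0)
      hint.1]

theorem integrable_and_hasRightDerivAtZero_matrixGap (hb : IsOrthonormalStarBasis b re)
    (hd : d ≠ 0) (m : ℕ) {F : Coord d m → ℝ}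
    (hF : ∀ ω, F ω = |(realify b (hermitian b ω)).det|) :
    Integrable F (gaussianEnsemble d m) ∧
      HasRightDerivAtZero (matrixGap b (m + 1)) (-2 * (m + 1 : ℕ) *
        (normConst d (m + 1) / normConst d m) * ∫ ω, F ω ∂(gaussianEnsemble d m)) := by
  obtain ⟨h1, h2⟩ := integrable_and_integral_abs_det hb hd m
  obtain rfl : F = fun ω => |(realify b (hermitian b ω)).det| := funext hF
  refine ⟨h1, ?_⟩
  rw [h2, matrixGap_eq_betaGap hb hd]
  exact hasRightDerivAtZero_betaGap (by positivity) m

end Transfer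

/-! ### The real, complex and quaternionic cases -/

theorem coe_basis_real : ⇑(Basis.singleton (Fin 1) ℝ) = realBasis := by
  funext i
  fin_cases i
  simp [realBasis]

theorem isOrthonormalStarBasis_real :
    IsOrthonormalStarBasis (Basis.singleton (Fin 1) ℝ) (LinearMap.id : ℝ →ₗ[ℝ] ℝ) where
  star_smul := by simp
  re_one := rfl
  eq_algebraMap := by simp
  re_star_mul := by
    intro i j
    fin_cases i
    fin_cases j
    simp

theorem det_realify_real {n : ℕ} (Q : Matrix (Fin n) (Fin n) ℝ) :
    (realify (Basis.singleton (Fin 1) ℝ) Q).det = Q.det := by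
  rw [← Matrix.det_submatrix_equiv_self (Equiv.prodUnique (Fin n) (Fin 1)) Q]
  congr 1
  ext p q
  simp [realify]

theorem isOrthonormalStarBasis_complex :
    IsOrthonormalStarBasis Complex.basisOneI Complex.reLm where
  star_smul := by simp
  re_one := rfl
  eq_algebraMap := by
    intro x hx
    exact (Complex.conj_eq_iff_re.1 hx).symm
  re_star_mul := by
    intro i j
    fin_cases i <;> fin_cases j <;> simp

/-- Here the index type is arbitrary because the formula is also applied to complexifications. -/
theorem det_realify_complex {ι : Type*} [Fintype ι] [DecidableEq ι] (Q : Matrix ι ι ℂ) :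
    (realify Complex.basisOneI Q).det = ‖Q.det‖ ^ 2 := by
  have h := Matrix.det_det (M := Q)
    (Algebra.leftMulMatrix Complex.basisOneI : ℂ →ₐ[ℝ] Matrix (Fin 2) (Fin 2) ℝ).toRingHom
  have h1 : realify Complex.basisOneI Q = (Q.map
      (Algebra.leftMulMatrix Complex.basisOneI : ℂ →ₐ[ℝ] Matrix (Fin 2) (Fin 2) ℝ).toRingHom).comp
        ι ι (Fin 2) (Fin 2) ℝ := by
    ext p q
    simp only [realify, Matrix.of_apply, Matrix.comp_apply, Matrix.map_apply]
    exact (Algebra.leftMulMatrix_eq_repr_mul Complex.basisOneI _ _ _).symm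
  rw [h1, ← h]
  change (Algebra.leftMulMatrix Complex.basisOneI Q.det).det = _
  rw [← Algebra.norm_eq_matrix_det, Algebra.norm_complex_apply, Complex.normSq_eq_norm_sq]

/-- The real basis `1, i, j, k` of the quaternions. -/
def quaternionBasisOneIJK : Basis (Fin 4) ℝ (Quaternion ℝ) := QuaternionAlgebra.basisOneIJK _ _ _

theorem quaternionBasisOneIJK_repr (q : Quaternion ℝ) :
    ⇑(quaternionBasisOneIJK.repr q) = ![q.re, q.imI, q.imJ, q.imK] := rfl

theorem coe_quaternionBasisOneIJK : ⇑quaternionBasisOneIJK = quaternionBasis := by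
  funext i
  refine quaternionBasisOneIJK.ext_elem fun k => ?_
  rw [quaternionBasisOneIJK.repr_self, quaternionBasisOneIJK_repr]
  fin_cases i <;> fin_cases k <;> simp [quaternionBasis]

/-- The real part of a quaternion, as a real linear map. -/
def quaternionRe : Quaternion ℝ →ₗ[ℝ] ℝ := QuaternionAlgebra.reₗ _ _ _

theorem quaternionRe_apply (q : Quaternion ℝ) : quaternionRe q = q.re := rfl

theorem isOrthonormalStarBasis_quaternion :
    IsOrthonormalStarBasis quaternionBasisOneIJK quaternionRe where
  star_smul := by
    intro r x
    ext <;> simp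
  re_one := rfl
  eq_algebraMap := by
    intro x hx
    exact Quaternion.star_eq_self.1 hx
  re_star_mul := by
    intro i j
    rw [coe_quaternionBasisOneIJK, quaternionRe_apply]
    rw [Quaternion.re_mul, Quaternion.re_star, Quaternion.imI_star, Quaternion.imJ_star,
      Quaternion.imK_star]
    fin_cases i <;> fin_cases j <;> simp [quaternionBasis]

/-- The bijection between the four real coordinates of a quaternion and the two complex
coordinates, each with real and imaginary part, of its complexification. -/
def quaternionIndexEquiv (n : ℕ) : Fin n × Fin 4 ≃ (Fin n ⊕ Fin n) × Fin 2 where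
  toFun p := (![Sum.inl p.1, Sum.inl p.1, Sum.inr p.1, Sum.inr p.1] p.2, ![0, 1, 0, 1] p.2)
  invFun q := Sum.elim (fun i => (i, ![0, 1] q.2)) (fun i => (i, ![2, 3] q.2)) q.1
  left_inv := by
    rintro ⟨i, k⟩
    fin_cases k <;> rfl
  right_inv := by
    rintro ⟨i | i, k⟩ <;> fin_cases k <;> rfl

/-- The real forms of a quaternionic matrix and of its complexification agree up to the sign of
the `j`-coordinate. -/
theorem realify_quaternion {n : ℕ} (Q : Matrix (Fin n) (Fin n) (Quaternion ℝ)) :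
    realify quaternionBasisOneIJK Q =
      Matrix.diagonal (fun p => (![1, 1, -1, 1] : Fin 4 → ℝ) p.2) *
        (realify Complex.basisOneI (complexification Q)).submatrix
          (quaternionIndexEquiv n) (quaternionIndexEquiv n) *
        Matrix.diagonal (fun p => (![1, 1, -1, 1] : Fin 4 → ℝ) p.2) := by
  ext ⟨i, k⟩ ⟨j, l⟩
  rw [Matrix.mul_diagonal, Matrix.diagonal_mul, Matrix.submatrix_apply]
  simp only [realify, Matrix.of_apply, quaternionBasisOneIJK_repr, coe_quaternionBasisOneIJK,
    Quaternion.re_mul, Quaternion.imI_mul, Quaternion.imJ_mul, Quaternion.imK_mul]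
  fin_cases k <;> fin_cases l <;>
    simp [quaternionBasis, quaternionIndexEquiv, complexification]

theorem abs_det_realify_quaternion {n : ℕ} (Q : Matrix (Fin n) (Fin n) (Quaternion ℝ)) :
    |(realify quaternionBasisOneIJK Q).det| = quaternionAbsDet Q ^ (4 : ℝ) := by
  have hs : (Matrix.diagonal (fun p : Fin n × Fin 4 => (![1, 1, -1, 1] : Fin 4 → ℝ) p.2)).det *
      (Matrix.diagonal (fun p : Fin n × Fin 4 => (![1, 1, -1, 1] : Fin 4 → ℝ) p.2)).det = 1 := by
    rw [← Matrix.det_mul, Matrix.diagonal_mul_diagonal, Matrix.det_diagonal]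
    refine Finset.prod_eq_one fun p _ => ?_
    obtain ⟨i, k⟩ := p
    fin_cases k <;> simp
  have h4 : quaternionAbsDet Q ^ (4 : ℝ) = ‖(complexification Q).det‖ ^ 2 := by
    rw [quaternionAbsDet, show (4 : ℝ) = ((4 : ℕ) : ℝ) by norm_num, Real.rpow_natCast,
      show (4 : ℕ) = 2 * 2 by norm_num, pow_mul, Real.sq_sqrt (norm_nonneg _)]
  rw [realify_quaternion, Matrix.det_mul, Matrix.det_mul, mul_right_comm, hs, one_mul,
    Matrix.det_submatrix_equiv_self, det_realify_complex, h4, abs_of_nonneg (by positivity)]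

end GapProbability

theorem mainTheorem1 (n : ℕ) (hn : 1 ≤ n) :
    (∀ β : ℝ, 0 < β →
      IsProbabilityMeasure (GapProbability.betaEnsemble β n) ∧
      Integrable (fun x : Fin (n - 1) → ℝ => |∏ i, x i| ^ β)
        (GapProbability.betaEnsemble β (n - 1)) ∧
      GapProbability.HasRightDerivAtZero (GapProbability.betaGap β n)
        (-2 * n * (GapProbability.normConst β n / GapProbability.normConst β (n - 1)) *
          ∫ x, |∏ i, x i| ^ β ∂(GapProbability.betaEnsemble β (n - 1)))) ∧
    (Integrable (fun ω => |(GapProbability.hermitian GapProbability.realBasis ω).det| ^ (1 : ℝ))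
        (GapProbability.gaussianEnsemble 1 (n - 1)) ∧
      GapProbability.HasRightDerivAtZero (GapProbability.matrixGap GapProbability.realBasis n)
        (-2 * n * (GapProbability.normConst 1 n / GapProbability.normConst 1 (n - 1)) *
          ∫ ω, |(GapProbability.hermitian GapProbability.realBasis ω).det| ^ (1 : ℝ)
            ∂(GapProbability.gaussianEnsemble 1 (n - 1)))) ∧
    (Integrable (fun ω => ‖(GapProbability.hermitian GapProbability.complexBasis ω).det‖ ^ (2 : ℝ))
        (GapProbability.gaussianEnsemble 2 (n - 1)) ∧
      GapProbability.HasRightDerivAtZero (GapProbability.matrixGap GapProbability.complexBasis n)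
        (-2 * n * (GapProbability.normConst 2 n / GapProbability.normConst 2 (n - 1)) *
          ∫ ω, ‖(GapProbability.hermitian GapProbability.complexBasis ω).det‖ ^ (2 : ℝ)
            ∂(GapProbability.gaussianEnsemble 2 (n - 1)))) ∧
    (Integrable (fun ω => GapProbability.quaternionAbsDet
          (GapProbability.hermitian GapProbability.quaternionBasis ω) ^ (4 : ℝ))
        (GapProbability.gaussianEnsemble 4 (n - 1)) ∧
      GapProbability.HasRightDerivAtZero (GapProbability.matrixGap GapProbability.quaternionBasis n)
        (-2 * n * (GapProbability.normConst 4 n / GapProbability.normConst 4 (n - 1)) *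
          ∫ ω, GapProbability.quaternionAbsDet
              (GapProbability.hermitian GapProbability.quaternionBasis ω) ^ (4 : ℝ)
            ∂(GapProbability.gaussianEnsemble 4 (n - 1)))) := by
  obtain ⟨m, rfl⟩ : ∃ m, n = m + 1 := ⟨n - 1, by omega⟩
  rw [Nat.add_sub_cancel]
  refine ⟨fun β hβ => ⟨GapProbability.isProbabilityMeasure_betaEnsemble hβ _,
    GapProbability.integrable_abs_prod_rpow hβ m,
    GapProbability.hasRightDerivAtZero_betaGap hβ m⟩, ?_, ?_, ?_⟩
  · have h := GapProbability.integrable_and_hasRightDerivAtZero_matrixGap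
      GapProbability.isOrthonormalStarBasis_real one_ne_zero m
      (F := fun ω => |(GapProbability.hermitian GapProbability.realBasis ω).det| ^ (1 : ℝ))
      fun ω => by
        rw [GapProbability.det_realify_real, Real.rpow_one, GapProbability.coe_basis_real]
    rwa [GapProbability.coe_basis_real, Nat.cast_one] at h
  · have h := GapProbability.integrable_and_hasRightDerivAtZero_matrixGap
      GapProbability.isOrthonormalStarBasis_complex two_ne_zero m
      (F := fun ω => ‖(GapProbability.hermitian GapProbability.complexBasis ω).det‖ ^ (2 : ℝ))
      fun ω => by
        rw [GapProbability.det_realify_complex, abs_of_nonneg (by positivity), Real.rpow_two,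
          Complex.coe_basisOneI, GapProbability.complexBasis]
    rwa [Complex.coe_basisOneI, Nat.cast_ofNat] at h
  · have h := GapProbability.integrable_and_hasRightDerivAtZero_matrixGap
      GapProbability.isOrthonormalStarBasis_quaternion four_ne_zero m
      (F := fun ω => GapProbability.quaternionAbsDet
        (GapProbability.hermitian GapProbability.quaternionBasis ω) ^ (4 : ℝ))
      fun ω => by
        rw [GapProbability.abs_det_realify_quaternion, GapProbability.coe_quaternionBasisOneIJK]
    rwa [GapProbability.coe_quaternionBasisOneIJK, Nat.cast_ofNat] at h

end
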